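/- Let $d\in\{1,2\}$, $\alpha\in(d,2d)$, $\beta\in\mathbb R$ and $q\ge 1$ an integer. Let $\Omega=(\mathbb S^1)^{\mathbb Z^d}$ with its product $\sigma$-algebra, where $\mathbb S^1\simeq[0,2\pi)$ carries Lebesgue measure $\lambda$ of mass $2\pi$, and let $\Omega'=\{1,\dots,q\}^{\mathbb Z^d}$. Consider the potential $\Phi_{\{x,y\}}(\omega)=\beta|x-y|^{-\alpha}\cos(\omega_x-\omega_y)$ for $x\ne y$ (with $|\cdot|$ the Euclidean norm), $\Phi_A=0$ if $A$ is not a pair, the Hamiltonians $\mathcal H_\Lambda=\sum_{A\cap\Lambda\neq\emptyset}\Phi_A$, and the specification $\gamma$ with, for finite $\Lambda\subset\mathbb Z^d$, $$\gamma_\Lambda(B\mid\eta)=\frac1{Z_\Lambda^\eta}\int \mathbf 1_B(\sigma_\Lambda\eta_{\Lambda^c})\,e^{-\mathcal H_\Lambda(\sigma_\Lambda\eta_{\Lambda^c})}\,\lambda^{\otimes\Lambda}(d\sigma_\Lambda).$$ (Both signs of $\beta$ are allowed; in this convention the ferromagnet corresponds to $\beta<0$.) A specification is a proper, consistent family of probability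 kernels $\gamma_\Lambda$ from $(\Omega,\mathcal F_{\Lambda^c})$ to $(\Omega,\mathcal F)$, for finite $\Lambda$ (likewise on $\Omega'$); a Gibbs measure for it is a probability measure $\mu$ with $\mu(\gamma_\Lambda(B\mid\cdot))=\mu(B)$ for all finite $\Lambda$ and measurable $B$. The set of Gibbs measures is denoted $\mathscr G(\cdot)$. Let $T$ send a spin to the index of the arc containing it among the $q$ arcs $[2\pi(l-1)/q,2\pi l/q)$, $1\le l\le q$; write $T$ also for the map $\Omega\to\Omega'$ acting sitewise, and $[\omega'_\Lambda]=\{\omega: T(\omega)|_\Lambda=\omega'_\Lambda\}$. For $\omega'\in\Omega'$ let $$\gamma^{\omega'}_\Lambda(f\mid\omega)=\frac{\gamma_\Lambda(f\mathbf 1_{[\omega'_\Lambda]}\mid\omega)}{\gamma_\Lambda(\mathbf 1_{[\omega'_\Lambda]}\mid\omega)}.$$ Assume the uniform Dobrushin condition $$\overline c=\sup_x\sum_y\overline C_{xy}<1,\qquad \overline C_{xy}=\sup_{\omega'\in\Omega'}\ \sup_{\substack{\xi_{y^c}=\eta_{y^c}\\ T(\xi)=T(\eta)=\omega'}}\big\|\gamma^{\omega'}_x(\cdot\mid\xi)-\gamma^{\omega'}_x(\cdot\mid\eta)\big\|_{\mathrm{TV}},$$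 where the single-site kernels are regarded as laws of the spin at $x$ and $\|\mu-\nu\|_{\mathrm{TV}}=\sup_A|\mu(A)-\nu(A)|$. Then for every finite $\Lambda\subset\mathbb Z^d$ and every $\omega'_{\Lambda^c}\in\{1,\dots,q\}^{\Lambda^c}$ there is exactly one Gibbs measure $\mu_{\Lambda^c}[\omega'_{\Lambda^c}]$ on $(\mathbb S^1)^{\Lambda^c}$ for the constrained specification on $\Lambda^c$ obtained as above from the potential in which all $\Phi_A$ with $A\cap\Lambda\neq\emptyset$ are dropped. Moreover $$\gamma'_\Lambda(\omega'_\Lambda\mid\omega'_{\Lambda^c})=\frac{\mu_{\Lambda^c}[\omega'_{\Lambda^c}]\big(\lambda^{\otimes\Lambda}(e^{-\mathcal H_\Lambda}\mathbf 1_{[\omega'_\Lambda]})\big)}{\mu_{\Lambda^c}[\omega'_{\Lambda^c}]\big(\lambda^{\otimes\Lambda}(e^{-\mathcal H_\Lambda})\big)}$$ defines a specification $\gamma'=(\gamma'_\Lambda)_\Lambda$ on $\Omega'$, and for every $\mu\in\mathscr G(\gamma)$ the image measure $\mu'=\mu\circ T^{-1}$ is a Gibbs measure for $\gamma'$. -/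

import Mathlib

open MeasureTheory ProbabilityTheory
open scoped ENNReal

noncomputable section

namespace DiscretisedGibbs

/-! ### Configurations, specifications and Gibbs measures -/

section General

variable {S E : Type*} [DecidableEq S]

/-- The configuration `σ_Λ τ_{Λᶜ}`, equal to `σ` on `Λ` and to `τ` off `Λ`. -/
def glue (Λ : Finset S) (σ : Λ → E) (τ : {x // x ∉ Λ} → E) : S → E :=
  fun x => if h : x ∈ Λ then σ ⟨x, h⟩ else τ ⟨x, h⟩

/-- The restriction `η_{Λᶜ}` of a configuration `η` to the complement of `Λ`. -/
def outside (Λ : Finset S) (η : S → E) : {x // x ∉ Λ} → E := fun x => η x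

variable [MeasurableSpace E]

/-- A specification: a family of probability kernels `γ_Λ` from `(Ω, 𝓕_{Λᶜ})` to `(Ω, 𝓕)`,
indexed by the finite sets `Λ` of sites, that is proper and consistent. -/
structure IsSpecification (γ : Finset S → (S → E) → Measure (S → E)) : Prop where
  prob : ∀ Λ η, IsProbabilityMeasure (γ Λ η)
  measurable : ∀ (Λ : Finset S) (B : Set (S → E)), MeasurableSet B →
    Measurable[cylinderEvents ((Λ : Set S)ᶜ)] (fun η => γ Λ η B)
  proper : ∀ (Λ : Finset S) (B : Set (S → E)), MeasurableSet[cylinderEvents ((Λ : Set S)ᶜ)] B →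
    ∀ η, γ Λ η B = B.indicator 1 η
  consistent : ∀ Δ Λ, Δ ⊆ Λ → ∀ (B : Set (S → E)), MeasurableSet B →
    ∀ η, ∫⁻ ω, γ Δ ω B ∂(γ Λ η) = γ Λ η B

/-- `μ` is a Gibbs measure for `γ`: a probability measure satisfying the DLR equations. -/
structure IsGibbs (γ : Finset S → (S → E) → Measure (S → E)) (μ : Measure (S → E)) : Prop where
  prob : IsProbabilityMeasure μ
  dlr : ∀ (Λ : Finset S) (B : Set (S → E)), MeasurableSet B → ∫⁻ ω, γ Λ ω B ∂μ = μ B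

/-- Total variation distance `sup_A |μ(A) - ν(A)|`. -/
def tvDist {X : Type*} [MeasurableSpace X] (μ ν : Measure X) : ℝ≥0∞ :=
  ⨆ (A : Set X) (_ : MeasurableSet A), ENNReal.ofReal |μ.real A - ν.real A|

end General

/-! ### Continuous spins -/

instance : Fact (0 < 2 * Real.pi) := ⟨Real.two_pi_pos⟩

/-- The circle `ℝ / 2πℤ`; its `volume` is Lebesgue measure, of total mass `2π`. -/
abbrev Spin : Type := AddCircle (2 * Real.pi)

section Continuous

variable {S : Type*} [DecidableEq S]

/-- The Hamiltonian `H_Λ = ∑_{A ∩ Λ ≠ ∅} Φ_A` of an interaction potential `Φ`. -/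
def hamiltonian (Φ : Finset S → (S → Spin) → ℝ) (Λ : Finset S) (ω : S → Spin) : ℝ :=
  ∑' A : Finset S, if (A ∩ Λ).Nonempty then Φ A ω else 0

/-- The Boltzmann weight `exp(-H_Λ(σ_Λ τ_{Λᶜ}))`. -/
def weight (Φ : Finset S → (S → Spin) → ℝ) (Λ : Finset S)
    (σ : Λ → Spin) (τ : {x // x ∉ Λ} → Spin) : ℝ≥0∞ :=
  ENNReal.ofReal (Real.exp (-hamiltonian Φ Λ (glue Λ σ τ)))

/-- The specification `γ` of the potential `Φ`:
`γ_Λ(B | η) = Z⁻¹ ∫ 1_B(σ_Λ η_{Λᶜ}) exp(-H_Λ(σ_Λ η_{Λᶜ})) λ^{⊗Λ}(dσ)`. -/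
def gibbsSpec (Φ : Finset S → (S → Spin) → ℝ) (Λ : Finset S) (η : S → Spin) :
    Measure (S → Spin) :=
  (∫⁻ σ : Λ → Spin, weight Φ Λ σ (outside Λ η))⁻¹ •
    ((volume : Measure (Λ → Spin)).withDensity (fun σ => weight Φ Λ σ (outside Λ η))).map
      (fun σ => glue Λ σ (outside Λ η))

/-- The potential on `Λᶜ` that is left when every `Φ_A` with `A ∩ Λ ≠ ∅` is dropped. Since `Φ_A`
depends on the spins in `A ⊆ Λᶜ` only, the value `0` put at the sites of `Λ` is irrelevant. -/
def restrictPotential (Φ : Finset S → (S → Spin) → ℝ) (Λ : Finset S) :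
    Finset {x // x ∉ Λ} → ({x // x ∉ Λ} → Spin) → ℝ :=
  fun A τ => Φ (A.map (Function.Embedding.subtype _)) (glue Λ (fun _ => 0) τ)

/-! ### Discretisation -/

/-- The discretisation map: the circle `[0, 2π)` is cut into `q` arcs
`[2πl/q, 2π(l+1)/q)`, `0 ≤ l < q`, and a spin is sent to the index of its arc. -/
def arc (q : ℕ) [NeZero q] (θ : Spin) : Fin q :=
  ⟨⌊(q : ℝ) * (AddCircle.equivIco (2 * Real.pi) 0 θ : ℝ) / (2 * Real.pi)⌋₊, by
    have h := (AddCircle.equivIco (2 * Real.pi) 0 θ).2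
    have hq : (0 : ℝ) < q := Nat.cast_pos.2 (Nat.pos_of_ne_zero (NeZero.ne q))
    rw [Nat.floor_lt (div_nonneg (mul_nonneg hq.le h.1) Real.two_pi_pos.le),
      div_lt_iff₀ Real.two_pi_pos]
    exact mul_lt_mul_of_pos_left (by simpa using h.2) hq⟩

lemma measurable_arc (q : ℕ) [NeZero q] : Measurable (arc q) := by
  have h1 : Measurable fun θ : Spin => (AddCircle.equivIco (2 * Real.pi) 0 θ : ℝ) :=
    measurable_subtype_coe.comp (AddCircle.measurableEquivIco (2 * Real.pi) 0).measurable
  have h2 : Measurable fun θ : Spin => ((arc q θ : Fin q) : ℕ) :=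
    Nat.measurable_floor.comp ((h1.const_mul (q : ℝ)).div_const (2 * Real.pi))
  refine measurable_to_countable' fun l => ?_
  have h3 : arc q ⁻¹' {l} = (fun θ : Spin => ((arc q θ : Fin q) : ℕ)) ⁻¹' {(l : ℕ)} := by
    ext θ
    simp [Fin.ext_iff]
  rw [h3]
  exact h2 (measurableSet_singleton _)

/-- The discretisation map applied at every site. -/
def discretise (q : ℕ) [NeZero q] {I : Type*} (ω : I → Spin) : I → Fin q := fun x => arc q (ω x)

/-- The constrained specification
`γ^{ω'}_Λ(f | ω) = γ_Λ(f 1_{[ω'_Λ]} | ω) / γ_Λ(1_{[ω'_Λ]} | ω)`, where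
`[ω'_Λ]` is the set of configurations whose discretisation agrees with `ω'` on `Λ`. -/
def constrainedSpec (q : ℕ) [NeZero q] (Φ : Finset S → (S → Spin) → ℝ) (ω' : S → Fin q)
    (Λ : Finset S) (η : S → Spin) : Measure (S → Spin) :=
  (gibbsSpec Φ Λ η)[|{ω | ∀ x ∈ Λ, discretise q ω x = ω' x}]

/-- The uniform Dobrushin coefficients of the family of constrained specifications. As usual the
single-site kernels are compared as laws of the spin at `x` (as measures on all configurations they
carry their boundary conditions, and would be mutually singular for any two different ones). -/
def uniformDobrushinCoeff (q : ℕ) [NeZero q] (Φ : Finset S → (S → Spin) → ℝ) (x y : S) : ℝ≥0∞ :=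
  ⨆ (ω' : S → Fin q) (ξ : S → Spin) (η : S → Spin) (_ : ∀ z, z ≠ y → ξ z = η z)
    (_ : discretise q ξ = ω') (_ : discretise q η = ω'),
    tvDist ((constrainedSpec q Φ ω' {x} ξ).map (fun ω => ω x))
      ((constrainedSpec q Φ ω' {x} η).map (fun ω => ω x))

/-- The uniform Dobrushin constant. -/
def uniformDobrushinConst (q : ℕ) [NeZero q] (Φ : Finset S → (S → Spin) → ℝ) : ℝ≥0∞ :=
  ⨆ x, ∑' y, uniformDobrushinCoeff q Φ x y

/-- The Gibbs measure `μ_{Λᶜ}[ω'_{Λᶜ}]` on `Λᶜ`, for the constrained specification without the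
interactions with `Λ` (it is pinned down when there is exactly one such Gibbs measure). -/
def constrainedGibbs (q : ℕ) [NeZero q] (Φ : Finset S → (S → Spin) → ℝ) (Λ : Finset S)
    (ω' : {x // x ∉ Λ} → Fin q) : Measure ({x // x ∉ Λ} → Spin) :=
  Classical.epsilon fun ν => IsGibbs (constrainedSpec q (restrictPotential Φ Λ) ω') ν

/-- The ratio `μ_{Λᶜ}[ω'_{Λᶜ}](λ^{⊗Λ}(e^{-H_Λ} 1_{[s]})) / μ_{Λᶜ}[ω'_{Λᶜ}](λ^{⊗Λ}(e^{-H_Λ}))`,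
the conditional probability of `s` in `Λ` given `ω'_{Λᶜ}`. -/
def discreteProb (q : ℕ) [NeZero q] (Φ : Finset S → (S → Spin) → ℝ) (Λ : Finset S)
    (s : Λ → Fin q) (ω' : {x // x ∉ Λ} → Fin q) : ℝ≥0∞ :=
  (∫⁻ τ, (∫⁻ σ : Λ → Spin, {σ | discretise q σ = s}.indicator (fun σ => weight Φ Λ σ τ) σ)
      ∂(constrainedGibbs q Φ Λ ω')) /
    (∫⁻ τ, (∫⁻ σ : Λ → Spin, weight Φ Λ σ τ) ∂(constrainedGibbs q Φ Λ ω'))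

/-- The discrete specification `γ'`: under `γ'_Λ(· | ω')` the spins off `Λ` are those of `ω'` and
the spins in `Λ` equal `s` with probability `discreteProb q Φ Λ s ω'_{Λᶜ}`. -/
def discreteSpec (q : ℕ) [NeZero q] (Φ : Finset S → (S → Spin) → ℝ) (Λ : Finset S)
    (ω' : S → Fin q) : Measure (S → Fin q) :=
  ∑ s : Λ → Fin q, discreteProb q Φ Λ s (outside Λ ω') • Measure.dirac (glue Λ s (outside Λ ω'))

end Continuous

/-! ### The long-range rotator model -/

/-- Euclidean distance on `ℤ^d`. -/
def latticeDist {d : ℕ} (x y : Fin d → ℤ) : ℝ := √(∑ i, ((x i : ℝ) - (y i : ℝ)) ^ 2)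

/-- The cosine on the circle; `spinCos (φ - ψ)` is the scalar product of the unit vectors with
angles `φ` and `ψ`. -/
def spinCos : Spin → ℝ := Real.cos_periodic.lift

lemma spinCos_coe (t : ℝ) : spinCos (t : Spin) = Real.cos t := rfl

lemma spinCos_neg (θ : Spin) : spinCos (-θ) = spinCos θ := by
  induction θ using QuotientAddGroup.induction_on with
  | H t => exact Real.cos_neg t

/-- The potential `β Φ`, with `Φ_{{x,y}}(ω) = |x - y|^{-α} cos(ω_x - ω_y)` for `x ≠ y` and
`Φ_A = 0` if `A` is not a pair (the factor `1/2` compensates for summing over ordered pairs). -/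
def longRange (d : ℕ) (α β : ℝ) (A : Finset (Fin d → ℤ)) (ω : (Fin d → ℤ) → Spin) : ℝ :=
  if A.card = 2 then
    β * ((1 / 2) * ∑ p ∈ A.offDiag,
      latticeDist p.1 p.2 ^ (-α) * spinCos (ω p.1 - ω p.2))
  else 0

lemma longRange_pair (d : ℕ) (α β : ℝ) {x y : Fin d → ℤ} (h : x ≠ y)
    (ω : (Fin d → ℤ) → Spin) :
    longRange d α β {x, y} ω
      = β * (latticeDist x y ^ (-α) * spinCos (ω x - ω y)) := by
  have h1 : latticeDist y x = latticeDist x y := by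
    unfold latticeDist
    congr 1
    exact Finset.sum_congr rfl fun i _ => by ring
  have h2 : spinCos (ω y - ω x) = spinCos (ω x - ω y) := by
    rw [← neg_sub, spinCos_neg]
  have h3 : ({x, y} : Finset (Fin d → ℤ)).offDiag = {(x, y), (y, x)} := by
    ext ⟨a, b⟩
    simp only [Finset.mem_offDiag, Finset.mem_insert, Finset.mem_singleton, Prod.mk.injEq]
    constructor
    · rintro ⟨rfl | rfl, rfl | rfl, hab⟩ <;> simp_all
    · rintro (⟨rfl, rfl⟩ | ⟨rfl, rfl⟩) <;> simp [h, h.symm]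
  have h4 : (x, y) ≠ (y, x) := fun e => h (Prod.mk.inj e).1
  rw [longRange, if_pos (Finset.card_pair h), h3, Finset.sum_pair h4]
  simp only [h1, h2]
  ring

end DiscretisedGibbs

end

noncomputable section

namespace DiscretisedGibbs

set_option linter.unusedSectionVars false

/-! ### Resampling finitely many spins -/

section Resampling

variable {S E : Type*} [DecidableEq S]

/-! Every specification that occurs is a resampling kernel: the spins in `Δ` are redrawn from
product a priori laws `u` and reweighted by `w`. Conditioning on arcs only changes `u`, and changing
the interaction only changes `w`. The DLR equation (`IsInvariant`) is equivalent to an unnormalised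
detailed balance (`IsReversible`). No partition function occurs in the latter, so it passes directly
to measures that are reweighted (`IsReversible.withDensity`) or conditioned on a product event
(`IsReversible.cond`).

Existence of constrained Gibbs measures is compactness together with the Feller property. For
uniqueness, the Dobrushin bound concerns the full potential, whereas the measures on `Λᶜ` belong to
the potential with the interactions with `Λ` dropped. Reweighting by `exp(-H_Λ)` with the spins in
`Λ` frozen turns them into measures whose single-site kernels are those of the full potential
(`isInvariant_tilt_frozen`), and this reweighting is injective. Dobrushin's theorem is then applied
on the set of configurations with the prescribed arcs.

Conversely, let `P` be a Gibbs measure free in `Λ` and pinned to the arcs `ω'` off `Λ`. Reweighting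
`P` by `1 / Z_Λ` and forgetting `Λ` yields the unique constrained measure
(`isInvariant_map_outside`), so `P` gives the arcs in `Λ` the probabilities `discreteProb`
(`measure_arcEvent_eq_discreteProb`). By compactness this survives limits of measures satisfying
more and more of the equations (`tendsto_measure_arcEvent`); continuity of `discreteProb` in `ω'` is
one consequence.

For a Gibbs measure free in `Λ` and free or pinned at each site elsewhere, conditioning on the arcs
in finite sets exhausting `Λᶜ` produces such a sequence. Hence `discreteProb` is the conditional
probability given the arcs off `Λ` (`withDensity_discreteProb`), which is the DLR equation for the
image (`lintegral_discreteSpec`). Applied to a Gibbs measure of `γ` it gives the last claim. Applied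
to a Gibbs measure free in a larger set, whose image is the kernel `γ'` of that set, it gives
consistency of `γ'`. -/

lemma piecewise_piecewise_subset {Δ Λ : Finset S} (h : Δ ⊆ Λ) (σ τ η : S → E) :
    Δ.piecewise σ (Λ.piecewise τ η) = Λ.piecewise (Δ.piecewise σ τ) η := by
  ext x
  by_cases h1 : x ∈ Δ
  · simp [Finset.piecewise, h1, h h1]
  · by_cases h2 : x ∈ Λ <;> simp [Finset.piecewise, h1, h2]

variable [MeasurableSpace E]

lemma measurable_piecewise (Δ : Finset S) :
    Measurable fun p : (S → E) × (S → E) => Δ.piecewise p.1 p.2 := by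
  refine measurable_pi_lambda _ fun x => ?_
  by_cases hx : x ∈ Δ
  · simpa [Finset.piecewise, hx] using (measurable_pi_apply x).fun_comp measurable_fst
  · simpa [Finset.piecewise, hx] using (measurable_pi_apply x).fun_comp measurable_snd

lemma measurable_piecewise_left (Δ : Finset S) (η : S → E) :
    Measurable fun σ : S → E => Δ.piecewise σ η :=
  (measurable_piecewise Δ).comp (measurable_id.prodMk measurable_const)

variable (u : S → Measure E) [∀ x, IsProbabilityMeasure (u x)]

lemma infinitePi_map_piecewise_left (Δ : Finset S) (η : S → E) :
    (Measure.infinitePi u).map (fun σ => Δ.piecewise σ η)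
      = Measure.infinitePi fun x => if x ∈ Δ then u x else Measure.dirac (η x) := by
  have h := Measure.infinitePi_map_pi (μ := u)
    (f := fun x => if x ∈ Δ then (id : E → E) else fun _ => η x) (fun x => by
      split_ifs
      · exact measurable_id
      · exact measurable_const)
  have h1 : (fun (σ : S → E) (x : S) => (if x ∈ Δ then (id : E → E) else fun _ => η x) (σ x))
      = fun σ => Δ.piecewise σ η := by
    ext σ x
    by_cases hx : x ∈ Δ <;> simp [hx]
  rw [h1] at h
  rw [h]
  congr 1
  ext1 x
  by_cases hx : x ∈ Δ
  · simp [hx]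
  · simp [hx]

/-- Splicing two independent copies reproduces the product law: on a box, the sites in `Δ` constrain
only the first copy and the other sites only the second. -/
lemma infinitePi_prod_map_piecewise (Δ : Finset S) :
    ((Measure.infinitePi u).prod (Measure.infinitePi u)).map (fun p => Δ.piecewise p.1 p.2)
      = Measure.infinitePi u := by
  refine Measure.eq_infinitePi u fun s t ht => ?_
  rw [Measure.map_apply (measurable_piecewise Δ) (.pi s.countable_toSet fun x _ => ht x)]
  have h : (fun p : (S → E) × (S → E) => Δ.piecewise p.1 p.2) ⁻¹' (Set.pi s t)
      = (Set.pi (s ∩ Δ : Finset S) t) ×ˢ (Set.pi (s \ Δ : Finset S) t) := by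
    ext p
    simp only [Set.mem_preimage, Set.mem_pi, Set.mem_prod, Finset.mem_coe, Finset.mem_inter,
      Finset.mem_sdiff]
    constructor
    · intro h
      exact ⟨fun x hx => by simpa [hx.2] using h x hx.1, fun x hx => by simpa [hx.2] using h x hx.1⟩
    · rintro ⟨h1, h2⟩ x hx
      by_cases hΔ : x ∈ Δ
      · simpa [hΔ] using h1 x ⟨hx, hΔ⟩
      · simpa [hΔ] using h2 x ⟨hx, hΔ⟩
  rw [h, Measure.prod_prod, Measure.infinitePi_pi _ fun x _ => ht x,
    Measure.infinitePi_pi _ fun x _ => ht x, Finset.prod_inter_mul_prod_sdiff]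

lemma lintegral_lintegral_piecewise (Δ : Finset S) {f : (S → E) → ℝ≥0∞} (hf : Measurable f) :
    ∫⁻ τ, ∫⁻ σ, f (Δ.piecewise σ τ) ∂Measure.infinitePi u ∂Measure.infinitePi u
      = ∫⁻ σ, f σ ∂Measure.infinitePi u := by
  conv_rhs => rw [← infinitePi_prod_map_piecewise u Δ,
    lintegral_map hf (measurable_piecewise Δ)]
  rw [lintegral_prod_symm' _ (hf.fun_comp (measurable_piecewise Δ))]

/-- The integral of the weight `w` over the spins in `Δ`. -/
def partitionFunction (w : (S → E) → ℝ≥0∞) (Δ : Finset S) (η : S → E) : ℝ≥0∞ :=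
  ∫⁻ σ, w (Δ.piecewise σ η) ∂Measure.infinitePi u

/-- The law obtained from `η` by resampling the spins in `Δ` from the a priori laws `u`,
reweighted by `w`. -/
def resample (w : (S → E) → ℝ≥0∞) (Δ : Finset S) (η : S → E) : Measure (S → E) :=
  (partitionFunction u w Δ η)⁻¹ •
    ((Measure.infinitePi u).withDensity fun σ => w (Δ.piecewise σ η)).map
      fun σ => Δ.piecewise σ η

/-- A measurable function bounded above and away from zero. -/
structure IsWeight {X : Type*} [MeasurableSpace X] (w : X → ℝ≥0∞) : Prop where
  measurable : Measurable w
  bounds : ∃ a b : ℝ≥0∞, a ≠ 0 ∧ b ≠ ∞ ∧ ∀ ω, a ≤ w ω ∧ w ω ≤ b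

namespace IsWeight

variable {X : Type*} [MeasurableSpace X] {v w : X → ℝ≥0∞}

lemma ne_zero (hw : IsWeight w) (ω : X) : w ω ≠ 0 := by
  obtain ⟨a, b, ha, _, h⟩ := hw.bounds
  exact fun h0 => ha (le_zero_iff.1 (h0 ▸ (h ω).1))

lemma ne_top (hw : IsWeight w) (ω : X) : w ω ≠ ∞ := by
  obtain ⟨a, b, _, hb, h⟩ := hw.bounds
  exact ne_top_of_le_ne_top hb (h ω).2

lemma mul (hv : IsWeight v) (hw : IsWeight w) : IsWeight fun ω => v ω * w ω := by
  obtain ⟨a, b, ha, hb, h⟩ := hv.bounds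
  obtain ⟨a', b', ha', hb', h'⟩ := hw.bounds
  exact ⟨hv.measurable.mul hw.measurable, a * a', b * b', mul_ne_zero ha ha',
    ENNReal.mul_ne_top hb hb', fun ω => ⟨mul_le_mul' (h ω).1 (h' ω).1,
      mul_le_mul' (h ω).2 (h' ω).2⟩⟩

lemma inv (hw : IsWeight w) : IsWeight fun ω => (w ω)⁻¹ := by
  obtain ⟨a, b, ha, hb, h⟩ := hw.bounds
  exact ⟨hw.measurable.inv, b⁻¹, a⁻¹, ENNReal.inv_ne_zero.2 hb, ENNReal.inv_ne_top.2 ha,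
    fun ω => ⟨ENNReal.inv_le_inv.2 (h ω).2, ENNReal.inv_le_inv.2 (h ω).1⟩⟩

lemma comp {Y : Type*} [MeasurableSpace Y] (hw : IsWeight w) {f : Y → X} (hf : Measurable f) :
    IsWeight fun y => w (f y) := by
  obtain ⟨a, b, ha, hb, h⟩ := hw.bounds
  exact ⟨hw.measurable.comp hf, a, b, ha, hb, fun y => h (f y)⟩

lemma lintegral_ne_zero (hw : IsWeight w) (P : Measure X) [hP : NeZero P] :
    ∫⁻ ω, w ω ∂P ≠ 0 := by
  obtain ⟨a, b, ha, hb, h⟩ := hw.bounds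
  intro h0
  have h1 : ∫⁻ _, a ∂P ≤ ∫⁻ ω, w ω ∂P := lintegral_mono fun ω => (h ω).1
  rw [h0, lintegral_const, le_zero_iff, mul_eq_zero] at h1
  exact h1.elim ha fun h2 => hP.out (Measure.measure_univ_eq_zero.1 h2)

lemma lintegral_ne_top (hw : IsWeight w) (P : Measure X) [IsFiniteMeasure P] :
    ∫⁻ ω, w ω ∂P ≠ ∞ := by
  obtain ⟨a, b, ha, hb, h⟩ := hw.bounds
  refine ne_top_of_le_ne_top ?_ (lintegral_mono fun ω => (h ω).2)
  rw [lintegral_const]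
  exact ENNReal.mul_ne_top hb (measure_ne_top _ _)

end IsWeight

variable {u} {w : (S → E) → ℝ≥0∞} {Δ Λ : Finset S}

lemma measurable_lintegral_piecewise {f : (S → E) → (S → E) → ℝ≥0∞}
    (hf : Measurable (Function.uncurry f)) (Δ : Finset S) :
    Measurable fun η => ∫⁻ σ, f η (Δ.piecewise σ η) ∂Measure.infinitePi u := by
  have h : Measurable fun p : (S → E) × (S → E) => f p.1 (Δ.piecewise p.2 p.1) :=
    hf.comp (measurable_fst.prodMk ((measurable_piecewise Δ).comp measurable_swap))
  exact h.lintegral_prod_right'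

lemma measurable_partitionFunction (hw : Measurable w) (Δ : Finset S) :
    Measurable (partitionFunction u w Δ) :=
  measurable_lintegral_piecewise (f := fun _ => w) (hw.comp measurable_snd) Δ

lemma IsWeight.partitionFunction (hw : IsWeight w) (Δ : Finset S) :
    IsWeight (partitionFunction u w Δ) := by
  obtain ⟨a, b, ha, hb, h⟩ := hw.bounds
  refine ⟨measurable_partitionFunction hw.measurable Δ, a, b, ha, hb, fun η => ⟨?_, ?_⟩⟩
  · refine le_trans ?_ (lintegral_mono fun σ => (h _).1)
    simp
  · refine le_trans (lintegral_mono fun σ => (h _).2) ?_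
    simp

/-- The normalisation only sees the spins off `Δ`, so it is the same before and after resampling. -/
lemma partitionFunction_piecewise (σ η : S → E) :
    partitionFunction u w Δ (Δ.piecewise σ η) = partitionFunction u w Δ η := by
  simp [partitionFunction, Finset.piecewise_idem_right]

lemma lintegral_resample (hw : Measurable w) {f : (S → E) → ℝ≥0∞} (hf : Measurable f)
    (η : S → E) :
    ∫⁻ ω, f ω ∂resample u w Δ η = (partitionFunction u w Δ η)⁻¹ *
      ∫⁻ σ, w (Δ.piecewise σ η) * f (Δ.piecewise σ η) ∂Measure.infinitePi u := by
  have hm := measurable_piecewise_left Δ η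
  rw [resample, lintegral_smul_measure, lintegral_map hf hm,
    lintegral_withDensity_eq_lintegral_mul _ (hw.fun_comp hm) (hf.fun_comp hm)]
  rfl

lemma resample_apply (hw : Measurable w) {B : Set (S → E)} (hB : MeasurableSet B) (η : S → E) :
    resample u w Δ η B = (partitionFunction u w Δ η)⁻¹ *
      ∫⁻ σ, w (Δ.piecewise σ η) * B.indicator 1 (Δ.piecewise σ η) ∂Measure.infinitePi u := by
  rw [← lintegral_indicator_one hB, lintegral_resample hw (measurable_one.indicator hB)]

lemma measurable_resample (hw : Measurable w) : Measurable (resample u w Δ) := by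
  refine Measure.measurable_of_measurable_coe _ fun B hB => ?_
  simp_rw [resample_apply hw hB]
  refine (measurable_partitionFunction hw Δ).inv.mul ?_
  exact measurable_lintegral_piecewise (f := fun _ ω => w ω * B.indicator 1 ω)
    ((hw.mul (measurable_one.indicator hB)).comp measurable_snd) Δ

lemma isProbabilityMeasure_resample (hw : IsWeight w) (Δ : Finset S) (η : S → E) :
    IsProbabilityMeasure (resample u w Δ η) := by
  constructor
  rw [resample_apply hw.measurable .univ]
  simp only [Set.indicator_univ, Pi.one_apply, mul_one]
  exact ENNReal.inv_mul_cancel ((hw.partitionFunction Δ).ne_zero η)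
    ((hw.partitionFunction Δ).ne_top η)

/-- The law `P` is invariant under resampling the spins in `Δ`. -/
def IsInvariant (u : S → Measure E) [∀ x, IsProbabilityMeasure (u x)] (w : (S → E) → ℝ≥0∞)
    (Δ : Finset S) (P : Measure (S → E)) : Prop :=
  P.bind (resample u w Δ) = P

/-- Detailed balance: the joint law of a configuration and of its resampling in `Δ`, weighted
by `w`, is symmetric. -/
def IsReversible (u : S → Measure E) [∀ x, IsProbabilityMeasure (u x)] (w : (S → E) → ℝ≥0∞)
    (Δ : Finset S) (P : Measure (S → E)) : Prop :=
  ∀ F : (S → E) → (S → E) → ℝ≥0∞, Measurable (Function.uncurry F) →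
    ∫⁻ η, ∫⁻ σ, w (Δ.piecewise σ η) * F η (Δ.piecewise σ η) ∂Measure.infinitePi u ∂P
      = ∫⁻ η, ∫⁻ σ, w (Δ.piecewise σ η) * F (Δ.piecewise σ η) η ∂Measure.infinitePi u ∂P

lemma IsInvariant.lintegral {P : Measure (S → E)} (h : IsInvariant u w Δ P) (hw : Measurable w)
    {f : (S → E) → ℝ≥0∞} (hf : Measurable f) :
    ∫⁻ η, (partitionFunction u w Δ η)⁻¹ *
      ∫⁻ σ, w (Δ.piecewise σ η) * f (Δ.piecewise σ η) ∂Measure.infinitePi u ∂P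
      = ∫⁻ η, f η ∂P := by
  conv_rhs => rw [← h, Measure.lintegral_bind (measurable_resample hw).aemeasurable
    hf.aemeasurable]
  simp_rw [lintegral_resample hw hf]

lemma isInvariant_iff_measure {P : Measure (S → E)} (hw : Measurable w) :
    IsInvariant u w Δ P ↔
      ∀ B, MeasurableSet B → ∫⁻ η, resample u w Δ η B ∂P = P B := by
  constructor
  · intro h B hB
    conv_rhs => rw [← h, Measure.bind_apply hB (measurable_resample hw).aemeasurable]
  · intro h
    refine Measure.ext fun B hB => ?_
    rw [Measure.bind_apply hB (measurable_resample hw).aemeasurable, h B hB]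

/-- By invariance `η` may itself be replaced by a resampled configuration. Both sides become
integrals over two independent resamplings `τ`, `σ` of the same `η` with weight `w(τ) w(σ) / Z(η)`,
and these are exchanged by swapping `τ` and `σ`. -/
lemma IsInvariant.isReversible {P : Measure (S → E)} (h : IsInvariant u w Δ P)
    (hw : Measurable w) : IsReversible u w Δ P := by
  intro F hF
  have hF' : Measurable (Function.uncurry fun η ω => F ω η) := hF.comp measurable_swap
  have key : ∀ G : (S → E) → (S → E) → ℝ≥0∞, Measurable (Function.uncurry G) →
      ∫⁻ η, ∫⁻ σ, w (Δ.piecewise σ η) * G η (Δ.piecewise σ η) ∂Measure.infinitePi u ∂P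
        = ∫⁻ η, (partitionFunction u w Δ η)⁻¹ * ∫⁻ τ, ∫⁻ σ, w (Δ.piecewise τ η) *
          (w (Δ.piecewise σ η) * G (Δ.piecewise τ η) (Δ.piecewise σ η))
            ∂Measure.infinitePi u ∂Measure.infinitePi u ∂P := by
    intro G hG
    rw [← h.lintegral hw (measurable_lintegral_piecewise
      (f := fun η ω => w ω * G η ω) ((hw.comp measurable_snd).mul hG) Δ)]
    refine lintegral_congr fun η => ?_
    congr 1
    refine lintegral_congr fun τ => ?_
    simp only [Finset.piecewise_idem_right]
    rw [lintegral_const_mul]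
    exact (hw.comp (measurable_piecewise_left Δ η)).mul
      (hG.comp (measurable_const.prodMk (measurable_piecewise_left Δ η)))
  rw [key F hF, key _ hF']
  refine lintegral_congr fun η => ?_
  congr 1
  rw [lintegral_lintegral_swap]
  · refine lintegral_congr fun τ => lintegral_congr fun σ => ?_
    ring
  · have h1 : Measurable fun p : (S → E) × (S → E) => Δ.piecewise p.1 η :=
      (measurable_piecewise_left Δ η).comp measurable_fst
    have h2 : Measurable fun p : (S → E) × (S → E) => Δ.piecewise p.2 η :=
      (measurable_piecewise_left Δ η).comp measurable_snd
    exact ((hw.comp h1).mul ((hw.comp h2).mul (hF.comp (h1.prodMk h2)))).aemeasurable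

/-- Detailed balance is tested on `1_B(ω) / Z(η)`. Since `Z` does not change under resampling, one
side is the resampled probability of `B`, and on the other the weight integrates to `Z` and cancels.
-/
lemma IsReversible.isInvariant {P : Measure (S → E)} (h : IsReversible u w Δ P)
    (hw : IsWeight w) : IsInvariant u w Δ P := by
  rw [isInvariant_iff_measure hw.measurable]
  intro B hB
  have hZ := hw.partitionFunction (u := u) Δ
  have hB' : Measurable (B.indicator 1 : (S → E) → ℝ≥0∞) := measurable_one.indicator hB
  have h1 := h (fun η ω => (partitionFunction u w Δ η)⁻¹ * B.indicator 1 ω)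
    ((hZ.measurable.inv.comp measurable_fst).mul (hB'.comp measurable_snd))
  simp only [partitionFunction_piecewise] at h1
  have h2 : ∀ η, ∫⁻ σ, w (Δ.piecewise σ η) * ((partitionFunction u w Δ η)⁻¹ * B.indicator 1 η)
      ∂Measure.infinitePi u = B.indicator 1 η := by
    intro η
    rw [lintegral_mul_const _ (hw.measurable.fun_comp (measurable_piecewise_left Δ η)), ← mul_assoc]
    change partitionFunction u w Δ η * _ * _ = _
    rw [ENNReal.mul_inv_cancel (hZ.ne_zero η) (hZ.ne_top η), one_mul]
  simp only [h2] at h1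
  rw [lintegral_indicator_one hB] at h1
  rw [← h1]
  refine lintegral_congr fun η => ?_
  rw [resample_apply hw.measurable hB, ← lintegral_const_mul]
  · refine lintegral_congr fun σ => ?_
    ring
  · exact (hw.measurable.mul hB').comp (measurable_piecewise_left Δ η)

lemma IsReversible.smul {P : Measure (S → E)} (h : IsReversible u w Δ P) (c : ℝ≥0∞) :
    IsReversible u w Δ (c • P) := by
  intro F hF
  rw [lintegral_smul_measure, lintegral_smul_measure, h F hF]

/-- Both sides acquire the factor `v(η) v(ω)`, which is symmetric and can be absorbed into the test
function. -/
lemma IsReversible.withDensity {P : Measure (S → E)} (h : IsReversible u w Δ P)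
    (hw : Measurable w) {v : (S → E) → ℝ≥0∞} (hv : Measurable v) :
    IsReversible u (fun ω => w ω * v ω) Δ (P.withDensity v) := by
  intro F hF
  have hF' : Measurable (Function.uncurry fun η ω => F ω η) := hF.comp measurable_swap
  have key : ∀ G : (S → E) → (S → E) → ℝ≥0∞, Measurable (Function.uncurry G) →
      ∫⁻ η, ∫⁻ σ, w (Δ.piecewise σ η) * v (Δ.piecewise σ η) * G η (Δ.piecewise σ η)
        ∂Measure.infinitePi u ∂P.withDensity v
      = ∫⁻ η, ∫⁻ σ, w (Δ.piecewise σ η) *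
        (v η * v (Δ.piecewise σ η) * G η (Δ.piecewise σ η)) ∂Measure.infinitePi u ∂P := by
    intro G hG
    rw [lintegral_withDensity_eq_lintegral_mul _ hv (measurable_lintegral_piecewise
      (f := fun η ω => w ω * v ω * G η ω)
      (((hw.comp measurable_snd).mul (hv.comp measurable_snd)).mul hG) Δ)]
    refine lintegral_congr fun η => ?_
    rw [Pi.mul_apply, ← lintegral_const_mul]
    · refine lintegral_congr fun σ => ?_
      ring
    · have hm := measurable_piecewise_left Δ η
      exact ((hw.comp hm).mul (hv.comp hm)).mul (hG.comp (measurable_const.prodMk hm))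
  rw [key F hF, key _ hF', h (fun η ω => v η * v ω * F η ω)
    (((hv.comp measurable_fst).mul (hv.comp measurable_snd)).mul hF)]
  refine lintegral_congr fun η => lintegral_congr fun σ => ?_
  ring

/-- A factor that does not feel the spins in `Δ` takes the same value at both arguments, so it too
can be absorbed into the test function. -/
lemma IsReversible.mul_outside {P : Measure (S → E)} (h : IsReversible u w Δ P)
    {c : (S → E) → ℝ≥0∞} (hc : Measurable c) (hc' : ∀ σ η, c (Δ.piecewise σ η) = c η) :
    IsReversible u (fun ω => w ω * c ω) Δ P := by
  intro F hF
  have := h (fun η ω => c η * F η ω) ((hc.comp measurable_fst).mul hF)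
  simpa [hc', mul_assoc] using this

lemma isReversible_infinitePi (Δ : Finset S) :
    IsReversible u (fun _ => 1) Δ (Measure.infinitePi u) := by
  refine IsInvariant.isReversible ?_ measurable_const
  rw [isInvariant_iff_measure measurable_const]
  intro B hB
  have hB' : Measurable (B.indicator 1 : (S → E) → ℝ≥0∞) := measurable_one.indicator hB
  simp only [resample_apply measurable_const hB, partitionFunction, one_mul, lintegral_const,
    measure_univ, inv_one, mul_one]
  rw [lintegral_lintegral_piecewise u Δ hB', lintegral_indicator_one hB]

/-- Resampling in `Λ` produces a law that is in detailed balance for resampling in any `Δ ⊆ Λ`. -/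
lemma isReversible_resample (hw : Measurable w) (h : Δ ⊆ Λ) (η : S → E) :
    IsReversible u w Δ (resample u w Λ η) := by
  -- Without the weight, the spins in `Λ` are independent with laws `u` and those off `Λ` are frozen
  -- at `η`; as `Δ ⊆ Λ`, the frozen spins are never touched and the balance of the product law
  -- applies. The weight is then put in as a density.
  have h1 : IsReversible u (fun _ => 1) Δ
      ((Measure.infinitePi u).map fun σ => Λ.piecewise σ η) := by
    intro F hF
    have hm := measurable_piecewise_left Λ η
    have hF' : Measurable (Function.uncurry fun η ω => F ω η) := hF.comp measurable_swap
    simp only [one_mul]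
    rw [lintegral_map (measurable_lintegral_piecewise hF Δ) hm,
      lintegral_map (measurable_lintegral_piecewise hF' Δ) hm]
    simp only [piecewise_piecewise_subset h]
    have := isReversible_infinitePi (u := u) Δ
      (fun ω ω' => F (Λ.piecewise ω η) (Λ.piecewise ω' η))
      (hF.comp ((hm.comp measurable_fst).prodMk (hm.comp measurable_snd)))
    simpa using this
  have h2 := (h1.withDensity measurable_const hw).smul (partitionFunction u w Λ η)⁻¹
  simp only [one_mul] at h2
  have h3 : resample u w Λ η = (partitionFunction u w Λ η)⁻¹ •
      ((Measure.infinitePi u).map fun σ => Λ.piecewise σ η).withDensity w := by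
    rw [resample]
    congr 1
    refine Measure.ext fun B hB => ?_
    have hm := measurable_piecewise_left Λ η
    rw [Measure.map_apply hm hB, withDensity_apply _ (hm hB), withDensity_apply _ hB,
      Measure.restrict_map hm hB, lintegral_map hw hm]
  rw [h3]
  exact h2

end Resampling

/-! ### Changing the a priori laws -/

section Conditioning

variable {S E : Type*} [DecidableEq S] [MeasurableSpace E]
  {u u' : S → Measure E} [∀ x, IsProbabilityMeasure (u x)] [∀ x, IsProbabilityMeasure (u' x)]
  {w : (S → E) → ℝ≥0∞} {Δ F : Finset S}

lemma lintegral_piecewise_congr (h : ∀ x ∈ Δ, u x = u' x) {f : (S → E) → ℝ≥0∞}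
    (hf : Measurable f) (η : S → E) :
    ∫⁻ σ, f (Δ.piecewise σ η) ∂Measure.infinitePi u
      = ∫⁻ σ, f (Δ.piecewise σ η) ∂Measure.infinitePi u' := by
  rw [← lintegral_map hf (measurable_piecewise_left Δ η),
    ← lintegral_map hf (measurable_piecewise_left Δ η), infinitePi_map_piecewise_left,
    infinitePi_map_piecewise_left]
  congr 2
  ext1 x
  by_cases hx : x ∈ Δ
  · simp [hx, h x hx]
  · simp [hx]

lemma resample_congr (hw : Measurable w) (h : ∀ x ∈ Δ, u x = u' x) (η : S → E) :
    resample u w Δ η = resample u' w Δ η := by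
  refine Measure.ext fun B hB => ?_
  rw [resample_apply hw hB, resample_apply hw hB, partitionFunction, partitionFunction,
    lintegral_piecewise_congr h hw,
    lintegral_piecewise_congr (f := fun ω => w ω * B.indicator 1 ω) h
      (hw.mul (measurable_one.indicator hB))]

lemma IsInvariant.congr (hw : Measurable w) (h : ∀ x ∈ Δ, u x = u' x) {P : Measure (S → E)}
    (hP : IsInvariant u w Δ P) : IsInvariant u' w Δ P := by
  have : resample u' w Δ = resample u w Δ := funext fun η => (resample_congr hw h η).symm
  rw [IsInvariant, this]
  exact hP

/-- The family of laws `u`, with `u x` conditioned on `A x` for `x ∈ F`. -/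
def condLaw (u : S → Measure E) (F : Finset S) (A : S → Set E) (x : S) : Measure E :=
  if x ∈ F then (u x)[|A x] else u x

lemma isProbabilityMeasure_condLaw {A : S → Set E} (h : ∀ x ∈ F, u x (A x) ≠ 0) (x : S) :
    IsProbabilityMeasure (condLaw u F A x) := by
  unfold condLaw
  split_ifs with hx
  · exact cond_isProbabilityMeasure (h x hx)
  · infer_instance

/-- Compared on boxes: at each site of `F`, the mass of `A x ∩ t x` is the mass of `A x` times the
conditional mass of `t x`. -/
lemma infinitePi_restrict {A : S → Set E} (hA : ∀ x, MeasurableSet (A x))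
    (h : ∀ x ∈ F, u x (A x) ≠ 0) :
    (Measure.infinitePi u).restrict {σ | ∀ x ∈ F, σ x ∈ A x}
      = (∏ x ∈ F, u x (A x)) • Measure.infinitePi (condLaw u F A) := by
  have hp := isProbabilityMeasure_condLaw h
  have hc0 : ∏ x ∈ F, u x (A x) ≠ 0 := Finset.prod_ne_zero_iff.2 h
  have hct : ∏ x ∈ F, u x (A x) ≠ ∞ := ENNReal.prod_ne_top fun x _ => measure_ne_top _ _
  have key : (∏ x ∈ F, u x (A x))⁻¹ • (Measure.infinitePi u).restrict {σ | ∀ x ∈ F, σ x ∈ A x}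
      = Measure.infinitePi (condLaw u F A) := by
    refine Measure.eq_infinitePi _ fun s t ht => ?_
    classical
    let t' : S → Set E := fun x => if x ∈ s then t x else Set.univ
    let A' : S → Set E := fun x => if x ∈ F then A x else Set.univ
    have ht' : ∀ x, MeasurableSet (t' x) := fun x => by
      by_cases hx : x ∈ s <;> simp [t', hx, ht]
    have hA' : ∀ x, MeasurableSet (A' x) := fun x => by
      by_cases hx : x ∈ F <;> simp [A', hx, hA]
    have h1 : Set.pi (s : Set S) t ∩ {σ | ∀ x ∈ F, σ x ∈ A x}
        = Set.pi (s ∪ F : Finset S) fun x => A' x ∩ t' x := by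
      ext σ
      simp only [Set.mem_inter_iff, Set.mem_pi, Finset.mem_coe, Set.mem_ofPred_eq,
        Finset.mem_union, A', t']
      constructor
      · rintro ⟨h1, h2⟩ x hx
        constructor
        · by_cases hF : x ∈ F <;> simp [hF, h2]
        · by_cases hs : x ∈ s <;> simp [hs, h1]
      · intro h1
        exact ⟨fun x hx => by simpa [hx] using (h1 x (.inl hx)).2,
          fun x hx => by simpa [hx] using (h1 x (.inr hx)).1⟩
    rw [Measure.smul_apply, Measure.restrict_apply (.pi s.countable_toSet fun x _ => ht x), h1,
      Measure.infinitePi_pi _ fun x _ => (hA' x).inter (ht' x), smul_eq_mul]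
    have h2 : ∏ x ∈ F, u x (A x) = ∏ x ∈ s ∪ F, u x (A' x) := by
      rw [← Finset.prod_subset (Finset.subset_union_right (s₁ := s)) (f := fun x => u x (A' x))]
      · exact Finset.prod_congr rfl fun x hx => by simp [A', hx]
      · intro x _ hx
        simp [A', hx]
    have h3 : ∏ x ∈ s, condLaw u F A x (t x) = ∏ x ∈ s ∪ F, condLaw u F A x (t' x) := by
      rw [← Finset.prod_subset (Finset.subset_union_left (s₂ := F))
        (f := fun x => condLaw u F A x (t' x))]
      · exact Finset.prod_congr rfl fun x hx => by simp [t', hx]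
      · intro x _ hx
        simp [t', hx]
    have h4 : ∏ x ∈ s ∪ F, u x (A' x ∩ t' x)
        = (∏ x ∈ F, u x (A x)) * ∏ x ∈ s, condLaw u F A x (t x) := ?_
    · rw [h4, ← mul_assoc, ENNReal.inv_mul_cancel hc0 hct, one_mul]
    rw [h2, h3, ← Finset.prod_mul_distrib]
    refine Finset.prod_congr rfl fun x _ => ?_
    by_cases hx : x ∈ F
    · simp only [A', condLaw, hx, if_true]
      rw [mul_comm, cond_mul_eq_inter (hA x)]
    · simp [A', condLaw, hx]
  rw [← key, smul_smul, ENNReal.mul_inv_cancel hc0 hct, one_smul]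

lemma measurableSet_forall_mem {A : S → Set E} (hA : ∀ x, MeasurableSet (A x)) (F : Finset S) :
    MeasurableSet {σ : S → E | ∀ x ∈ F, σ x ∈ A x} := by
  have : {σ : S → E | ∀ x ∈ F, σ x ∈ A x} = Set.pi (F : Set S) A := by
    ext σ
    simp
  rw [this]
  exact .pi F.countable_toSet fun x _ => hA x

lemma lintegral_indicator_piecewise {A : S → Set E} (hA : ∀ x, MeasurableSet (A x))
    (h : ∀ x ∈ F, u x (A x) ≠ 0) {f : (S → E) → ℝ≥0∞} (hf : Measurable f) (η : S → E) :
    ∫⁻ σ, {σ : S → E | ∀ x ∈ F ∩ Δ, σ x ∈ A x}.indicator (fun σ => f (Δ.piecewise σ η)) σ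
        ∂Measure.infinitePi u
      = (∏ x ∈ F ∩ Δ, u x (A x)) *
        ∫⁻ σ, f (Δ.piecewise σ η) ∂Measure.infinitePi (condLaw u F A) := by
  have h' : ∀ x ∈ F ∩ Δ, u x (A x) ≠ 0 := fun x hx => h x (Finset.mem_inter.1 hx).1
  have hp := isProbabilityMeasure_condLaw h
  have hp' := isProbabilityMeasure_condLaw h'
  rw [lintegral_indicator (measurableSet_forall_mem hA _), infinitePi_restrict hA h',
    lintegral_smul_measure, smul_eq_mul]
  congr 1
  refine lintegral_piecewise_congr (fun x hx => ?_) hf η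
  simp [condLaw, hx]

/-- Once `η` satisfies the constraints, a resampled configuration can only violate them at sites of
`F ∩ Δ`, so the event becomes one about `σ` alone. -/
lemma indicator_piecewise_of_mem {A : S → Set E} {η : S → E}
    (hη : ∀ x ∈ F, η x ∈ A x) (f : (S → E) → ℝ≥0∞) (σ : S → E) :
    {ω : S → E | ∀ x ∈ F, ω x ∈ A x}.indicator f (Δ.piecewise σ η)
      = {σ : S → E | ∀ x ∈ F ∩ Δ, σ x ∈ A x}.indicator (fun σ => f (Δ.piecewise σ η)) σ := by
  have : (∀ x ∈ F, Δ.piecewise σ η x ∈ A x) ↔ ∀ x ∈ F ∩ Δ, σ x ∈ A x := by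
    constructor
    · intro h x hx
      rw [Finset.mem_inter] at hx
      simpa [hx.2] using h x hx.1
    · intro h x hx
      by_cases hΔ : x ∈ Δ
      · simpa [hΔ] using h x (Finset.mem_inter.2 ⟨hx, hΔ⟩)
      · simpa [hΔ] using hη x hx
  by_cases h1 : ∀ x ∈ F ∩ Δ, σ x ∈ A x
  · rw [Set.indicator_of_mem (by exact this.2 h1), Set.indicator_of_mem (by exact h1)]
  · rw [Set.indicator_of_notMem (by exact fun h => h1 (this.1 h)),
      Set.indicator_of_notMem (by exact h1)]

/-- Detailed balance is applied to the test function multiplied by `1_C(η) 1_C(ω)`. For `η` in `C`,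
the second indicator restricts the a priori law of `σ` to the sets `A x`, `x ∈ F ∩ Δ`. This amounts
to passing to `condLaw` up to a constant that is the same on both sides. -/
lemma IsReversible.cond (hw : Measurable w) {A : S → Set E} (hA : ∀ x, MeasurableSet (A x))
    (h : ∀ x ∈ F, u x (A x) ≠ 0) [∀ x, IsProbabilityMeasure (condLaw u F A x)]
    {P : Measure (S → E)} (hP : IsReversible u w Δ P) :
    IsReversible (condLaw u F A) w Δ (P[|{ω | ∀ x ∈ F, ω x ∈ A x}]) := by
  set C : Set (S → E) := {ω | ∀ x ∈ F, ω x ∈ A x} with hC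
  have hCm : MeasurableSet C := measurableSet_forall_mem hA F
  have hc0 : ∏ x ∈ F ∩ Δ, u x (A x) ≠ 0 :=
    Finset.prod_ne_zero_iff.2 fun x hx => h x (Finset.mem_inter.1 hx).1
  have hct : ∏ x ∈ F ∩ Δ, u x (A x) ≠ ∞ := ENNReal.prod_ne_top fun x _ => measure_ne_top _ _
  refine IsReversible.smul (fun G hG => ?_) _
  have hI : Measurable (C.indicator 1 : (S → E) → ℝ≥0∞) := measurable_one.indicator hCm
  have key : ∀ K : (S → E) → (S → E) → ℝ≥0∞, Measurable (Function.uncurry K) →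
      ∫⁻ η, ∫⁻ σ, w (Δ.piecewise σ η) * (C.indicator 1 η * (C.indicator 1 (Δ.piecewise σ η) *
        K η (Δ.piecewise σ η))) ∂Measure.infinitePi u ∂P
      = (∏ x ∈ F ∩ Δ, u x (A x)) * ∫⁻ η in C, ∫⁻ σ, w (Δ.piecewise σ η) *
        K η (Δ.piecewise σ η) ∂Measure.infinitePi (condLaw u F A) ∂P := by
    intro K hK
    rw [← lintegral_const_mul _ (measurable_lintegral_piecewise (f := fun η ω => w ω * K η ω)
      ((hw.comp measurable_snd).mul hK) Δ), ← lintegral_indicator hCm]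
    refine lintegral_congr fun η => ?_
    by_cases hη : η ∈ C
    · simp only [Set.indicator_of_mem hη, Pi.one_apply, one_mul]
      rw [← lintegral_indicator_piecewise hA h (f := fun ω => w ω * K η ω)
        (hw.mul (hK.comp (measurable_const.prodMk measurable_id)))]
      refine lintegral_congr fun σ => ?_
      have h3 := indicator_piecewise_of_mem (Δ := Δ) hη (fun ω => w ω * K η ω) σ
      rw [← h3]
      by_cases hσ : Δ.piecewise σ η ∈ C <;> simp [hσ, ← hC]
    · simp [hη]
  have h1 := hP (fun η ω => C.indicator 1 η * (C.indicator 1 ω * G η ω))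
    ((hI.comp measurable_fst).mul ((hI.comp measurable_snd).mul hG))
  have h2 : ∀ η σ, C.indicator 1 (Δ.piecewise σ η) * (C.indicator 1 η * G (Δ.piecewise σ η) η)
      = C.indicator 1 η * (C.indicator 1 (Δ.piecewise σ η) * G (Δ.piecewise σ η) η) :=
    fun η σ => mul_left_comm _ _ _
  simp only [h2] at h1
  rw [key G hG, key (fun η ω => G ω η) (hG.comp measurable_swap)] at h1
  exact (ENNReal.mul_right_inj hc0 hct).1 h1

end Conditioning

/-! ### Weak limits of invariant laws -/

section Limits

open Filter Topology

variable {S : Type*} [DecidableEq S] [Countable S]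
  {u : S → Measure Spin} [∀ x, IsProbabilityMeasure (u x)]
  {w : (S → Spin) → ℝ≥0∞} {Δ Λ : Finset S}

lemma continuous_piecewise_right {E : Type*} [TopologicalSpace E] (Δ : Finset S) (σ : S → E) :
    Continuous fun η : S → E => Δ.piecewise σ η := by
  refine continuous_pi fun x => ?_
  by_cases hx : x ∈ Δ
  · simpa [hx] using continuous_const
  · simpa [hx] using continuous_apply x

lemma exists_bound_of_continuous {X : Type*} [TopologicalSpace X] [CompactSpace X] {f : X → ℝ}
    (hf : Continuous f) : ∃ M : ℝ, ∀ x, ‖f x‖ ≤ M := by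
  obtain ⟨M, hM⟩ := isCompact_univ.exists_bound_of_continuousOn hf.continuousOn
  exact ⟨M, fun x => hM x (Set.mem_univ x)⟩

lemma integrable_of_continuous {X : Type*} [TopologicalSpace X] [CompactSpace X]
    [MeasurableSpace X] [BorelSpace X] {f : X → ℝ} (hf : Continuous f) (P : Measure X)
    [IsFiniteMeasure P] : Integrable f P := by
  obtain ⟨M, hM⟩ := exists_bound_of_continuous hf
  exact Integrable.of_bound hf.measurable.aestronglyMeasurable M (.of_forall hM)

lemma continuous_integral_piecewise {f : (S → Spin) → ℝ} (hf : Continuous f) (Δ : Finset S) :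
    Continuous fun η => ∫ σ, f (Δ.piecewise σ η) ∂Measure.infinitePi u := by
  obtain ⟨M, hM⟩ := exists_bound_of_continuous hf
  refine continuous_of_dominated (bound := fun _ => M)
    (fun η => (hf.measurable.comp (measurable_piecewise_left Δ η)).aestronglyMeasurable)
    (fun η => .of_forall fun σ => hM _) (integrable_const _)
    (.of_forall fun σ => hf.comp (continuous_piecewise_right Δ σ))

lemma partitionFunction_toReal (hw : IsWeight w) (η : S → Spin) :
    (partitionFunction u w Δ η).toReal
      = ∫ σ, (w (Δ.piecewise σ η)).toReal ∂Measure.infinitePi u := by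
  rw [partitionFunction, integral_toReal
    (hw.measurable.fun_comp (measurable_piecewise_left Δ η)).aemeasurable
    (.of_forall fun σ => (hw.ne_top _).lt_top)]

lemma integral_resample (hw : IsWeight w) {f : (S → Spin) → ℝ} (hf : Continuous f)
    (η : S → Spin) :
    ∫ ω, f ω ∂resample u w Δ η = (partitionFunction u w Δ η).toReal⁻¹ *
      ∫ σ, (w (Δ.piecewise σ η)).toReal * f (Δ.piecewise σ η) ∂Measure.infinitePi u := by
  have hm := measurable_piecewise_left Δ η
  rw [resample, integral_smul_measure, integral_map hm.aemeasurable
    hf.measurable.aestronglyMeasurable, integral_withDensity_eq_integral_toReal_smul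
    (hw.measurable.fun_comp hm) (.of_forall fun σ => (hw.ne_top _).lt_top), ENNReal.toReal_inv]
  rfl

lemma IsWeight.continuous_toReal {X : Type*} [TopologicalSpace X] [MeasurableSpace X]
    {w : X → ℝ≥0∞} (hw : IsWeight w) (hc : Continuous w) :
    Continuous fun ω => (w ω).toReal :=
  continuous_iff_continuousAt.2 fun ω =>
    (ENNReal.tendsto_toReal (hw.ne_top ω)).comp hc.continuousAt

/-- The Feller property of resampling. -/
lemma continuous_integral_resample (hw : IsWeight w) (hc : Continuous w) {f : (S → Spin) → ℝ}
    (hf : Continuous f) : Continuous fun η => ∫ ω, f ω ∂resample u w Δ η := by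
  have hw' := hw.continuous_toReal hc
  simp_rw [integral_resample hw hf]
  refine Continuous.mul (Continuous.inv₀ ?_ fun η => ?_) ?_
  · simp_rw [partitionFunction_toReal hw]
    exact continuous_integral_piecewise hw' Δ
  · exact ENNReal.toReal_ne_zero.2 ⟨(hw.partitionFunction Δ).ne_zero η,
      (hw.partitionFunction Δ).ne_top η⟩
  · exact continuous_integral_piecewise (hw'.mul hf) Δ

lemma integral_bind_resample (hw : IsWeight w) (P : Measure (S → Spin)) [IsProbabilityMeasure P]
    {f : (S → Spin) → ℝ} (hf : Continuous f) :
    ∫ ω, f ω ∂P.bind (resample u w Δ) = ∫ η, ∫ ω, f ω ∂resample u w Δ η ∂P := by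
  have := fun η => isProbabilityMeasure_resample (u := u) hw Δ η
  let κ : Kernel (S → Spin) (S → Spin) := ⟨resample u w Δ, measurable_resample hw.measurable⟩
  have : IsMarkovKernel κ := ⟨this⟩
  have h := Kernel.integral_comp (κ := Kernel.const Unit P) (η := κ) (a := ())
    (integrable_of_continuous hf _)
  rwa [Kernel.comp_apply, Kernel.const_apply] at h

lemma IsInvariant.integral (hw : IsWeight w) {P : Measure (S → Spin)} [IsProbabilityMeasure P]
    (h : IsInvariant u w Δ P) {f : (S → Spin) → ℝ} (hf : Continuous f) :
    ∫ η, ∫ ω, f ω ∂resample u w Δ η ∂P = ∫ η, f η ∂P := by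
  rw [← integral_bind_resample hw P hf, h]

lemma isInvariant_of_integral (hw : IsWeight w) {P : Measure (S → Spin)} [IsProbabilityMeasure P]
    (h : ∀ f : (S → Spin) → ℝ, Continuous f →
      ∫ η, ∫ ω, f ω ∂resample u w Δ η ∂P = ∫ η, f η ∂P) : IsInvariant u w Δ P := by
  have := fun η => isProbabilityMeasure_resample (u := u) hw Δ η
  have : IsFiniteMeasure (P.bind (resample u w Δ)) := ⟨by
    rw [Measure.bind_apply .univ (measurable_resample hw.measurable).aemeasurable]
    simp⟩
  refine ext_of_forall_integral_eq_of_IsFiniteMeasure fun f => ?_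
  rw [integral_bind_resample hw P f.continuous]
  exact h f f.continuous

/-- For continuous `f`, invariance is an equality between the integrals of two continuous functions,
the resampled `f` being continuous by the Feller property. Such equalities pass to weak limits. -/
lemma isInvariant_of_tendsto (hw : IsWeight w) (hc : Continuous w) {ι : Type*} {l : Filter ι}
    [l.NeBot] {P : ι → ProbabilityMeasure (S → Spin)} {Q : ProbabilityMeasure (S → Spin)}
    (hP : Tendsto P l (𝓝 Q)) (h : ∀ᶠ i in l, IsInvariant u w Δ (P i : Measure (S → Spin))) :
    IsInvariant u w Δ (Q : Measure (S → Spin)) := by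
  refine isInvariant_of_integral hw fun f hf => ?_
  rw [ProbabilityMeasure.tendsto_iff_forall_integral_tendsto] at hP
  have h1 := hP (BoundedContinuousFunction.mkOfCompact ⟨f, hf⟩)
  have h2 := hP (BoundedContinuousFunction.mkOfCompact
    ⟨_, continuous_integral_resample (u := u) (Δ := Δ) hw hc hf⟩)
  refine tendsto_nhds_unique (h2.congr' ?_) h1
  filter_upwards [h] with i hi
  exact hi.integral hw hf

lemma exists_tendsto_probabilityMeasure {ι : Type*} (l : Ultrafilter ι)
    (P : ι → ProbabilityMeasure (S → Spin)) : ∃ Q, Tendsto P l (𝓝 Q) :=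
  ⟨_, (l.map P).le_nhds_lim⟩

/-- Continuous weights that define a consistent family of conditional laws. -/
structure IsWeightFamily (w : Finset S → (S → Spin) → ℝ≥0∞) : Prop where
  isWeight : ∀ Δ, IsWeight (w Δ)
  continuous : ∀ Δ, Continuous (w Δ)
  consistent : ∀ Δ Λ, Δ ⊆ Λ → ∃ c : (S → Spin) → ℝ≥0∞, IsWeight c ∧
    (∀ σ η, c (Δ.piecewise σ η) = c η) ∧ ∀ ω, w Λ ω = w Δ ω * c ω

/-- Multiplying the weight by `c⁻¹`, which does not feel `Δ` either, cancels `c`. -/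
lemma IsReversible.of_mul_outside {P : Measure (S → Spin)} {c : (S → Spin) → ℝ≥0∞}
    (h : IsReversible u (fun ω => w ω * c ω) Δ P) (hc : IsWeight c)
    (hc' : ∀ σ η, c (Δ.piecewise σ η) = c η) : IsReversible u w Δ P := by
  have h1 := h.mul_outside hc.inv.measurable fun σ η => by rw [hc']
  have h2 : (fun ω => w ω * c ω * (c ω)⁻¹) = w := by
    ext ω
    rw [mul_assoc, ENNReal.mul_inv_cancel (hc.ne_zero ω) (hc.ne_top ω), mul_one]
  rwa [h2] at h1

lemma IsWeightFamily.isInvariant_resample {w : Finset S → (S → Spin) → ℝ≥0∞}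
    (hw : IsWeightFamily w) (h : Δ ⊆ Λ) (η : S → Spin) :
    IsInvariant u (w Δ) Δ (resample u (w Λ) Λ η) := by
  obtain ⟨c, hc, hc', hcw⟩ := hw.consistent Δ Λ h
  have h1 := isReversible_resample (u := u) (hw.isWeight Λ).measurable h η
  have h2 : (w Λ) = fun ω => w Δ ω * c ω := funext hcw
  have h3 : IsReversible u (fun ω => w Δ ω * c ω) Δ (resample u (w Λ) Λ η) := h2 ▸ h1
  exact (h3.of_mul_outside hc hc').isInvariant (hw.isWeight Δ)

/-- Finite-volume laws with a fixed boundary condition, here `0`, converge by compactness along an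
ultrafilter finer than `atTop`. Every `Δ` is eventually contained in the volume, and from then on
consistency makes the law invariant in `Δ`. -/
theorem IsWeightFamily.exists_isInvariant {w : Finset S → (S → Spin) → ℝ≥0∞}
    (hw : IsWeightFamily w) (u : S → Measure Spin) [∀ x, IsProbabilityMeasure (u x)] :
    ∃ P : ProbabilityMeasure (S → Spin),
      ∀ Δ, IsInvariant u (w Δ) Δ (P : Measure (S → Spin)) := by
  let l : Ultrafilter (Finset S) := Ultrafilter.of atTop
  let P : Finset S → ProbabilityMeasure (S → Spin) := fun Λ =>
    ⟨resample u (w Λ) Λ 0, isProbabilityMeasure_resample (hw.isWeight Λ) Λ 0⟩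
  obtain ⟨Q, hQ⟩ := exists_tendsto_probabilityMeasure l P
  refine ⟨Q, fun Δ => isInvariant_of_tendsto (hw.isWeight Δ) (hw.continuous Δ) hQ ?_⟩
  have h : ∀ᶠ Λ in (l : Filter (Finset S)), Δ ⊆ Λ :=
    Ultrafilter.of_le atTop (eventually_ge_atTop Δ)
  filter_upwards [h] with Λ hΛ
  exact hw.isInvariant_resample hΛ 0

end Limits

/-! ### Dobrushin's uniqueness theorem -/

section Dobrushin

open Filter Topology

lemma ofReal_abs_sub_le_tvDist {X : Type*} [MeasurableSpace X] (μ ν : Measure X) {A : Set X}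
    (hA : MeasurableSet A) : ENNReal.ofReal |μ.real A - ν.real A| ≤ tvDist μ ν :=
  le_iSup₂ (f := fun (A : Set X) (_ : MeasurableSet A) =>
    ENNReal.ofReal |μ.real A - ν.real A|) A hA

lemma tvDist_le_one {X : Type*} [MeasurableSpace X] (μ ν : Measure X) [IsProbabilityMeasure μ]
    [IsProbabilityMeasure ν] : tvDist μ ν ≤ 1 := by
  refine iSup₂_le fun A _ => ?_
  rw [← ENNReal.ofReal_one]
  refine ENNReal.ofReal_le_ofReal (abs_sub_le_iff.2 ⟨?_, ?_⟩)
  · linarith [measureReal_nonneg (μ := ν) (s := A), measureReal_le_one (μ := μ) (s := A)]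
  · linarith [measureReal_nonneg (μ := μ) (s := A), measureReal_le_one (μ := ν) (s := A)]

lemma integrableOn_measureReal_le {X : Type*} [MeasurableSpace X] (μ : Measure X)
    [IsProbabilityMeasure μ] (g : X → ℝ) (M : ℝ) :
    IntegrableOn (fun t => μ.real {a | t ≤ g a}) (Set.Ioc 0 M) := by
  have h : Antitone fun t => μ.real {a | t ≤ g a} := fun s t hst =>
    measureReal_mono (fun a (ha : t ≤ g a) => hst.trans ha)
  refine Integrable.of_bound h.measurable.aestronglyMeasurable 1 (.of_forall fun t => ?_)
  rw [Real.norm_of_nonneg measureReal_nonneg]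
  exact measureReal_le_one

/-- Layer-cake formula: on `A` the values of `g` lie in `[lo, lo + M]`, so either integral is `lo`
plus the integral over `(0, M]` of the tail probabilities. The two tails differ by at most the total
variation distance at each level. -/
lemma abs_integral_sub_le_tvDist {X : Type*} [MeasurableSpace X] (μ ν : Measure X)
    [IsProbabilityMeasure μ] [IsProbabilityMeasure ν] {A : Set X} (hμ : ∀ᵐ s ∂μ, s ∈ A)
    (hν : ∀ᵐ s ∂ν, s ∈ A) {g : X → ℝ} (hg : Measurable g) {M : ℝ}
    (hM : ∀ s ∈ A, ∀ t ∈ A, g s - g t ≤ M) :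
    |∫ s, g s ∂μ - ∫ s, g s ∂ν| ≤ M * (tvDist μ ν).toReal := by
  obtain ⟨s₀, hs₀⟩ := hμ.exists
  have hM0 : 0 ≤ M := by simpa using hM s₀ hs₀ s₀ hs₀
  set lo := sInf (g '' A)
  have hbdd : BddBelow (g '' A) := ⟨g s₀ - M, by
    rintro _ ⟨t, ht, rfl⟩
    linarith [hM s₀ hs₀ t ht]⟩
  have h0 : ∀ s ∈ A, 0 ≤ g s - lo := fun s hs =>
    sub_nonneg.2 (csInf_le hbdd ⟨s, hs, rfl⟩)
  have h1 : ∀ s ∈ A, g s - lo ≤ M := by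
    intro s hs
    have : g s - M ≤ lo := le_csInf ⟨_, s₀, hs₀, rfl⟩ (by
      rintro _ ⟨t, ht, rfl⟩
      linarith [hM s hs t ht])
    linarith
  have key : ∀ (ρ : Measure X) [IsProbabilityMeasure ρ], (∀ᵐ s ∂ρ, s ∈ A) →
      ∫ s, g s ∂ρ = (∫ t in Set.Ioc 0 M, ρ.real {a | t ≤ g a - lo}) + lo := by
    intro ρ _ hρ
    have hi : Integrable (fun s => g s - lo) ρ := by
      refine Integrable.of_bound (hg.sub_const lo).aestronglyMeasurable M ?_
      filter_upwards [hρ] with s hs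
      rw [Real.norm_of_nonneg (h0 s hs)]
      exact h1 s hs
    rw [← hi.integral_eq_integral_Ioc_meas_le (hρ.mono h0) (hρ.mono h1)]
    have : ∫ s, g s ∂ρ = ∫ s, ((g s - lo) + lo) ∂ρ := by simp
    rw [this, integral_add hi (integrable_const _)]
    simp
  rw [key μ hμ, key ν hν, add_sub_add_right_eq_sub,
    ← integral_sub (integrableOn_measureReal_le μ _ M) (integrableOn_measureReal_le ν _ M)]
  have h2 := norm_setIntegral_le_of_norm_le_const (μ := volume) (s := Set.Ioc 0 M)
    (f := fun t => μ.real {a | t ≤ g a - lo} - ν.real {a | t ≤ g a - lo})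
    (C := (tvDist μ ν).toReal) (by simp) (fun t _ => by
      rw [Real.norm_eq_abs]
      refine (ENNReal.ofReal_le_iff_le_toReal
        (ne_top_of_le_ne_top ENNReal.one_ne_top (tvDist_le_one μ ν))).1
        (ofReal_abs_sub_le_tvDist μ ν ?_)
      exact measurableSet_le measurable_const (hg.sub_const lo))
  rw [Real.norm_eq_abs] at h2
  refine h2.trans_eq ?_
  rw [Real.volume_real_Ioc_of_le hM0, sub_zero, mul_comm]

variable {I : Type*} [DecidableEq I] [Countable I]

/-- The oscillation of `f` at the site `y`, over the configurations in `∏ A z`. -/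
def oscillation (A : I → Set Spin) (y : I) (f : (I → Spin) → ℝ) : ℝ≥0∞ :=
  ⨆ (ξ : I → Spin) (η : I → Spin) (_ : ∀ z, ξ z ∈ A z) (_ : ∀ z, η z ∈ A z)
    (_ : ∀ z, z ≠ y → ξ z = η z), ENNReal.ofReal |f ξ - f η|

variable {A : I → Set Spin} {f : (I → Spin) → ℝ}

lemma le_oscillation {y : I} {ξ η : I → Spin} (hξ : ∀ z, ξ z ∈ A z) (hη : ∀ z, η z ∈ A z)
    (h : ∀ z, z ≠ y → ξ z = η z) : ENNReal.ofReal |f ξ - f η| ≤ oscillation A y f := by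
  unfold oscillation
  exact le_iSup_of_le ξ <| le_iSup_of_le η <| le_iSup_of_le hξ <| le_iSup_of_le hη <|
    le_iSup_of_le h le_rfl

lemma oscillation_le {y : I} {K : ℝ≥0∞} (h : ∀ ξ η : I → Spin, (∀ z, ξ z ∈ A z) →
    (∀ z, η z ∈ A z) → (∀ z, z ≠ y → ξ z = η z) → ENNReal.ofReal |f ξ - f η| ≤ K) :
    oscillation A y f ≤ K :=
  iSup_le fun ξ => iSup_le fun η => iSup_le fun hξ => iSup_le fun hη => iSup_le fun h' =>
    h ξ η hξ hη h'

lemma oscillation_ne_top (hf : Continuous f) (y : I) : oscillation A y f ≠ ∞ := by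
  obtain ⟨M, hM⟩ := exists_bound_of_continuous hf
  refine ne_top_of_le_ne_top (ENNReal.ofReal_ne_top (r := M + M))
    (oscillation_le fun ξ η _ _ _ => ENNReal.ofReal_le_ofReal ?_)
  exact (abs_sub _ _).trans (add_le_add (hM ξ) (hM η))

/-- The sites of a finite set are changed one at a time and the differences telescope. The
intermediate configurations stay in `∏ A z` because it is a product. Continuity of `f` then lets the
finite set grow to all sites. -/
lemma ofReal_abs_sub_le_tsum_oscillation (hf : Continuous f) {ξ η : I → Spin}
    (hξ : ∀ z, ξ z ∈ A z) (hη : ∀ z, η z ∈ A z) :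
    ENNReal.ofReal |f ξ - f η| ≤ ∑' y, oscillation A y f := by
  have hX : ∀ Δ : Finset I, ∀ z, Δ.piecewise ξ η z ∈ A z := fun Δ z => by
    by_cases hz : z ∈ Δ <;> simp [hz, hξ, hη]
  have h1 : ∀ Δ : Finset I,
      ENNReal.ofReal |f (Δ.piecewise ξ η) - f η| ≤ ∑ y ∈ Δ, oscillation A y f := by
    intro Δ
    induction Δ using Finset.induction_on with
    | empty => simp
    | insert y Δ hy ih =>
      rw [Finset.sum_insert hy]
      calc ENNReal.ofReal |f ((insert y Δ).piecewise ξ η) - f η|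
          ≤ ENNReal.ofReal (|f ((insert y Δ).piecewise ξ η) - f (Δ.piecewise ξ η)|
            + |f (Δ.piecewise ξ η) - f η|) := ENNReal.ofReal_le_ofReal (abs_sub_le _ _ _)
        _ ≤ _ := ENNReal.ofReal_add_le
        _ ≤ _ := by
          refine add_le_add (le_oscillation (hX _) (hX _) fun z hz => ?_) ih
          by_cases hzΔ : z ∈ Δ <;> simp [hzΔ, hz]
  have h2 : Tendsto (fun Δ : Finset I => Δ.piecewise ξ η) atTop (𝓝 ξ) := by
    rw [tendsto_pi_nhds]
    intro x
    refine tendsto_const_nhds.congr' ?_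
    filter_upwards [eventually_ge_atTop {x}] with Δ hΔ
    simp [Finset.singleton_subset_iff.1 hΔ]
  have h3 : Tendsto (fun Δ : Finset I => ENNReal.ofReal |f (Δ.piecewise ξ η) - f η|) atTop
      (𝓝 (ENNReal.ofReal |f ξ - f η|)) :=
    ENNReal.tendsto_ofReal ((((hf.tendsto ξ).comp h2).sub_const _).abs)
  exact le_of_tendsto h3 (.of_forall fun Δ => (h1 Δ).trans (ENNReal.sum_le_tsum Δ))

lemma ofReal_abs_integral_sub_le_tsum_oscillation (hf : Continuous f) (P Q : Measure (I → Spin))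
    [IsProbabilityMeasure P] [IsProbabilityMeasure Q] (hP : ∀ᵐ ω ∂P, ∀ z, ω z ∈ A z)
    (hQ : ∀ᵐ ω ∂Q, ∀ z, ω z ∈ A z) :
    ENNReal.ofReal |∫ ω, f ω ∂P - ∫ ω, f ω ∂Q| ≤ ∑' y, oscillation A y f := by
  by_cases hM : ∑' y, oscillation A y f = ∞
  · simp [hM]
  rw [ENNReal.ofReal_le_iff_le_toReal hM]
  set M := (∑' y, oscillation A y f).toReal
  have hfi := fun (ρ : Measure (I → Spin)) [IsProbabilityMeasure ρ] => integrable_of_continuous hf ρ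
  have h0 : ∀ η : I → Spin, (∀ z, η z ∈ A z) → ‖∫ ω, f ω ∂P - f η‖ ≤ M := by
    intro η hη
    have : ∫ ω, f ω ∂P - f η = ∫ ω, (f ω - f η) ∂P := by
      rw [integral_sub (hfi P) (integrable_const _)]
      simp
    rw [this]
    refine (norm_integral_le_of_norm_le_const (C := M) ?_).trans_eq (by simp)
    filter_upwards [hP] with ω hω
    exact (ENNReal.ofReal_le_iff_le_toReal hM).1 (ofReal_abs_sub_le_tsum_oscillation hf hω hη)
  have h1 : ∫ ω, f ω ∂P - ∫ ω, f ω ∂Q = ∫ η, (∫ ω, f ω ∂P - f η) ∂Q := by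
    rw [integral_sub (integrable_const _) (hfi Q)]
    simp
  rw [h1, ← Real.norm_eq_abs]
  exact (norm_integral_le_of_norm_le_const (hQ.mono h0)).trans_eq (by simp)

lemma continuous_update_right {E : Type*} [TopologicalSpace E] (η : I → E) (x : I) :
    Continuous fun s : E => Function.update η x s :=
  continuous_const.update x continuous_id

/-- A change at `y` acts in two ways: through the integrand, which costs at most the oscillation at
`y` and nothing if `y = x` since that spin is overwritten, and through the law `p η`, which costs a
total variation distance times the oscillation at `x`. -/
lemma oscillation_integral_update_le {p : (I → Spin) → Measure Spin}
    [∀ η, IsProbabilityMeasure (p η)] {x : I} (hpA : ∀ η, ∀ᵐ s ∂p η, s ∈ A x) {c : I → ℝ≥0∞}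
    (hc : ∀ y ξ η, (∀ z, ξ z ∈ A z) → (∀ z, η z ∈ A z) → (∀ z, z ≠ y → ξ z = η z) →
      tvDist (p ξ) (p η) ≤ c y) (hf : Continuous f) (y : I) :
    oscillation A y (fun η => ∫ s, f (Function.update η x s) ∂p η)
      ≤ (if y = x then 0 else oscillation A y f) + c y * oscillation A x f := by
  refine oscillation_le fun ξ η hξ hη h => ?_
  have hcu : ∀ ζ : I → Spin, Continuous fun s => f (Function.update ζ x s) :=
    fun ζ => hf.comp (continuous_update_right ζ x)
  have hupd : ∀ ζ : I → Spin, (∀ z, ζ z ∈ A z) → ∀ s ∈ A x, ∀ z,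
      Function.update ζ x s z ∈ A z := by
    intro ζ hζ s hs z
    by_cases hz : z = x
    · subst hz
      simpa using hs
    · simpa [hz] using hζ z
  have h1 : |∫ s, f (Function.update ξ x s) ∂p ξ - ∫ s, f (Function.update ξ x s) ∂p η|
      ≤ (oscillation A x f).toReal * (tvDist (p ξ) (p η)).toReal := by
    refine abs_integral_sub_le_tvDist _ _ (hpA ξ) (hpA η) (hcu ξ).measurable
      fun s hs t ht => (le_abs_self _).trans ?_
    refine (ENNReal.ofReal_le_iff_le_toReal (oscillation_ne_top hf x)).1
      (le_oscillation (hupd ξ hξ s hs) (hupd ξ hξ t ht) fun z hz => by simp [hz])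
  have h2 : ENNReal.ofReal
      |∫ s, f (Function.update ξ x s) ∂p η - ∫ s, f (Function.update η x s) ∂p η|
      ≤ if y = x then 0 else oscillation A y f := by
    split_ifs with hyx
    · subst hyx
      have : ∀ s, Function.update ξ y s = Function.update η y s := by
        intro s
        ext z
        by_cases hz : z = y
        · subst hz
          simp
        · simp [hz, h z hz]
      simp [this]
    · rw [ENNReal.ofReal_le_iff_le_toReal (oscillation_ne_top hf y),
        ← integral_sub (integrable_of_continuous (hcu ξ) _) (integrable_of_continuous (hcu η) _),
        ← Real.norm_eq_abs]
      refine (norm_integral_le_of_norm_le_const (C := (oscillation A y f).toReal) ?_).trans_eq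
        (by simp)
      filter_upwards [hpA η] with s hs
      refine (ENNReal.ofReal_le_iff_le_toReal (oscillation_ne_top hf y)).1
        (le_oscillation (hupd ξ hξ s hs) (hupd η hη s hs) fun z hz => ?_)
      by_cases hzx : z = x
      · subst hzx
        simp
      · simp [hzx, h z hz]
  calc ENNReal.ofReal |∫ s, f (Function.update ξ x s) ∂p ξ - ∫ s, f (Function.update η x s) ∂p η|
      ≤ ENNReal.ofReal
          (|∫ s, f (Function.update ξ x s) ∂p η - ∫ s, f (Function.update η x s) ∂p η| +
          |∫ s, f (Function.update ξ x s) ∂p ξ - ∫ s, f (Function.update ξ x s) ∂p η|) := by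
        refine ENNReal.ofReal_le_ofReal ?_
        rw [add_comm]
        exact abs_sub_le _ _ _
    _ ≤ _ := ENNReal.ofReal_add_le
    _ ≤ _ := by
      refine add_le_add h2 ((ENNReal.ofReal_le_ofReal h1).trans ?_)
      rw [ENNReal.ofReal_mul ENNReal.toReal_nonneg,
        ENNReal.ofReal_toReal (oscillation_ne_top hf x), ENNReal.ofReal_toReal
        (ne_top_of_le_ne_top ENNReal.one_ne_top (tvDist_le_one _ _)), mul_comm]
      gcongr
      exact hc y ξ η hξ hη h

lemma ext_of_integral_local {P Q : Measure (I → Spin)} [IsProbabilityMeasure P]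
    [IsProbabilityMeasure Q] (h : ∀ (F : Finset I) (g : (F → Spin) → ℝ), Continuous g →
      ∫ ω, g (F.restrict ω) ∂P = ∫ ω, g (F.restrict ω) ∂Q) : P = Q := by
  have hP : IsProjectiveLimit P fun F : Finset I => P.map F.restrict := fun F => rfl
  refine hP.unique fun F => ?_
  have hm : Measurable (F.restrict : (I → Spin) → (F → Spin)) := Finset.measurable_restrict F
  have := Measure.isProbabilityMeasure_map (μ := P) hm.aemeasurable
  have := Measure.isProbabilityMeasure_map (μ := Q) hm.aemeasurable
  refine ext_of_forall_integral_eq_of_IsFiniteMeasure fun g => ?_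
  rw [integral_map hm.aemeasurable g.continuous.measurable.aestronglyMeasurable,
    integral_map hm.aemeasurable g.continuous.measurable.aestronglyMeasurable]
  exact (h F g g.continuous).symm

/-- The difference of the two expectations is bounded by `∑ a y * oscillation y`, starting from `a =
1`. Smoothing at one site after another, which neither measure notices, shrinks the coefficients by
the factor `c`; iterating sends them to zero. Everything takes place on `∏ A z`, the only region
where `C` controls the kernels. -/
theorem dobrushin_uniqueness {p : I → (I → Spin) → Measure Spin}
    [∀ x η, IsProbabilityMeasure (p x η)] (hpA : ∀ x η, ∀ᵐ s ∂p x η, s ∈ A x)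
    (hcont : ∀ x (f : (I → Spin) → ℝ), Continuous f →
      Continuous fun η => ∫ s, f (Function.update η x s) ∂p x η)
    {C : I → I → ℝ≥0∞}
    (hC : ∀ x y ξ η, (∀ z, ξ z ∈ A z) → (∀ z, η z ∈ A z) → (∀ z, z ≠ y → ξ z = η z) →
      tvDist (p x ξ) (p x η) ≤ C x y)
    {c : ℝ≥0∞} (hc : ∀ x, ∑' y, C x y ≤ c) (hc1 : c < 1) {P Q : Measure (I → Spin)}
    [IsProbabilityMeasure P] [IsProbabilityMeasure Q] (hPA : ∀ᵐ ω ∂P, ∀ z, ω z ∈ A z)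
    (hQA : ∀ᵐ ω ∂Q, ∀ z, ω z ∈ A z)
    (hP : ∀ x (f : (I → Spin) → ℝ), Continuous f →
      ∫ η, ∫ s, f (Function.update η x s) ∂p x η ∂P = ∫ η, f η ∂P)
    (hQ : ∀ x (f : (I → Spin) → ℝ), Continuous f →
      ∫ η, ∫ s, f (Function.update η x s) ∂p x η ∂Q = ∫ η, f η ∂Q) : P = Q := by
  let Est : (I → ℝ≥0∞) → Prop := fun a => ∀ f : (I → Spin) → ℝ, Continuous f →
    ∑' y, oscillation A y f ≠ ∞ →
    ENNReal.ofReal |∫ ω, f ω ∂P - ∫ ω, f ω ∂Q| ≤ ∑' y, a y * oscillation A y f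
  -- The estimate for the function smoothed at `x` has `∑ y, a y * C x y ≤ b * c` in front of the
  -- oscillation of `f` at `x`, while the old term at `x` has disappeared.
  have hstep : ∀ (a : I → ℝ≥0∞) (b : ℝ≥0∞) (x : I), Est a → (∀ y, a y ≤ b) →
      Est (Function.update a x (c * b)) := by
    intro a b x ha hab f hf hfin
    have hK := fun y => oscillation_integral_update_le (hpA x) (hC x) hf y
    have hsum : ∑' y, C x y * oscillation A x f ≤ c * oscillation A x f := by
      rw [ENNReal.tsum_mul_right]
      gcongr
      exact hc x
    -- `Est` only speaks of functions of finite total oscillation, so smoothing must be shown to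
    -- preserve this class.
    have hfin' : ∑' y, oscillation A y (fun η => ∫ s, f (Function.update η x s) ∂p x η) ≠ ∞ := by
      refine ne_top_of_le_ne_top ?_ (ENNReal.tsum_le_tsum hK)
      rw [ENNReal.tsum_add]
      refine ENNReal.add_ne_top.2 ⟨ne_top_of_le_ne_top hfin (ENNReal.tsum_le_tsum fun y => ?_),
        ne_top_of_le_ne_top (ENNReal.mul_ne_top hc1.ne_top (oscillation_ne_top hf x)) hsum⟩
      split_ifs <;> simp
    have h1 := ha _ (hcont x f hf) hfin'
    rw [hP x f hf, hQ x f hf] at h1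
    refine h1.trans ?_
    calc ∑' y, a y * oscillation A y (fun η => ∫ s, f (Function.update η x s) ∂p x η)
        ≤ ∑' y, ((if y = x then 0 else a y * oscillation A y f) +
          b * (C x y * oscillation A x f)) := by
          refine ENNReal.tsum_le_tsum fun y => (mul_le_mul_right (hK y) _).trans ?_
          rw [mul_add]
          refine add_le_add ?_ (mul_le_mul_left (hab y) _)
          split_ifs <;> simp
      _ ≤ (∑' y, if y = x then 0 else a y * oscillation A y f) +
          ∑' y, if y = x then c * b * oscillation A x f else 0 := by
          rw [ENNReal.tsum_add, ENNReal.tsum_mul_left, tsum_ite_eq]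
          refine add_le_add le_rfl ((mul_le_mul_right hsum b).trans_eq ?_)
          ring
      _ = ∑' y, Function.update a x (c * b) y * oscillation A y f := by
          rw [← ENNReal.tsum_add]
          refine tsum_congr fun y => ?_
          by_cases hy : y = x
          · subst hy
            simp
          · simp [hy]
  -- The sites of `F` are treated successively; since `c < 1`, all coefficients remain at most `b`
  -- and the step can be repeated.
  have hfinset : ∀ b, Est (fun _ => b) → ∀ F : Finset I,
      Est fun y => if y ∈ F then c * b else b := by
    intro b hb F
    induction F using Finset.induction_on with
    | empty => simpa using hb
    | insert x F hx ih =>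
      have h1 := hstep _ b x ih fun y => by
        split_ifs
        · exact (mul_le_mul_left hc1.le b).trans_eq (one_mul b)
        · exact le_rfl
      convert h1 using 1
      ext y
      by_cases hy : y = x
      · subst hy
        simp
      · simp [hy]
  -- As `F` grows, the sites not yet treated contribute `b` times the tail of a convergent series,
  -- which vanishes in the limit.
  have hconst : ∀ b, b ≠ ∞ → Est (fun _ => b) → Est fun _ => c * b := by
    intro b hb hE f hf hfin
    have h1 : ∀ F : Finset I, ENNReal.ofReal |∫ ω, f ω ∂P - ∫ ω, f ω ∂Q| ≤
        ∑' y, c * b * oscillation A y f + b * ∑' y : {y // y ∉ F}, oscillation A y f := by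
      intro F
      refine (hfinset b hE F f hf hfin).trans ?_
      have h2 : ∑' y : {y // y ∉ F}, oscillation A y f
          = ∑' y, if y ∈ F then 0 else oscillation A y f := by
        refine (tsum_subtype {y | y ∉ F} (fun y => oscillation A y f)).trans
          (tsum_congr fun y => ?_)
        by_cases hy : y ∈ F <;> simp [hy]
      rw [h2, ← ENNReal.tsum_mul_left, ← ENNReal.tsum_add]
      refine ENNReal.tsum_le_tsum fun y => ?_
      by_cases hy : y ∈ F <;> simp [hy]
    have h3 : Tendsto (fun F : Finset I => ∑' y, c * b * oscillation A y f +
        b * ∑' y : {y // y ∉ F}, oscillation A y f) atTop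
        (𝓝 (∑' y, c * b * oscillation A y f + b * 0)) :=
      tendsto_const_nhds.add (ENNReal.Tendsto.const_mul
        (ENNReal.tendsto_tsum_compl_atTop_zero hfin) (.inr hb))
    rw [mul_zero, add_zero] at h3
    exact ge_of_tendsto' h3 h1
  have hpow : ∀ n : ℕ, Est fun _ => c ^ n := by
    intro n
    induction n with
    | zero =>
      intro f hf _
      simpa using ofReal_abs_integral_sub_le_tsum_oscillation hf P Q hPA hQA
    | succ n ih =>
      simp only [pow_succ']
      exact hconst _ (ENNReal.pow_ne_top hc1.ne_top) ih
  refine ext_of_integral_local fun F g hg => ?_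
  have hf : Continuous fun ω : I → Spin => g (F.restrict ω) :=
    hg.comp (continuous_pi fun x => continuous_apply _)
  have hfin : ∑' y, oscillation A y (fun ω : I → Spin => g (F.restrict ω)) ≠ ∞ := by
    rw [tsum_eq_sum (s := F)]
    · exact ENNReal.sum_ne_top.2 fun y _ => oscillation_ne_top hf y
    · intro y hy
      refine le_zero_iff.1 (oscillation_le fun ξ η _ _ h => ?_)
      have : F.restrict ξ = F.restrict η := by
        ext1 z
        exact h z fun hz => hy (hz ▸ z.2)
      simp [this]
  have h1 : Tendsto (fun n : ℕ => ∑' y, c ^ n *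
      oscillation A y (fun ω : I → Spin => g (F.restrict ω))) atTop (𝓝 0) := by
    simp_rw [ENNReal.tsum_mul_left]
    have := ENNReal.Tendsto.mul_const (ENNReal.tendsto_pow_atTop_nhds_zero_of_lt_one hc1)
      (.inr hfin)
    simpa using this
  have h2 := ge_of_tendsto' h1 fun n => hpow n _ hf hfin
  have h3 := ENNReal.ofReal_eq_zero.1 (le_zero_iff.1 h2)
  exact sub_eq_zero.1 (abs_nonpos_iff.1 h3)

end Dobrushin

/-! ### Regular potentials -/

section Potentials

variable {S : Type*} [DecidableEq S]

lemma glue_of_mem {E : Type*} {Λ : Finset S} (σ : Λ → E) (τ : {x // x ∉ Λ} → E) {x : S}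
    (h : x ∈ Λ) : glue Λ σ τ x = σ ⟨x, h⟩ := dif_pos h

lemma glue_of_notMem {E : Type*} {Λ : Finset S} (σ : Λ → E) (τ : {x // x ∉ Λ} → E) {x : S}
    (h : x ∉ Λ) : glue Λ σ τ x = τ ⟨x, h⟩ := dif_neg h

lemma glue_restrict_outside {E : Type*} (Λ : Finset S) (σ η : S → E) :
    glue Λ (Λ.restrict σ) (outside Λ η) = Λ.piecewise σ η := by
  ext x
  by_cases hx : x ∈ Λ <;> simp [glue, hx, outside]

lemma outside_glue {E : Type*} (Λ : Finset S) (σ : Λ → E) (τ : {x // x ∉ Λ} → E) :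
    outside Λ (glue Λ σ τ) = τ := by
  ext x
  simp [glue, outside, x.2]

lemma outside_piecewise {E : Type*} (Λ : Finset S) (σ η : S → E) :
    outside Λ (Λ.piecewise σ η) = outside Λ η := by
  ext x
  simp [outside, x.2]

lemma glue_outside_self {E : Type*} (Λ : Finset S) (ω : S → E) :
    glue Λ (Λ.restrict ω) (outside Λ ω) = ω := by
  rw [glue_restrict_outside, Finset.piecewise_same]

lemma measurable_glue {E : Type*} [MeasurableSpace E] (Λ : Finset S) :
    Measurable fun p : (Λ → E) × ({x // x ∉ Λ} → E) => glue Λ p.1 p.2 := by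
  refine measurable_pi_lambda _ fun x => ?_
  by_cases hx : x ∈ Λ
  · simpa [glue, hx] using (measurable_pi_apply _).fun_comp measurable_fst
  · simpa [glue, hx] using (measurable_pi_apply _).fun_comp measurable_snd

lemma measurable_glue_left {E : Type*} [MeasurableSpace E] (Λ : Finset S)
    (τ : {x // x ∉ Λ} → E) : Measurable fun σ : Λ → E => glue Λ σ τ :=
  (measurable_glue Λ).comp (measurable_id.prodMk (measurable_const (a := τ)))

lemma measurable_glue_right {E : Type*} [MeasurableSpace E] (Λ : Finset S)
    (σ : Λ → E) : Measurable fun τ : {x // x ∉ Λ} → E => glue Λ σ τ :=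
  (measurable_glue Λ).comp ((measurable_const (a := σ)).prodMk measurable_id)

lemma measurable_outside {E : Type*} [MeasurableSpace E] (Λ : Finset S) :
    Measurable (outside Λ : (S → E) → _) :=
  measurable_pi_lambda _ fun _ => measurable_pi_apply _

lemma continuous_glue {E : Type*} [TopologicalSpace E] (Λ : Finset S) :
    Continuous fun p : (Λ → E) × ({x // x ∉ Λ} → E) => glue Λ p.1 p.2 := by
  refine continuous_pi fun x => ?_
  by_cases hx : x ∈ Λ
  · simpa [glue, hx] using (continuous_apply _).comp' continuous_fst
  · simpa [glue, hx] using (continuous_apply _).comp' continuous_snd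

lemma continuous_glue_right {E : Type*} [TopologicalSpace E] (Λ : Finset S)
    (σ : Λ → E) : Continuous fun τ : {x // x ∉ Λ} → E => glue Λ σ τ :=
  (continuous_glue Λ).comp ((continuous_const (y := σ)).prodMk continuous_id)

/-- A potential made of continuous local functions that is absolutely summable, uniformly in the
configuration. -/
structure IsRegular (Φ : Finset S → (S → Spin) → ℝ) : Prop where
  continuous : ∀ A, Continuous (Φ A)
  congr : ∀ A ω ω', (∀ x ∈ A, ω x = ω' x) → Φ A ω = Φ A ω'
  summable : ∃ b : Finset S → ℝ, (∀ A ω, |Φ A ω| ≤ b A) ∧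
    ∀ x, Summable fun A => if x ∈ A then b A else 0

namespace IsRegular

variable {Φ : Finset S → (S → Spin) → ℝ}

lemma exists_bound (h : IsRegular Φ) (Λ : Finset S) : ∃ b : Finset S → ℝ, Summable b ∧
    ∀ A ω, ‖if (A ∩ Λ).Nonempty then Φ A ω else 0‖ ≤ b A := by
  obtain ⟨b, hb, hs⟩ := h.summable
  have hb0 : ∀ A, 0 ≤ b A := fun A => (abs_nonneg _).trans (hb A 0)
  refine ⟨fun A => ∑ x ∈ Λ, if x ∈ A then b A else 0, summable_sum fun x _ => hs x,
    fun A ω => ?_⟩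
  have h0 : ∀ x ∈ Λ, 0 ≤ if x ∈ A then b A else 0 := fun x _ => by
    split_ifs
    · exact hb0 A
    · exact le_rfl
  split_ifs with hA
  · obtain ⟨x, hx⟩ := hA
    rw [Finset.mem_inter] at hx
    refine (hb A ω).trans ?_
    calc b A = if x ∈ A then b A else 0 := by rw [if_pos hx.1]
      _ ≤ _ := Finset.single_le_sum h0 hx.2
  · rw [norm_zero]
    exact Finset.sum_nonneg h0

lemma summable_hamiltonian (h : IsRegular Φ) (Λ : Finset S) (ω : S → Spin) :
    Summable fun A => if (A ∩ Λ).Nonempty then Φ A ω else 0 := by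
  obtain ⟨b, hb, hb'⟩ := h.exists_bound Λ
  exact hb.of_norm_bounded fun A => hb' A ω

lemma continuous_hamiltonian (h : IsRegular Φ) (Λ : Finset S) :
    Continuous (hamiltonian Φ Λ) := by
  obtain ⟨b, hb, hb'⟩ := h.exists_bound Λ
  refine continuous_tsum (fun A => ?_) hb hb'
  split_ifs
  · exact h.continuous A
  · exact continuous_const

lemma hamiltonian_sub (h : IsRegular Φ) {Δ Λ : Finset S} (hΔ : Δ ⊆ Λ) (ω : S → Spin) :
    hamiltonian Φ Λ ω - hamiltonian Φ Δ ω
      = ∑' A : Finset S, if (A ∩ Λ).Nonempty ∧ ¬(A ∩ Δ).Nonempty then Φ A ω else 0 := by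
  rw [hamiltonian, hamiltonian,
    ← (h.summable_hamiltonian Λ ω).tsum_sub (h.summable_hamiltonian Δ ω)]
  refine tsum_congr fun A => ?_
  by_cases h1 : (A ∩ Δ).Nonempty
  · have h2 : (A ∩ Λ).Nonempty := h1.mono (Finset.inter_subset_inter_left hΔ)
    simp [h1, h2]
  · by_cases h2 : (A ∩ Λ).Nonempty <;> simp [h1, h2]

/-- Only sets meeting `Λ` but not `Δ` survive in the difference, and their terms do not involve the
spins in `Δ`. This is what makes the Boltzmann weights a consistent family. -/
lemma hamiltonian_sub_piecewise (h : IsRegular Φ) {Δ Λ : Finset S} (hΔ : Δ ⊆ Λ)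
    (σ η : S → Spin) :
    hamiltonian Φ Λ (Δ.piecewise σ η) - hamiltonian Φ Δ (Δ.piecewise σ η)
      = hamiltonian Φ Λ η - hamiltonian Φ Δ η := by
  rw [h.hamiltonian_sub hΔ, h.hamiltonian_sub hΔ]
  refine tsum_congr fun A => ?_
  split_ifs with hA
  · refine h.congr A _ _ fun x hx => ?_
    have : x ∉ Δ := fun hxΔ => hA.2 ⟨x, Finset.mem_inter.2 ⟨hx, hxΔ⟩⟩
    simp [this]
  · rfl

end IsRegular

/-- The Boltzmann weight as a function of the whole configuration. -/
def boltzmann (Φ : Finset S → (S → Spin) → ℝ) (Λ : Finset S) (ω : S → Spin) : ℝ≥0∞ :=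
  ENNReal.ofReal (Real.exp (-hamiltonian Φ Λ ω))

lemma isWeight_ofReal_exp {X : Type*} [TopologicalSpace X] [CompactSpace X] [MeasurableSpace X]
    [BorelSpace X] {g : X → ℝ} (hg : Continuous g) :
    IsWeight fun x => ENNReal.ofReal (Real.exp (g x)) := by
  obtain ⟨M, hM⟩ := exists_bound_of_continuous hg
  refine ⟨ENNReal.measurable_ofReal.comp (Real.measurable_exp.comp hg.measurable),
    ENNReal.ofReal (Real.exp (-M)), ENNReal.ofReal (Real.exp M), ?_, ENNReal.ofReal_ne_top,
    fun x => ⟨?_, ?_⟩⟩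
  · simpa using Real.exp_pos _
  · exact ENNReal.ofReal_le_ofReal (Real.exp_le_exp.2 (abs_le.1 (hM x)).1)
  · exact ENNReal.ofReal_le_ofReal (Real.exp_le_exp.2 (abs_le.1 (hM x)).2)

lemma ofReal_exp_add (a b : ℝ) : ENNReal.ofReal (Real.exp (a + b))
    = ENNReal.ofReal (Real.exp a) * ENNReal.ofReal (Real.exp b) := by
  rw [Real.exp_add, ENNReal.ofReal_mul (Real.exp_pos a).le]

lemma IsRegular.isWeightFamily [Countable S] {Φ : Finset S → (S → Spin) → ℝ} (h : IsRegular Φ) :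
    IsWeightFamily (boltzmann Φ) where
  isWeight Δ := isWeight_ofReal_exp (h.continuous_hamiltonian Δ).neg
  continuous Δ := ENNReal.continuous_ofReal.comp
    (Real.continuous_exp.comp (h.continuous_hamiltonian Δ).neg)
  consistent Δ Λ hΔ := by
    refine ⟨fun ω => ENNReal.ofReal (Real.exp (-(hamiltonian Φ Λ ω - hamiltonian Φ Δ ω))),
      isWeight_ofReal_exp ((h.continuous_hamiltonian Λ).sub (h.continuous_hamiltonian Δ)).neg,
      fun σ η => ?_, fun ω => ?_⟩
    · simp only [h.hamiltonian_sub_piecewise hΔ]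
    · rw [boltzmann, boltzmann, ← ofReal_exp_add]
      congr 2
      ring

/-- The sites of `Λ` together with the sites `Δ` of its complement. -/
def withOutside (Λ : Finset S) (Δ : Finset {x // x ∉ Λ}) : Finset S :=
  Λ ∪ Δ.map (Function.Embedding.subtype _)

lemma IsRegular.restrictPotential {Φ : Finset S → (S → Spin) → ℝ} (h : IsRegular Φ)
    (Λ : Finset S) : IsRegular (restrictPotential Φ Λ) where
  continuous A := (h.continuous _).comp (continuous_glue_right Λ _)
  congr A τ τ' hτ := by
    refine h.congr _ _ _ fun x hx => ?_
    obtain ⟨y, hy, rfl⟩ := Finset.mem_map.1 hx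
    simp only [Function.Embedding.subtype_apply]
    rw [glue_of_notMem _ _ y.2, glue_of_notMem _ _ y.2]
    exact hτ y hy
  summable := by
    obtain ⟨b, hb, hs⟩ := h.summable
    refine ⟨fun A => b (A.map (Function.Embedding.subtype _)), fun A τ => hb _ _, fun x => ?_⟩
    have := (hs x).comp_injective (Finset.map_injective (Function.Embedding.subtype (· ∉ Λ)))
    refine this.congr fun A => ?_
    simp [x.2]

/-- A set meeting the union either meets `Λ` or is contained in `Λᶜ` and meets `Δ`; the sets of the
second kind are exactly those of the restricted potential. -/
lemma IsRegular.hamiltonian_withOutside {Φ : Finset S → (S → Spin) → ℝ} (h : IsRegular Φ)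
    (Λ : Finset S) (Δ : Finset {x // x ∉ Λ}) (ω : S → Spin) :
    hamiltonian Φ (withOutside Λ Δ) ω = hamiltonian Φ Λ ω
      + hamiltonian (DiscretisedGibbs.restrictPotential Φ Λ) Δ (outside Λ ω) := by
  rw [← sub_eq_iff_eq_add', h.hamiltonian_sub (Λ := withOutside Λ Δ) Finset.subset_union_left, hamiltonian]
  have hinj := Finset.map_injective (Function.Embedding.subtype (· ∉ Λ))
  rw [← hinj.tsum_eq]
  · refine tsum_congr fun A => ?_
    have h1 : ¬(A.map (Function.Embedding.subtype (· ∉ Λ)) ∩ Λ).Nonempty := by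
      rintro ⟨x, hx⟩
      obtain ⟨hx1, hx2⟩ := Finset.mem_inter.1 hx
      obtain ⟨y, -, rfl⟩ := Finset.mem_map.1 hx1
      exact y.2 hx2
    have h2 : (A.map (Function.Embedding.subtype (· ∉ Λ)) ∩ withOutside Λ Δ).Nonempty ↔
        (A ∩ Δ).Nonempty := by
      rw [withOutside, Finset.inter_union_distrib_left,
        Finset.not_nonempty_iff_eq_empty.1 h1, Finset.empty_union, ← Finset.map_inter,
        Finset.map_nonempty]
    simp only [h1, h2, not_false_eq_true, and_true]
    split_ifs
    · refine h.congr _ _ _ fun x hx => ?_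
      obtain ⟨y, -, rfl⟩ := Finset.mem_map.1 hx
      simp only [Function.Embedding.subtype_apply]
      rw [glue_of_notMem _ _ y.2]
      rfl
    · rfl
  · intro A hA
    have hA' : ¬(A ∩ Λ).Nonempty := by
      by_contra hne
      exact hA (if_neg fun h => h.2 hne)
    refine ⟨A.subtype (· ∉ Λ), ?_⟩
    rw [Finset.subtype_map_of_mem]
    exact fun x hx hxΛ => hA' ⟨x, Finset.mem_inter.2 ⟨hx, hxΛ⟩⟩

end Potentials

/-! ### The a priori laws and the specifications as resampling kernels -/

section Laws

variable {q : ℕ} [NeZero q]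

/-- The spins in a given arc, or all spins. -/
def arcSet (k : Option (Fin q)) : Set Spin := {θ | ∀ l ∈ k, arc q θ = l}

lemma arcSet_none : arcSet (none : Option (Fin q)) = Set.univ := by
  ext θ
  simp [arcSet]

lemma mem_arcSet_some {l : Fin q} {θ : Spin} : θ ∈ arcSet (some l) ↔ arc q θ = l := by
  simp [arcSet, eq_comm]

lemma measurableSet_arcSet (k : Option (Fin q)) : MeasurableSet (arcSet k) := by
  cases k with
  | none => simp [arcSet_none]
  | some l =>
    have : arcSet (some l) = arc q ⁻¹' {l} := by
      ext θ
      simp [mem_arcSet_some]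
    rw [this]
    exact measurable_arc q (measurableSet_singleton l)

lemma arc_coe {t : ℝ} {l : Fin q} (h1 : 2 * Real.pi * l / q ≤ t)
    (h2 : t < 2 * Real.pi * (l + 1) / q) : arc q (t : Spin) = l := by
  have hq : (0 : ℝ) < q := Nat.cast_pos.2 (Nat.pos_of_ne_zero (NeZero.ne q))
  have hp := Real.two_pi_pos
  have ht0 : 0 ≤ t := le_trans (by positivity) h1
  have hl : (l : ℝ) + 1 ≤ q := by exact_mod_cast l.2
  have ht : t ∈ Set.Ico 0 (0 + 2 * Real.pi) := by
    refine ⟨ht0, h2.trans_le ?_⟩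
    rw [zero_add, div_le_iff₀ hq]
    gcongr
  have he : (AddCircle.equivIco (2 * Real.pi) 0 (t : Spin) : ℝ) = t := by
    rw [AddCircle.equivIco_coe_eq ht]
  ext
  change ⌊(q : ℝ) * (AddCircle.equivIco (2 * Real.pi) 0 (t : Spin) : ℝ) / (2 * Real.pi)⌋₊ = l
  rw [he, Nat.floor_eq_iff (by positivity), le_div_iff₀ hp, div_lt_iff₀ hp]
  rw [div_le_iff₀ hq] at h1
  rw [lt_div_iff₀ hq] at h2
  constructor <;> linarith

/-- An arc contains the image of an open interval under the open quotient map, and nonempty open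
sets have positive measure. All conditionings on arcs rest on this. -/
lemma volume_arcSet_ne_zero (k : Option (Fin q)) : volume (arcSet k) ≠ 0 := by
  have hq : (0 : ℝ) < q := Nat.cast_pos.2 (Nat.pos_of_ne_zero (NeZero.ne q))
  have hp := Real.two_pi_pos
  cases k with
  | none =>
    rw [arcSet_none, AddCircle.measure_univ]
    simpa using hp
  | some l =>
    have hlt : 2 * Real.pi * l / q < 2 * Real.pi * ((l : ℝ) + 1) / q := by
      gcongr
      linarith
    let U : Set Spin := (fun t : ℝ => (t : Spin)) ''
      Set.Ioo (2 * Real.pi * l / q) (2 * Real.pi * ((l : ℝ) + 1) / q)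
    have hU : IsOpen U := QuotientAddGroup.isOpenMap_coe _ isOpen_Ioo
    have hne : U.Nonempty := (Set.nonempty_Ioo.2 hlt).image _
    have hsub : U ⊆ arcSet (some l) := by
      rintro _ ⟨t, ht, rfl⟩
      exact mem_arcSet_some.2 (arc_coe ht.1.le ht.2)
    exact fun h0 => (hU.measure_pos volume hne).ne' (measure_mono_null hsub h0)

/-- Normalised Lebesgue measure on an arc, or on the circle. -/
def spinLaw (k : Option (Fin q)) : Measure Spin := volume[|arcSet k]

instance (k : Option (Fin q)) : IsProbabilityMeasure (spinLaw k) :=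
  cond_isProbabilityMeasure (volume_arcSet_ne_zero k)

lemma ae_mem_arcSet (k : Option (Fin q)) : ∀ᵐ θ ∂spinLaw k, θ ∈ arcSet k :=
  ae_cond_mem (measurableSet_arcSet k)

lemma spinLaw_none_apply_ne_zero (k : Option (Fin q)) :
    spinLaw (none : Option (Fin q)) (arcSet k) ≠ 0 := by
  rw [spinLaw, arcSet_none, ProbabilityTheory.cond, Measure.restrict_univ]
  simpa [ENNReal.mul_eq_top] using volume_arcSet_ne_zero k

lemma spinLaw_none_cond (k : Option (Fin q)) :
    (spinLaw (none : Option (Fin q)))[|arcSet k] = spinLaw k := by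
  rw [spinLaw, arcSet_none, cond_cond_eq_cond_inter .univ (measurableSet_arcSet k),
    Set.univ_inter]
  rfl

variable {S : Type*} [DecidableEq S] {Φ : Finset S → (S → Spin) → ℝ}

variable (q) in
lemma lintegral_pi_spin (Λ : Finset S) {f : (S → Spin) → ℝ≥0∞} (hf : Measurable f)
    (η : S → Spin) :
    ∫⁻ σ : Λ → Spin, f (glue Λ σ (outside Λ η))
      = ENNReal.ofReal (2 * Real.pi) ^ Λ.card *
        ∫⁻ σ, f (Λ.piecewise σ η)
          ∂Measure.infinitePi fun _ : S => spinLaw (none : Option (Fin q)) := by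
  have h0 : ENNReal.ofReal (2 * Real.pi) ≠ 0 := by simpa using Real.two_pi_pos
  have h1 : (volume : Measure (Λ → Spin)) = ENNReal.ofReal (2 * Real.pi) ^ Λ.card •
      Measure.pi fun _ : Λ => spinLaw (none : Option (Fin q)) := by
    rw [volume_pi]
    refine Measure.pi_eq fun s _ => ?_
    rw [Measure.smul_apply, Measure.pi_pi, smul_eq_mul, ← Fintype.card_coe, ← Finset.card_univ,
      ← Finset.prod_const, ← Finset.prod_mul_distrib]
    refine Finset.prod_congr rfl fun x _ => ?_
    rw [spinLaw, arcSet_none, ProbabilityTheory.cond, Measure.restrict_univ, Measure.smul_apply, AddCircle.measure_univ, smul_eq_mul,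
      ← mul_assoc, ENNReal.mul_inv_cancel h0 ENNReal.ofReal_ne_top, one_mul]
  rw [h1, lintegral_smul_measure, smul_eq_mul, ← Measure.infinitePi_map_restrict
    (fun _ : S => spinLaw (none : Option (Fin q))), lintegral_map]
  · simp only [glue_restrict_outside]
  · exact hf.comp (measurable_glue_left Λ _)
  · exact Finset.measurable_restrict Λ

variable (q) in
-- Normalising Lebesgue measure at each site costs `(2π)^|Λ|` in the numerator and in the partition
-- function alike.
lemma gibbsSpec_eq_resample (hΦ : ∀ Λ, IsWeight (boltzmann Φ Λ)) (Λ : Finset S) (η : S → Spin) :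
    gibbsSpec Φ Λ η
      = resample (fun _ => spinLaw (none : Option (Fin q))) (boltzmann Φ Λ) Λ η := by
  have h0 : ENNReal.ofReal (2 * Real.pi) ^ Λ.card ≠ 0 :=
    pow_ne_zero _ (ENNReal.ofReal_pos.2 Real.two_pi_pos).ne'
  have ht : ENNReal.ofReal (2 * Real.pi) ^ Λ.card ≠ ∞ := ENNReal.pow_ne_top ENNReal.ofReal_ne_top
  have hm : Measurable fun σ : Λ → Spin => glue Λ σ (outside Λ η) :=
    measurable_glue_left Λ _
  have hw := (hΦ Λ).measurable
  have hweight : ∀ σ : Λ → Spin, weight Φ Λ σ (outside Λ η)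
      = boltzmann Φ Λ (glue Λ σ (outside Λ η)) := fun _ => rfl
  refine Measure.ext fun B hB => ?_
  have hB' : Measurable (B.indicator 1 : (S → Spin) → ℝ≥0∞) := measurable_one.indicator hB
  rw [resample_apply hw hB, gibbsSpec, ← lintegral_indicator_one hB, lintegral_smul_measure,
    lintegral_map hB' hm]
  simp only [hweight]
  rw [lintegral_withDensity_eq_lintegral_mul _ (hw.fun_comp hm) (hB'.fun_comp hm)]
  simp only [Pi.mul_apply]
  rw [lintegral_pi_spin q Λ hw, lintegral_pi_spin q Λ (f := fun ω => _ * _) (hw.mul hB'),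
    partitionFunction, smul_eq_mul, ENNReal.mul_inv (.inl h0) (.inl ht), mul_mul_mul_comm,
    ENNReal.inv_mul_cancel h0 ht, one_mul]

/-- Conditioning a reweighted product law on a product event gives the same reweighting of the
conditioned factors; the mass of the event and the unconstrained partition function cancel. -/
lemma constrainedSpec_eq_resample (hΦ : ∀ Λ, IsWeight (boltzmann Φ Λ)) (ω' : S → Fin q)
    (Λ : Finset S) (η : S → Spin) :
    constrainedSpec q Φ ω' Λ η
      = resample (fun x => spinLaw (some (ω' x))) (boltzmann Φ Λ) Λ η := by
  set u₀ : S → Measure Spin := fun _ => spinLaw (none : Option (Fin q))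
  set A : S → Set Spin := fun x => arcSet (some (ω' x))
  have hA : ∀ x, MeasurableSet (A x) := fun x => measurableSet_arcSet _
  have hA0 : ∀ x ∈ Λ, u₀ x (A x) ≠ 0 := fun x _ => spinLaw_none_apply_ne_zero _
  have hp := isProbabilityMeasure_condLaw hA0
  have hw := (hΦ Λ).measurable
  have hC : {ω | ∀ x ∈ Λ, discretise q ω x = ω' x} = {ω : S → Spin | ∀ x ∈ Λ, ω x ∈ A x} := by
    ext ω
    simp [A, mem_arcSet_some, discretise]
  have hCm := measurableSet_forall_mem hA Λ
  have hc0 : ∏ x ∈ Λ, u₀ x (A x) ≠ 0 := Finset.prod_ne_zero_iff.2 hA0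
  have hct : ∏ x ∈ Λ, u₀ x (A x) ≠ ∞ := ENNReal.prod_ne_top fun x _ => measure_ne_top _ _
  rw [← resample_congr (u := condLaw u₀ Λ A) hw fun x hx => by
    simp only [condLaw, hx, if_true, u₀, A, spinLaw_none_cond], constrainedSpec, hC,
    gibbsSpec_eq_resample q hΦ]
  have key : ∀ f : (S → Spin) → ℝ≥0∞, Measurable f →
      ∫⁻ ω in {ω : S → Spin | ∀ x ∈ Λ, ω x ∈ A x}, f ω ∂resample u₀ (boltzmann Φ Λ) Λ η
      = (partitionFunction u₀ (boltzmann Φ Λ) Λ η)⁻¹ * ((∏ x ∈ Λ, u₀ x (A x)) *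
        ∫⁻ σ, boltzmann Φ Λ (Λ.piecewise σ η) * f (Λ.piecewise σ η)
          ∂Measure.infinitePi (condLaw u₀ Λ A)) := by
    intro f hf
    rw [← lintegral_indicator hCm, lintegral_resample hw (hf.indicator hCm)]
    congr 1
    have h1 := lintegral_indicator_piecewise (Δ := Λ) hA hA0
      (f := fun ω => boltzmann Φ Λ ω * f ω) (hw.mul hf) η
    simp only [Finset.inter_self] at h1
    rw [← h1]
    refine lintegral_congr fun σ => ?_
    have h2 : (∀ x ∈ Λ, Λ.piecewise σ η x ∈ A x) ↔ ∀ x ∈ Λ, σ x ∈ A x :=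
      forall₂_congr fun x hx => by simp [hx]
    by_cases hσ : ∀ x ∈ Λ, σ x ∈ A x
    · rw [Set.indicator_of_mem (by exact h2.2 hσ), Set.indicator_of_mem (by exact hσ)]
    · rw [Set.indicator_of_notMem (by exact fun h => hσ (h2.1 h)),
        Set.indicator_of_notMem (by exact hσ), mul_zero]
  have hZ := (hΦ Λ).partitionFunction (u := u₀) Λ
  have hZ' := (hΦ Λ).partitionFunction (u := condLaw u₀ Λ A) Λ
  have h1 := key (fun _ => 1) measurable_const
  simp only [mul_one] at h1
  rw [setLIntegral_one] at h1
  change _ = _ * (_ * partitionFunction (condLaw u₀ Λ A) (boltzmann Φ Λ) Λ η) at h1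
  refine Measure.ext fun B hB => ?_
  rw [cond_apply hCm, h1, Set.inter_comm, ← Measure.restrict_apply hB,
    ← lintegral_indicator_one hB, key _ (measurable_one.indicator hB), resample_apply hw hB,
    ENNReal.mul_inv (.inl (ENNReal.inv_ne_zero.2 (hZ.ne_top η)))
      (.inl (ENNReal.inv_ne_top.2 (hZ.ne_zero η))),
    ENNReal.mul_inv (.inl hc0) (.inl hct), mul_mul_mul_comm,
    ENNReal.inv_mul_cancel (ENNReal.inv_ne_zero.2 (hZ.ne_top η))
      (ENNReal.inv_ne_top.2 (hZ.ne_zero η)), one_mul, mul_mul_mul_comm,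
    ENNReal.inv_mul_cancel hc0 hct, one_mul]

end Laws

/-! ### Existence and uniqueness of the constrained Gibbs measures -/

section Tilt

variable {X : Type*} [MeasurableSpace X] {v : X → ℝ≥0∞}

/-- The probability measure with density proportional to `v` with respect to `P`. -/
def tilt (v : X → ℝ≥0∞) (P : Measure X) : Measure X := (∫⁻ x, v x ∂P)⁻¹ • P.withDensity v

lemma isProbabilityMeasure_tilt (hv : IsWeight v) (P : Measure X) [IsProbabilityMeasure P] :
    IsProbabilityMeasure (tilt v P) := by
  constructor
  rw [tilt, Measure.smul_apply, withDensity_apply _ .univ, Measure.restrict_univ, smul_eq_mul]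
  exact ENNReal.inv_mul_cancel (hv.lintegral_ne_zero P) (hv.lintegral_ne_top P)

/-- The density can be inverted, which recovers each measure up to a constant, and comparing total
masses identifies the two constants. -/
lemma tilt_injective (hv : IsWeight v) {P Q : Measure X} [IsProbabilityMeasure P]
    [IsProbabilityMeasure Q] (h : tilt v P = tilt v Q) : P = Q := by
  have h1 : ∀ ρ : Measure X, (tilt v ρ).withDensity (fun x => (v x)⁻¹)
      = (∫⁻ x, v x ∂ρ)⁻¹ • ρ := by
    intro ρ
    have h2 := withDensity_inv_same (μ := ρ) hv.measurable (.of_forall fun x => hv.ne_zero x)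
      (.of_forall fun x => hv.ne_top x)
    rw [tilt, withDensity_smul_measure]
    exact congrArg _ h2
  have h2 := h1 P
  rw [h, h1 Q] at h2
  have h3 := congrArg (fun R : Measure X => R Set.univ) h2
  simp only [Measure.smul_apply, measure_univ, smul_eq_mul, mul_one] at h3
  rw [h3] at h2
  have h4 : (∫⁻ x, v x ∂P)⁻¹ ≠ 0 := ENNReal.inv_ne_zero.2 (hv.lintegral_ne_top P)
  have h5 : (∫⁻ x, v x ∂P)⁻¹ ≠ ∞ := ENNReal.inv_ne_top.2 (hv.lintegral_ne_zero P)
  refine Measure.ext fun B _ => ?_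
  have h6 := congrArg (fun R : Measure X => R B) h2
  simp only [Measure.smul_apply, smul_eq_mul] at h6
  exact ((ENNReal.mul_right_inj h4 h5).1 h6).symm

lemma IsReversible.tilt {S E : Type*} [DecidableEq S] [MeasurableSpace E] {u : S → Measure E}
    [∀ x, IsProbabilityMeasure (u x)] {w v : (S → E) → ℝ≥0∞} {Δ : Finset S}
    {P : Measure (S → E)} (h : IsReversible u w Δ P) (hw : Measurable w) (hv : Measurable v) :
    IsReversible u (fun ω => w ω * v ω) Δ (tilt v P) :=
  (h.withDensity hw hv).smul _

end Tilt

/-! ### Single-site conditional laws -/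

section SiteLaw

variable {S E : Type*} [DecidableEq S] [MeasurableSpace E]

/-- The law of the spin at `x` after resampling it from the a priori law `m`, given the other
spins of `η`. -/
def siteLaw (m : Measure E) (w : (S → E) → ℝ≥0∞) (x : S) (η : S → E) : Measure E :=
  (∫⁻ s, w (Function.update η x s) ∂m)⁻¹ • m.withDensity fun s => w (Function.update η x s)

variable {u : S → Measure E} [∀ x, IsProbabilityMeasure (u x)] {w : (S → E) → ℝ≥0∞}

lemma measurable_update_right (η : S → E) (x : S) :
    Measurable fun s : E => Function.update η x s := measurable_update η

lemma isProbabilityMeasure_siteLaw (m : Measure E) [IsProbabilityMeasure m] (hw : IsWeight w)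
    (x : S) (η : S → E) : IsProbabilityMeasure (siteLaw m w x η) :=
  isProbabilityMeasure_tilt (hw.comp (measurable_update_right η x)) m

lemma lintegral_piecewise_singleton {f : (S → E) → ℝ≥0∞} (hf : Measurable f) (x : S)
    (η : S → E) :
    ∫⁻ σ, f (({x} : Finset S).piecewise σ η) ∂Measure.infinitePi u
      = ∫⁻ s, f (Function.update η x s) ∂u x := by
  simp only [Finset.piecewise_singleton]
  exact (measurePreserving_eval_infinitePi u x).lintegral_comp
    (f := fun s => f (Function.update η x s)) (hf.comp (measurable_update_right η x))

lemma resample_singleton (hw : Measurable w) (x : S) (η : S → E) :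
    resample u w {x} η = (siteLaw (u x) w x η).map fun s => Function.update η x s := by
  have hm := measurable_update_right η x
  refine Measure.ext fun B hB => ?_
  have hB' : Measurable (B.indicator 1 : (S → E) → ℝ≥0∞) := measurable_one.indicator hB
  rw [resample_apply hw hB, partitionFunction, lintegral_piecewise_singleton hw,
    lintegral_piecewise_singleton (f := fun ω => w ω * B.indicator 1 ω) (hw.mul hB'),
    ← lintegral_indicator_one hB, lintegral_map hB' hm, siteLaw, lintegral_smul_measure,
    lintegral_withDensity_eq_lintegral_mul _ (hw.fun_comp hm) (hB'.fun_comp hm)]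
  rfl

lemma resample_singleton_map_eval (hw : Measurable w) (x : S) (η : S → E) :
    (resample u w {x} η).map (fun ω => ω x) = siteLaw (u x) w x η := by
  rw [resample_singleton hw, Measure.map_map (measurable_pi_apply x) (measurable_update_right η x)]
  have : (fun ω : S → E => ω x) ∘ (fun s => Function.update η x s) = id := by
    ext s
    simp
  rw [this, Measure.map_id]

end SiteLaw

/-! ### Constrained Gibbs measures: compactness, freezing and Dobrushin uniqueness -/

section Constrained

variable {S : Type*} [DecidableEq S] [Countable S] {q : ℕ} [NeZero q]
  {Φ : Finset S → (S → Spin) → ℝ}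

/-- `P` satisfies the DLR equations of the potential `Φ` with spins constrained to the arcs `κ`
(a site `x` with `κ x = none` is not constrained). -/
def IsConstrainedGibbs (Φ : Finset S → (S → Spin) → ℝ) (κ : S → Option (Fin q))
    (P : Measure (S → Spin)) : Prop :=
  ∀ Δ, IsInvariant (fun x => spinLaw (κ x)) (boltzmann Φ Δ) Δ P

lemma isGibbs_constrainedSpec_iff (hΦ : IsRegular Φ) (ω' : S → Fin q) (P : Measure (S → Spin)) :
    IsGibbs (constrainedSpec q Φ ω') P ↔
      IsProbabilityMeasure P ∧ IsConstrainedGibbs Φ (fun x => some (ω' x)) P := by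
  have hw := hΦ.isWeightFamily.isWeight
  have h : ∀ Δ, IsInvariant (fun x => spinLaw (some (ω' x))) (boltzmann Φ Δ) Δ P ↔
      ∀ B, MeasurableSet B → ∫⁻ ω, constrainedSpec q Φ ω' Δ ω B ∂P = P B := by
    intro Δ
    simp only [isInvariant_iff_measure (hw Δ).measurable, constrainedSpec_eq_resample hw]
  exact ⟨fun hP => ⟨hP.prob, fun Δ => (h Δ).2 (hP.dlr Δ)⟩,
    fun hP => ⟨hP.1, fun Δ => (h Δ).1 (hP.2 Δ)⟩⟩

lemma IsGibbs.isConstrainedGibbs (hΦ : IsRegular Φ) {P : Measure (S → Spin)}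
    (h : IsGibbs (gibbsSpec Φ) P) : IsConstrainedGibbs Φ (fun _ => (none : Option (Fin q))) P := by
  have hw := hΦ.isWeightFamily.isWeight
  intro Δ
  rw [isInvariant_iff_measure (hw Δ).measurable]
  simpa only [gibbsSpec_eq_resample q hw] using h.dlr Δ

/-- Resampling at `x` puts the spin there in the arc with probability one, whatever the
configuration was, and the measure is unchanged by it. -/
lemma ae_mem_arcSet_of_isInvariant {u : S → Measure Spin} [∀ x, IsProbabilityMeasure (u x)]
    {w : (S → Spin) → ℝ≥0∞} (hw : IsWeight w) {x : S} {k : Option (Fin q)} (hu : u x = spinLaw k)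
    {P : Measure (S → Spin)} (h : IsInvariant u w {x} P) : ∀ᵐ ω ∂P, ω x ∈ arcSet k := by
  have hm : MeasurableSet {ω : S → Spin | ω x ∈ (arcSet k)ᶜ} :=
    (measurable_pi_apply x) (measurableSet_arcSet k).compl
  rw [isInvariant_iff_measure hw.measurable] at h
  have h1 := h _ hm
  rw [ae_iff]
  refine Eq.trans h1.symm ?_
  rw [← lintegral_zero (μ := P)]
  refine lintegral_congr fun η => ?_
  rw [resample_singleton hw.measurable, Measure.map_apply (measurable_update_right η x) hm]
  have h2 : (fun s => Function.update η x s) ⁻¹' {ω : S → Spin | ω x ∈ (arcSet k)ᶜ}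
      = (arcSet k)ᶜ := by
    ext s
    simp
  rw [h2, siteLaw, Measure.smul_apply, hu]
  have h3 : (spinLaw k) (arcSet k)ᶜ = 0 := ae_mem_arcSet k
  rw [withDensity_absolutelyContinuous _ _ h3, smul_zero]

lemma IsConstrainedGibbs.ae_mem (hΦ : IsRegular Φ) {κ : S → Option (Fin q)}
    {P : Measure (S → Spin)} (h : IsConstrainedGibbs Φ κ P) :
    ∀ᵐ ω ∂P, ∀ x, ω x ∈ arcSet (κ x) :=
  ae_all_iff.2 fun x =>
    ae_mem_arcSet_of_isInvariant (hΦ.isWeightFamily.isWeight {x}) rfl (h {x})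

lemma exists_isConstrainedGibbs (hΦ : IsRegular Φ) (κ : S → Option (Fin q)) :
    ∃ P : ProbabilityMeasure (S → Spin), IsConstrainedGibbs Φ κ (P : Measure (S → Spin)) :=
  hΦ.isWeightFamily.exists_isInvariant _

omit [Countable S] in
lemma glue_piecewise {E : Type*} {Λ : Finset S} (a : Λ → E) (Δ : Finset {x // x ∉ Λ})
    (σ η : {x // x ∉ Λ} → E) : glue Λ a (Δ.piecewise σ η)
      = (Δ.map (Function.Embedding.subtype _)).piecewise (glue Λ a σ) (glue Λ a η) := by
  ext x
  by_cases hx : x ∈ Λ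
  · by_cases h : x ∈ Δ.map (Function.Embedding.subtype (· ∉ Λ)) <;> simp [h, glue, hx]
  · by_cases h : (⟨x, hx⟩ : {x // x ∉ Λ}) ∈ Δ
    · have : x ∈ Δ.map (Function.Embedding.subtype (· ∉ Λ)) :=
        Finset.mem_map.2 ⟨_, h, rfl⟩
      simp [glue, hx, h]
    · simp [glue, hx, h]

omit [Countable S] in
lemma glue_update {E : Type*} {Λ : Finset S} (a : Λ → E) (τ : {x // x ∉ Λ} → E)
    (x : {x // x ∉ Λ}) (s : E) :
    glue Λ a (Function.update τ x s) = Function.update (glue Λ a τ) x s := by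
  have h := glue_piecewise a {x} (fun _ => s) τ
  rw [Finset.piecewise_singleton, Finset.map_singleton, Finset.piecewise_singleton] at h
  rw [h]
  simp [glue, x.2]

omit [Countable S] in
lemma boltzmann_withOutside (hΦ : IsRegular Φ) (Λ : Finset S) (Δ : Finset {x // x ∉ Λ})
    (ω : S → Spin) : boltzmann Φ (withOutside Λ Δ) ω
      = boltzmann Φ Λ ω * boltzmann (restrictPotential Φ Λ) Δ (outside Λ ω) := by
  rw [boltzmann, hΦ.hamiltonian_withOutside, neg_add, ofReal_exp_add]
  rfl

/-- Reweighting turns a Gibbs measure without the interactions with `Λ` into a Gibbs measure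
with the spins in `Λ` frozen. -/
lemma isInvariant_tilt_frozen (hΦ : IsRegular Φ) {Λ : Finset S} (a : Λ → Spin)
    {u : {x // x ∉ Λ} → Measure Spin} [∀ x, IsProbabilityMeasure (u x)]
    {Δ : Finset {x // x ∉ Λ}} {ν : Measure ({x // x ∉ Λ} → Spin)}
    (h : IsInvariant u (boltzmann (restrictPotential Φ Λ) Δ) Δ ν) :
    IsInvariant u (fun τ => boltzmann Φ (Δ.map (Function.Embedding.subtype _)) (glue Λ a τ)) Δ
      (tilt (fun τ => boltzmann Φ Λ (glue Λ a τ)) ν) := by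
  have hw := hΦ.isWeightFamily.isWeight
  have hw' := (hΦ.restrictPotential Λ).isWeightFamily.isWeight
  have hg := measurable_glue_right Λ a
  -- The weight of `Λ ∪ Δ` is factored in two ways: as the weight of `Λ` times the restricted weight
  -- of `Δ`, and as the full weight of `Δ` times a factor `c` not feeling `Δ`. The density supplies
  -- the weight of `Λ`, and `c` is then discarded.
  obtain ⟨c, hc, hc', hcw⟩ := hΦ.isWeightFamily.consistent
    (Δ.map (Function.Embedding.subtype _)) (withOutside Λ Δ) Finset.subset_union_right
  have h1 := (h.isReversible (hw' Δ).measurable).tilt (hw' Δ).measurable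
    ((hw Λ).comp hg).measurable
  have h2 : (fun τ => boltzmann (restrictPotential Φ Λ) Δ τ * boltzmann Φ Λ (glue Λ a τ))
      = fun τ => boltzmann Φ (Δ.map (Function.Embedding.subtype _)) (glue Λ a τ)
        * c (glue Λ a τ) := by
    ext τ
    rw [← hcw, boltzmann_withOutside hΦ, outside_glue, mul_comm]
  rw [h2] at h1
  refine (h1.of_mul_outside (c := fun τ => c (glue Λ a τ)) (hc.comp hg) fun σ η => ?_).isInvariant
    ((hw _).comp hg)
  rw [glue_piecewise, hc']

theorem isConstrainedGibbs_restrictPotential_unique (hΦ : IsRegular Φ)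
    (hD : uniformDobrushinConst q Φ < 1) (Λ : Finset S) (ω' : {x // x ∉ Λ} → Fin q)
    {ν₁ ν₂ : Measure ({x // x ∉ Λ} → Spin)} [IsProbabilityMeasure ν₁] [IsProbabilityMeasure ν₂]
    (h₁ : IsConstrainedGibbs (restrictPotential Φ Λ) (fun x => some (ω' x)) ν₁)
    (h₂ : IsConstrainedGibbs (restrictPotential Φ Λ) (fun x => some (ω' x)) ν₂) : ν₁ = ν₂ := by
  -- Any fixed spins would do; the reference arcs on `Λ` are chosen below to match them.
  let a : Λ → Spin := fun _ => 0
  have hw := hΦ.isWeightFamily.isWeight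
  have hg := measurable_glue_right Λ a
  have hv : IsWeight fun τ => boltzmann Φ Λ (glue Λ a τ) := (hw Λ).comp hg
  refine tilt_injective hv ?_
  let u : {x // x ∉ Λ} → Measure Spin := fun x => spinLaw (some (ω' x))
  let w : {x // x ∉ Λ} → ({x // x ∉ Λ} → Spin) → ℝ≥0∞ := fun x τ =>
    boltzmann Φ {x.1} (glue Λ a τ)
  have hwx : ∀ x, IsWeight (w x) := fun x => (hw _).comp hg
  have hwc : ∀ x, Continuous (w x) := fun x =>
    (hΦ.isWeightFamily.continuous _).comp (continuous_glue_right Λ a)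
  have hp : ∀ x η, IsProbabilityMeasure (siteLaw (u x) (w x) x η) := fun x η =>
    isProbabilityMeasure_siteLaw (u x) (hwx x) x η
  have hint : ∀ x (f : ({x // x ∉ Λ} → Spin) → ℝ), Continuous f → ∀ η,
      ∫ s, f (Function.update η x s) ∂siteLaw (u x) (w x) x η
        = ∫ ω, f ω ∂resample u (w x) {x} η := by
    intro x f hf η
    rw [resample_singleton (hwx x).measurable, integral_map
      (measurable_update_right η x).aemeasurable hf.measurable.aestronglyMeasurable]
  have key : ∀ ν : Measure ({x // x ∉ Λ} → Spin), IsProbabilityMeasure ν →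
      IsConstrainedGibbs (restrictPotential Φ Λ) (fun x => some (ω' x)) ν →
      ∀ x, IsInvariant u (w x) {x} (tilt (fun τ => boltzmann Φ Λ (glue Λ a τ)) ν) := by
    intro ν _ hν x
    have := isInvariant_tilt_frozen hΦ a (hν {x})
    rwa [Finset.map_singleton] at this
  have hprob := fun (ν : Measure ({x // x ∉ Λ} → Spin)) [IsProbabilityMeasure ν] =>
    isProbabilityMeasure_tilt hv ν
  have := hprob ν₁
  have := hprob ν₂
  refine dobrushin_uniqueness (A := fun x => arcSet (some (ω' x)))
    (p := fun x η => siteLaw (u x) (w x) x η)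
    (C := fun x y => uniformDobrushinCoeff q Φ x y) (fun x η => ?_) (fun x f hf => ?_)
    (fun x y ξ η hξ hη h => ?_) (fun x => ?_) hD ?_ ?_ (fun x f hf => ?_) (fun x f hf => ?_)
  · refine Measure.ae_smul_measure ?_ _
    exact (withDensity_absolutelyContinuous _ _).ae_le (ae_mem_arcSet _)
  · simp_rw [hint x f hf]
    exact continuous_integral_resample (hwx x) (hwc x) hf
  -- With the frozen spins filled in, both boundary conditions have the same discretisation `ω''` on
  -- all of `S`, so they compete in the supremum defining the coefficient of the full potential.
  · let ω'' : S → Fin q := glue Λ (fun _ => arc q 0) ω'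
    have h1 : ∀ ζ : {x // x ∉ Λ} → Spin, siteLaw (u x) (w x) x ζ
        = (constrainedSpec q Φ ω'' {x.1} (glue Λ a ζ)).map (fun ω => ω x.1) := by
      intro ζ
      rw [constrainedSpec_eq_resample hw, resample_singleton_map_eval (hw _).measurable]
      simp only [siteLaw, w, u, glue_update, ω'', glue_of_notMem _ _ x.2]
    have h2 : ∀ ζ : {x // x ∉ Λ} → Spin, (∀ z, ζ z ∈ arcSet (some (ω' z))) →
        discretise q (glue Λ a ζ) = ω'' := by
      intro ζ hζ
      ext1 z
      by_cases hz : z ∈ Λ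
      · simp [discretise, ω'', glue, hz, a]
      · simpa [discretise, ω'', glue, hz] using mem_arcSet_some.1 (hζ ⟨z, hz⟩)
    rw [h1, h1]
    unfold uniformDobrushinCoeff
    refine le_iSup_of_le ω'' <| le_iSup_of_le (glue Λ a ξ) <| le_iSup_of_le (glue Λ a η) <|
      le_iSup_of_le (fun z hz => ?_) <| le_iSup_of_le (h2 ξ hξ) <|
      le_iSup_of_le (h2 η hη) le_rfl
    by_cases hzΛ : z ∈ Λ
    · simp [glue, hzΛ]
    · simpa [glue, hzΛ] using h ⟨z, hzΛ⟩ fun hzy => hz (congrArg Subtype.val hzy)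
  · refine (ENNReal.tsum_comp_le_tsum_of_injective Subtype.val_injective
      fun y => uniformDobrushinCoeff q Φ x y).trans ?_
    exact le_iSup (fun x => ∑' y, uniformDobrushinCoeff q Φ x y) x.1
  · exact ae_all_iff.2 fun x => ae_mem_arcSet_of_isInvariant (hwx x) rfl (key ν₁ inferInstance h₁ x)
  · exact ae_all_iff.2 fun x => ae_mem_arcSet_of_isInvariant (hwx x) rfl (key ν₂ inferInstance h₂ x)
  · simp_rw [hint x f hf]
    exact (key ν₁ inferInstance h₁ x).integral (hwx x) hf
  · simp_rw [hint x f hf]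
    exact (key ν₂ inferInstance h₂ x).integral (hwx x) hf

theorem existsUnique_isGibbs_restrictPotential (hΦ : IsRegular Φ)
    (hD : uniformDobrushinConst q Φ < 1) (Λ : Finset S) (ω' : {x // x ∉ Λ} → Fin q) :
    ∃! ν, IsGibbs (constrainedSpec q (restrictPotential Φ Λ) ω') ν := by
  have hR := hΦ.restrictPotential Λ
  simp only [isGibbs_constrainedSpec_iff hR]
  obtain ⟨P, hP⟩ := exists_isConstrainedGibbs hR fun x => some (ω' x)
  refine ⟨P, ⟨inferInstance, hP⟩, fun ν hν => ?_⟩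
  have := hν.1
  exact isConstrainedGibbs_restrictPotential_unique hΦ hD Λ ω' hν.2 hP

end Constrained

/-! ### Removing the spins in a finite set -/

section Removal

open Filter Topology

variable {S : Type*} [DecidableEq S] [Countable S] {q : ℕ} [NeZero q]
  {Φ : Finset S → (S → Spin) → ℝ}

/-- The constraints that leave the spins in `Λ` free and put those off `Λ` in the arcs `ω'`. -/
def freeIn (Λ : Finset S) (ω' : {x // x ∉ Λ} → Fin q) : S → Option (Fin q) :=
  glue Λ (fun _ => none) fun x => some (ω' x)

lemma freeIn_of_mem {Λ : Finset S} (ω' : {x // x ∉ Λ} → Fin q) {x : S} (hx : x ∈ Λ) :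
    freeIn Λ ω' x = none := glue_of_mem _ _ hx

lemma freeIn_of_notMem {Λ : Finset S} (ω' : {x // x ∉ Λ} → Fin q) {x : S} (hx : x ∉ Λ) :
    freeIn Λ ω' x = some (ω' ⟨x, hx⟩) := glue_of_notMem _ _ hx

lemma infinitePi_map_outside {E : Type*} [MeasurableSpace E] (u : S → Measure E)
    [∀ x, IsProbabilityMeasure (u x)] (Λ : Finset S) :
    (Measure.infinitePi u).map (outside Λ)
      = Measure.infinitePi fun x : {x // x ∉ Λ} => u x := by
  refine Measure.eq_infinitePi _ fun s t ht => ?_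
  let t' : S → Set E := fun x => if h : x ∉ Λ then t ⟨x, h⟩ else Set.univ
  have ht' : ∀ x, MeasurableSet (t' x) := fun x => by
    by_cases hx : x ∈ Λ <;> simp [t', hx, ht]
  have h : outside Λ ⁻¹' (Set.pi s t)
      = Set.pi (s.map (Function.Embedding.subtype (· ∉ Λ)) : Finset S) t' := by
    ext ω
    simp only [Set.mem_preimage, Set.mem_pi, Finset.mem_coe, Finset.mem_map, outside]
    constructor
    · rintro h _ ⟨y, hy, rfl⟩
      simpa [t', y.2] using h y hy
    · intro h y hy
      simpa [t', y.2] using h y ⟨y, hy, rfl⟩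
  rw [Measure.map_apply (measurable_outside Λ) (.pi s.countable_toSet fun x _ => ht x), h,
    Measure.infinitePi_pi _ fun x _ => ht' x, Finset.prod_map]
  refine Finset.prod_congr rfl fun x _ => ?_
  simp [t', x.2]

omit [Countable S] in
lemma withOutside_piecewise {E : Type*} (Λ : Finset S) (Δ : Finset {x // x ∉ Λ})
    (σ τ η : S → E) : (withOutside Λ Δ).piecewise (Λ.piecewise σ τ) η
      = Λ.piecewise σ ((withOutside Λ Δ).piecewise τ η) := by
  ext x
  by_cases hx : x ∈ Λ
  · have : x ∈ withOutside Λ Δ := Finset.mem_union_left _ hx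
    simp [hx, this]
  · by_cases hx' : x ∈ withOutside Λ Δ <;> simp [hx, hx']

omit [Countable S] in
lemma outside_withOutside_piecewise {E : Type*} (Λ : Finset S) (Δ : Finset {x // x ∉ Λ})
    (τ η : S → E) : outside Λ ((withOutside Λ Δ).piecewise τ η)
      = Δ.piecewise (outside Λ τ) (outside Λ η) := by
  ext x
  have : x.1 ∈ withOutside Λ Δ ↔ x ∈ Δ := by
    simp [withOutside, x.2]
  by_cases hx : x ∈ Δ
  · simp [outside, hx, this.2 hx]
  · rw [outside, Finset.piecewise_eq_of_notMem _ _ _ (mt this.1 hx),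
      Finset.piecewise_eq_of_notMem _ _ _ hx]
    rfl

/-- The spins in `Λ` are integrated first. The weight of `Λ ∪ Δ` splits into the weight of `Λ` and
the restricted weight of `Δ`; the former integrates to `Z_Λ`, and the remaining factors do not
depend on the spins in `Λ`. -/
lemma lintegral_withOutside (hΦ : IsRegular Φ) (u : S → Measure Spin)
    [∀ x, IsProbabilityMeasure (u x)] (Λ : Finset S) (Δ : Finset {x // x ∉ Λ})
    {g : ({x // x ∉ Λ} → Spin) → ℝ≥0∞} (hg : Measurable g) (η : S → Spin) :
    ∫⁻ σ, boltzmann Φ (withOutside Λ Δ) ((withOutside Λ Δ).piecewise σ η) *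
        (partitionFunction u (boltzmann Φ Λ) Λ ((withOutside Λ Δ).piecewise σ η))⁻¹ *
        g (outside Λ ((withOutside Λ Δ).piecewise σ η)) ∂Measure.infinitePi u
      = ∫⁻ τ, boltzmann (restrictPotential Φ Λ) Δ (Δ.piecewise τ (outside Λ η)) *
          g (Δ.piecewise τ (outside Λ η)) ∂Measure.infinitePi fun x : {x // x ∉ Λ} => u x := by
  have hw := hΦ.isWeightFamily.isWeight
  have hw' := (hΦ.restrictPotential Λ).isWeightFamily.isWeight
  have hZ := (hw Λ).partitionFunction (u := u) Λ
  have hm := measurable_piecewise_left (withOutside Λ Δ) η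
  have hf : Measurable fun σ => boltzmann Φ (withOutside Λ Δ) ((withOutside Λ Δ).piecewise σ η) *
        (partitionFunction u (boltzmann Φ Λ) Λ ((withOutside Λ Δ).piecewise σ η))⁻¹ *
        g (outside Λ ((withOutside Λ Δ).piecewise σ η)) :=
    (((hw _).measurable.comp hm).mul (hZ.measurable.comp hm).inv).mul
      (hg.comp ((measurable_outside Λ).comp hm))
  rw [← lintegral_lintegral_piecewise u Λ hf, ← infinitePi_map_outside u Λ,
    lintegral_map (f := fun τ => boltzmann (restrictPotential Φ Λ) Δ
      (Δ.piecewise τ (outside Λ η)) * g (Δ.piecewise τ (outside Λ η)))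
      (((hw' Δ).measurable.mul hg).comp (measurable_piecewise_left Δ _)) (measurable_outside Λ)]
  refine lintegral_congr fun τ => ?_
  simp only [withOutside_piecewise, partitionFunction_piecewise, boltzmann_withOutside hΦ,
    outside_piecewise, outside_withOutside_piecewise, mul_assoc]
  rw [lintegral_mul_const _ ((hw Λ).measurable.fun_comp (measurable_piecewise_left Λ _))]
  change partitionFunction u (boltzmann Φ Λ) Λ _ * _ = _
  rw [mul_left_comm, ← mul_assoc (partitionFunction u (boltzmann Φ Λ) Λ _),
    ENNReal.mul_inv_cancel (hZ.ne_zero _) (hZ.ne_top _), one_mul]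

/-- Removing the interactions with `Λ` from a Gibbs measure by reweighting. -/
lemma isInvariant_map_outside (hΦ : IsRegular Φ) {u : S → Measure Spin}
    [∀ x, IsProbabilityMeasure (u x)] {Λ : Finset S} {Δ : Finset {x // x ∉ Λ}}
    {P : Measure (S → Spin)}
    (h : IsInvariant u (boltzmann Φ (withOutside Λ Δ)) (withOutside Λ Δ) P) :
    IsInvariant (fun x : {x // x ∉ Λ} => u x) (boltzmann (restrictPotential Φ Λ) Δ) Δ
      ((tilt (fun ω => (partitionFunction u (boltzmann Φ Λ) Λ ω)⁻¹) P).map (outside Λ)) := by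
  have hw := hΦ.isWeightFamily.isWeight
  have hw' := (hΦ.restrictPotential Λ).isWeightFamily.isWeight
  have hZ := ((hw Λ).partitionFunction (u := u) Λ).inv
  have hW := (hw (withOutside Λ Δ)).mul hZ
  -- The reweighted measure is Gibbs in `Λ ∪ Δ` for the weight divided by `Z_Λ`. For functions of
  -- the outside spins, `lintegral_withOutside` turns both the integral and the partition function
  -- of this weight into those of the restricted potential.
  have h1 := ((h.isReversible (hw _).measurable).tilt (hw _).measurable hZ.measurable).isInvariant
    hW
  rw [isInvariant_iff_measure (hw' Δ).measurable]
  intro B hB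
  have hB' : Measurable (B.indicator 1 : ({x // x ∉ Λ} → Spin) → ℝ≥0∞) :=
    measurable_one.indicator hB
  have hmo := measurable_outside (E := Spin) Λ
  have h2 := h1.lintegral hW.measurable (f := fun ω => B.indicator 1 (outside Λ ω))
    (hB'.comp hmo)
  have h3 : ∀ η, partitionFunction u (fun ω => boltzmann Φ (withOutside Λ Δ) ω *
      (partitionFunction u (boltzmann Φ Λ) Λ ω)⁻¹) (withOutside Λ Δ) η
      = partitionFunction (fun x : {x // x ∉ Λ} => u x) (boltzmann (restrictPotential Φ Λ) Δ) Δ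
        (outside Λ η) := by
    intro η
    have := lintegral_withOutside hΦ u Λ Δ (g := fun _ => 1) measurable_const η
    simp only [mul_one] at this
    exact this
  simp only [h3, lintegral_withOutside hΦ u Λ Δ hB'] at h2
  rw [lintegral_map ((Measure.measurable_coe hB).fun_comp (measurable_resample (hw' Δ).measurable))
    hmo, ← lintegral_indicator_one hB, lintegral_map hB' hmo, ← h2]
  simp only [resample_apply (hw' Δ).measurable hB]

lemma constrainedGibbs_spec (hΦ : IsRegular Φ) (hD : uniformDobrushinConst q Φ < 1)
    (Λ : Finset S) (ω' : {x // x ∉ Λ} → Fin q) :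
    IsGibbs (constrainedSpec q (restrictPotential Φ Λ) ω') (constrainedGibbs q Φ Λ ω') :=
  Classical.epsilon_spec (existsUnique_isGibbs_restrictPotential hΦ hD Λ ω').exists

lemma eq_constrainedGibbs (hΦ : IsRegular Φ) (hD : uniformDobrushinConst q Φ < 1)
    {Λ : Finset S} {ω' : {x // x ∉ Λ} → Fin q} {ν : Measure ({x // x ∉ Λ} → Spin)}
    [hν : IsProbabilityMeasure ν]
    (h : IsConstrainedGibbs (restrictPotential Φ Λ) (fun x => some (ω' x)) ν) :
    ν = constrainedGibbs q Φ Λ ω' :=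
  (existsUnique_isGibbs_restrictPotential hΦ hD Λ ω').unique
    ((isGibbs_constrainedSpec_iff (hΦ.restrictPotential Λ) ω' ν).2 ⟨hν, h⟩)
    (constrainedGibbs_spec hΦ hD Λ ω')

/-- The image satisfies the DLR equations without the interactions with `Λ`, off which the a priori
laws are those of the arcs `ω'`; uniqueness identifies it. -/
lemma map_tilt_eq_constrainedGibbs (hΦ : IsRegular Φ) (hD : uniformDobrushinConst q Φ < 1)
    {Λ : Finset S} {ω' : {x // x ∉ Λ} → Fin q} {P : Measure (S → Spin)} [IsProbabilityMeasure P]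
    (h : IsConstrainedGibbs Φ (freeIn Λ ω') P) :
    (tilt (fun ω => (partitionFunction (fun x => spinLaw (freeIn Λ ω' x)) (boltzmann Φ Λ) Λ ω)⁻¹)
      P).map (outside Λ) = constrainedGibbs q Φ Λ ω' := by
  have hw := hΦ.isWeightFamily.isWeight
  have hZ := ((hw Λ).partitionFunction (u := fun x => spinLaw (freeIn Λ ω' x)) Λ).inv
  have := isProbabilityMeasure_tilt hZ P
  have := Measure.isProbabilityMeasure_map (μ := tilt (fun ω => (partitionFunction
    (fun x => spinLaw (freeIn Λ ω' x)) (boltzmann Φ Λ) Λ ω)⁻¹) P)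
    (measurable_outside (E := Spin) Λ).aemeasurable
  refine eq_constrainedGibbs hΦ hD fun Δ => ?_
  refine IsInvariant.congr ((hΦ.restrictPotential Λ).isWeightFamily.isWeight Δ).measurable
    (fun x _ => ?_) (isInvariant_map_outside hΦ (h (withOutside Λ Δ)))
  rw [freeIn_of_notMem _ x.2]

/-- A Gibbs measure that is free in `Λ`, in terms of the constrained Gibbs measure off `Λ`. -/
lemma exists_lintegral_eq_constrainedGibbs (hΦ : IsRegular Φ)
    (hD : uniformDobrushinConst q Φ < 1) {Λ : Finset S} {ω' : {x // x ∉ Λ} → Fin q}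
    {P : Measure (S → Spin)} [IsProbabilityMeasure P]
    (h : IsConstrainedGibbs Φ (freeIn Λ ω') P) :
    ∃ c : ℝ≥0∞, c ≠ 0 ∧ c ≠ ∞ ∧ ∀ f : (S → Spin) → ℝ≥0∞, Measurable f →
      ∫⁻ ω, f ω ∂P = c * ∫⁻ τ, (∫⁻ σ : Λ → Spin, weight Φ Λ σ τ * f (glue Λ σ τ))
        ∂constrainedGibbs q Φ Λ ω' := by
  have hw := hΦ.isWeightFamily.isWeight
  set u : S → Measure Spin := fun x => spinLaw (freeIn Λ ω' x) with hu
  have hZ := ((hw Λ).partitionFunction (u := u) Λ).inv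
  set b := ENNReal.ofReal (2 * Real.pi) ^ Λ.card with hb
  have hb0 : b ≠ 0 := pow_ne_zero _ (ENNReal.ofReal_pos.2 Real.two_pi_pos).ne'
  have hbt : b ≠ ∞ := ENNReal.pow_ne_top ENNReal.ofReal_ne_top
  set k := ∫⁻ ω, (partitionFunction u (boltzmann Φ Λ) Λ ω)⁻¹ ∂P with hk
  have hk0 : k ≠ 0 := hZ.lintegral_ne_zero P
  have hkt : k ≠ ∞ := hZ.lintegral_ne_top P
  -- `k` undoes the normalisation of the tilt, and `b` is the mass of Lebesgue measure on the spins
  -- in `Λ`.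
  refine ⟨k * b⁻¹, mul_ne_zero hk0 (ENNReal.inv_ne_zero.2 hbt),
    ENNReal.mul_ne_top hkt (ENNReal.inv_ne_top.2 hb0), fun f hf => ?_⟩
  have hwf : Measurable fun ω => boltzmann Φ Λ ω * f ω := (hw Λ).measurable.mul hf
  have h1 : ∀ η, ∫⁻ σ : Λ → Spin, weight Φ Λ σ (outside Λ η) * f (glue Λ σ (outside Λ η))
      = b * ∫⁻ σ, boltzmann Φ Λ (Λ.piecewise σ η) * f (Λ.piecewise σ η)
        ∂Measure.infinitePi u := by
    intro η
    have h2 := lintegral_pi_spin q Λ hwf η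
    rw [lintegral_piecewise_congr (u' := u) (fun x hx => by
      simp only [hu, freeIn_of_mem _ hx]) hwf] at h2
    exact h2
  have hN : Measurable fun τ : {x // x ∉ Λ} → Spin =>
      ∫⁻ σ : Λ → Spin, weight Φ Λ σ τ * f (glue Λ σ τ) := by
    have h3 : Measurable fun p : ({x // x ∉ Λ} → Spin) × (Λ → Spin) =>
        boltzmann Φ Λ (glue Λ p.2 p.1) * f (glue Λ p.2 p.1) :=
      hwf.comp ((measurable_glue Λ).comp measurable_swap)
    exact h3.lintegral_prod_right'
  -- The DLR equation in `Λ` writes the expectation of `f` as that of `Z_Λ⁻¹` times an unnormalised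
  -- integral over the spins in `Λ`; the factor `Z_Λ⁻¹` is exactly the density of the tilt.
  rw [← map_tilt_eq_constrainedGibbs hΦ hD h, lintegral_map hN (measurable_outside Λ), tilt,
    lintegral_smul_measure, lintegral_withDensity_eq_lintegral_mul _ hZ.measurable
    (hN.fun_comp (measurable_outside Λ)), ← (h Λ).lintegral (hw Λ).measurable hf]
  have h4 : ∀ x : ℝ≥0∞, x = k * b⁻¹ * (k⁻¹ * (b * x)) := fun x => by
    rw [mul_mul_mul_comm, ENNReal.mul_inv_cancel hk0 hkt, one_mul, ← mul_assoc,
      ENNReal.inv_mul_cancel hb0 hbt, one_mul]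
  refine (h4 _).trans ?_
  rw [← lintegral_const_mul' b _ hbt, smul_eq_mul]
  simp only [Pi.mul_apply, h1, mul_left_comm b]
  rfl

end Removal

/-! ### The discretised specification -/

section Discrete

open Filter Topology

variable {S : Type*} [DecidableEq S] [Countable S] {q : ℕ} [NeZero q]
  {Φ : Finset S → (S → Spin) → ℝ}

lemma measurable_discretise (q : ℕ) [NeZero q] {I : Type*} :
    Measurable (discretise q : (I → Spin) → I → Fin q) :=
  measurable_pi_lambda _ fun x => (measurable_arc q).comp (measurable_pi_apply x)

/-- The configurations whose discretisation in `Λ` is `s`. -/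
def arcEvent (Λ : Finset S) (s : Λ → Fin q) : Set (S → Spin) :=
  {ω | Λ.restrict (discretise q ω) = s}

lemma measurable_restrict_discretise (Λ : Finset S) :
    Measurable fun ω : S → Spin => Λ.restrict (discretise q ω) :=
  (Finset.measurable_restrict Λ).comp (measurable_discretise q)

lemma measurableSet_arcEvent (Λ : Finset S) (s : Λ → Fin q) : MeasurableSet (arcEvent Λ s) :=
  measurable_restrict_discretise Λ (measurableSet_singleton s)

lemma restrict_glue {E : Type*} (Λ : Finset S) (σ : Λ → E) (τ : {x // x ∉ Λ} → E) :
    Λ.restrict (glue Λ σ τ) = σ := by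
  ext x
  simp [glue]

lemma discretise_glue {Λ : Finset S} (σ : Λ → Spin) (τ : {x // x ∉ Λ} → Spin) :
    discretise q (glue Λ σ τ) = glue Λ (discretise q σ) (discretise q τ) := by
  ext x
  by_cases hx : x ∈ Λ <;> simp [discretise, glue, hx]

/-- The unknown constant `c` drops out of the quotient of the formulas for the indicator of the
event and for the function `1`. -/
lemma measure_arcEvent_eq_discreteProb (hΦ : IsRegular Φ) (hD : uniformDobrushinConst q Φ < 1)
    {Λ : Finset S} {ω' : {x // x ∉ Λ} → Fin q} {P : Measure (S → Spin)} [IsProbabilityMeasure P]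
    (h : IsConstrainedGibbs Φ (freeIn Λ ω') P) (s : Λ → Fin q) :
    P (arcEvent Λ s) = discreteProb q Φ Λ s ω' := by
  obtain ⟨c, hc0, hct, hc⟩ := exists_lintegral_eq_constrainedGibbs hΦ hD h
  have h1 := hc (fun _ => 1) measurable_const
  simp only [mul_one, lintegral_const, measure_univ] at h1
  have h2 := hc ((arcEvent Λ s).indicator 1)
    (measurable_one.indicator (measurableSet_arcEvent Λ s))
  rw [lintegral_indicator_one (measurableSet_arcEvent Λ s)] at h2
  have h3 : ∀ (τ : {x // x ∉ Λ} → Spin) (σ : Λ → Spin),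
      weight Φ Λ σ τ * (arcEvent Λ s).indicator 1 (glue Λ σ τ)
        = {σ | discretise q σ = s}.indicator (fun σ => weight Φ Λ σ τ) σ := by
    intro τ σ
    have : glue Λ σ τ ∈ arcEvent Λ s ↔ discretise q σ = s := by
      rw [arcEvent, Set.mem_ofPred_eq, discretise_glue, restrict_glue]
    by_cases hσ : discretise q σ = s
    · rw [Set.indicator_of_mem (this.2 hσ), Set.indicator_of_mem (by exact hσ)]
      simp
    · rw [Set.indicator_of_notMem (mt this.1 hσ), Set.indicator_of_notMem (by exact hσ), mul_zero]
  simp only [h3] at h2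
  rw [discreteProb, ← ENNReal.mul_div_mul_left _ _ hc0 hct, ← h1, ← h2, div_one]

/-- Indicators of arcs need not be continuous. Here the event involves only spins in `Λ`, all of
which are redrawn: its indicator depends on `σ` and not on `η`, and `η` enters only through the
continuous weight. -/
lemma continuous_resample_arcEvent {u : S → Measure Spin} [∀ x, IsProbabilityMeasure (u x)]
    {w : (S → Spin) → ℝ≥0∞} (hw : IsWeight w) (hc : Continuous w) (Λ : Finset S)
    (s : Λ → Fin q) : Continuous fun η => (resample u w Λ η).real (arcEvent Λ s) := by
  have hw' := hw.continuous_toReal hc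
  have hE := measurableSet_arcEvent Λ s
  have h1 : ∀ η, (resample u w Λ η).real (arcEvent Λ s)
      = (partitionFunction u w Λ η).toReal⁻¹ * ∫ σ, (w (Λ.piecewise σ η)).toReal *
        (arcEvent Λ s).indicator 1 σ ∂Measure.infinitePi u := by
    intro η
    have hm := measurable_piecewise_left Λ η
    rw [measureReal_def, resample_apply hw.measurable hE, ENNReal.toReal_mul, ENNReal.toReal_inv,
      ← integral_toReal (f := fun σ => w (Λ.piecewise σ η) *
        (arcEvent Λ s).indicator 1 (Λ.piecewise σ η))
        ((hw.measurable.mul (measurable_one.indicator hE)).fun_comp hm).aemeasurable]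
    · congr 1
      refine integral_congr_ae (.of_forall fun σ => ?_)
      have : Λ.piecewise σ η ∈ arcEvent Λ s ↔ σ ∈ arcEvent Λ s := by
        have : Λ.restrict (discretise q (Λ.piecewise σ η)) = Λ.restrict (discretise q σ) := by
          ext x
          simp [discretise]
        rw [arcEvent, Set.mem_ofPred_eq, Set.mem_ofPred_eq, this]
      by_cases hσ : σ ∈ arcEvent Λ s
      · simp [hσ, this.2 hσ]
      · simp [hσ, mt this.1 hσ]
    · refine .of_forall fun σ => ENNReal.mul_lt_top (hw.ne_top _).lt_top ?_
      by_cases hσ : Λ.piecewise σ η ∈ arcEvent Λ s <;> simp [hσ]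
  simp_rw [h1]
  refine Continuous.mul (Continuous.inv₀ ?_ fun η => ?_) ?_
  · simp_rw [partitionFunction_toReal hw]
    exact continuous_integral_piecewise hw' Λ
  · exact ENNReal.toReal_ne_zero.2 ⟨(hw.partitionFunction Λ).ne_zero η,
      (hw.partitionFunction Λ).ne_top η⟩
  · obtain ⟨M, hM⟩ := exists_bound_of_continuous hw'
    refine continuous_of_dominated (bound := fun _ => M) (fun η => ?_)
      (fun η => .of_forall fun σ => ?_) (integrable_const _)
      (.of_forall fun σ => (hw'.comp (continuous_piecewise_right Λ σ)).mul continuous_const)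
    · exact ((hw'.measurable.comp (measurable_piecewise_left Λ η)).mul
        (measurable_one.indicator hE)).aestronglyMeasurable
    · by_cases hσ : σ ∈ arcEvent Λ s
      · simpa [hσ] using hM (Λ.piecewise σ η)
      · simpa [hσ] using (norm_nonneg _).trans (hM η)

lemma IsInvariant.integral_arcEvent {u : S → Measure Spin} [∀ x, IsProbabilityMeasure (u x)]
    {w : (S → Spin) → ℝ≥0∞} (hw : IsWeight w) {Λ : Finset S} {P : Measure (S → Spin)}
    [IsProbabilityMeasure P] (h : IsInvariant u w Λ P) (s : Λ → Fin q) :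
    ∫ η, (resample u w Λ η).real (arcEvent Λ s) ∂P = P.real (arcEvent Λ s) := by
  have hE := measurableSet_arcEvent Λ s
  have := fun η => isProbabilityMeasure_resample (u := u) hw Λ η
  rw [measureReal_def, ← (isInvariant_iff_measure hw.measurable).1 h _ hE]
  exact integral_toReal ((Measure.measurable_coe hE).comp
    (measurable_resample hw.measurable)).aemeasurable (.of_forall fun η => measure_lt_top _ _)

/-- Laws that are asymptotically constrained Gibbs measures, free in `Λ`, give asymptotically the
probabilities `discreteProb` to the discretised configurations in `Λ`. -/
lemma tendsto_measure_arcEvent (hΦ : IsRegular Φ) (hD : uniformDobrushinConst q Φ < 1)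
    {Λ : Finset S} {ω' : {x // x ∉ Λ} → Fin q} {ι : Type*} {l : Filter ι}
    {P : ι → Measure (S → Spin)} [hP : ∀ i, IsProbabilityMeasure (P i)]
    (h : ∀ Δ, ∀ᶠ i in l,
      IsInvariant (fun x => spinLaw (freeIn Λ ω' x)) (boltzmann Φ Δ) Δ (P i))
    (s : Λ → Fin q) :
    Tendsto (fun i => P i (arcEvent Λ s)) l (𝓝 (discreteProb q Φ Λ s ω')) := by
  have hw := hΦ.isWeightFamily.isWeight
  have hwc := hΦ.isWeightFamily.continuous
  -- Along any ultrafilter a weak limit exists by compactness and is a constrained Gibbs measure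
  -- free in `Λ`. The value it gives the event does not depend on the ultrafilter.
  rw [tendsto_iff_ultrafilter]
  intro l' hl'
  obtain ⟨Q, hQ⟩ := exists_tendsto_probabilityMeasure l' fun i => ⟨P i, hP i⟩
  have hQG : IsConstrainedGibbs Φ (freeIn Λ ω') (Q : Measure (S → Spin)) := fun Δ =>
    isInvariant_of_tendsto (hw Δ) (hwc Δ) hQ (hl' (h Δ))
  rw [← measure_arcEvent_eq_discreteProb hΦ hD hQG s]
  have hk := continuous_resample_arcEvent (u := fun x => spinLaw (freeIn Λ ω' x)) (hw Λ) (hwc Λ)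
    Λ s
  have h1 := (ProbabilityMeasure.tendsto_iff_forall_integral_tendsto.1 hQ)
    (BoundedContinuousFunction.mkOfCompact ⟨_, hk⟩)
  -- Weak convergence does not apply directly to the arc event. Invariance in `Λ` first replaces its
  -- indicator by its resampled probability, which is continuous.
  have h2 : Tendsto (fun i => (P i).real (arcEvent Λ s)) l'
      (𝓝 ((Q : Measure (S → Spin)).real (arcEvent Λ s))) := by
    rw [← (hQG Λ).integral_arcEvent (hw Λ)]
    refine Tendsto.congr' ?_ h1
    filter_upwards [hl' (h Λ)] with i hi
    exact hi.integral_arcEvent (hw Λ) s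
  rw [← ofReal_measureReal]
  refine (ENNReal.tendsto_ofReal h2).congr fun i => ?_
  rw [ofReal_measureReal]

lemma eventually_freeIn_eq {Λ : Finset S} (ω' : {x // x ∉ Λ} → Fin q) (Δ : Finset S) :
    ∀ᶠ ζ in 𝓝 ω', ∀ x ∈ Δ, freeIn Λ ζ x = freeIn Λ ω' x := by
  rw [eventually_all_finset]
  intro x _
  by_cases hx : x ∈ Λ
  · simp [freeIn_of_mem _ hx]
  · have h : Tendsto (fun ζ : {x // x ∉ Λ} → Fin q => ζ ⟨x, hx⟩) (𝓝 ω') (𝓝 (ω' ⟨x, hx⟩)) :=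
      (continuous_apply _).tendsto ω'
    rw [nhds_discrete (Fin q), tendsto_pure] at h
    filter_upwards [h] with ζ hζ
    rw [freeIn_of_notMem _ hx, freeIn_of_notMem _ hx, hζ]

/-- Near `ω'` in the product topology the arcs agree on any given finite set, so Gibbs measures for
`ζ` satisfy, as `ζ` tends to `ω'`, each of the equations for `ω'`. -/
lemma continuous_discreteProb (hΦ : IsRegular Φ) (hD : uniformDobrushinConst q Φ < 1)
    (Λ : Finset S) (s : Λ → Fin q) : Continuous (discreteProb q Φ Λ s) := by
  have hw := hΦ.isWeightFamily.isWeight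
  choose P hP using fun ω' : {x // x ∉ Λ} → Fin q => exists_isConstrainedGibbs hΦ (freeIn Λ ω')
  refine continuous_iff_continuousAt.2 fun ω' => ?_
  refine (tendsto_measure_arcEvent hΦ hD (P := fun ζ => (P ζ : Measure (S → Spin)))
    (fun Δ => ?_) s).congr fun ζ => measure_arcEvent_eq_discreteProb hΦ hD (hP ζ) s
  filter_upwards [eventually_freeIn_eq ω' Δ] with ζ hζ
  exact (hP ζ Δ).congr (hw Δ).measurable fun x hx => by rw [hζ x hx]

lemma discreteSpec_apply (Λ : Finset S) (ω' : S → Fin q) (B : Set (S → Fin q))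
    (hB : MeasurableSet B) :
    discreteSpec q Φ Λ ω' B = ∑ s : Λ → Fin q, discreteProb q Φ Λ s (outside Λ ω') *
      B.indicator 1 (glue Λ s (outside Λ ω')) := by
  simp [discreteSpec, Measure.dirac_apply' _ hB]

lemma glue_restrict_discretise {Λ : Finset S} {ω' : {x // x ∉ Λ} → Fin q} {ω : S → Spin}
    (h : ∀ x, ω x ∈ arcSet (freeIn Λ ω' x)) :
    glue Λ (Λ.restrict (discretise q ω)) ω' = discretise q ω := by
  ext1 x
  by_cases hx : x ∈ Λ
  · simp [glue, hx]
  · have := h x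
    rw [freeIn_of_notMem _ hx, mem_arcSet_some] at this
    simp [glue, hx, discretise, this]

/-- The discrete kernel is the image of any Gibbs measure that is free in `Λ`. -/
lemma discreteSpec_eq_map (hΦ : IsRegular Φ) (hD : uniformDobrushinConst q Φ < 1)
    {Λ : Finset S} {ω' : S → Fin q} {P : Measure (S → Spin)} [IsProbabilityMeasure P]
    (h : IsConstrainedGibbs Φ (freeIn Λ (outside Λ ω')) P) :
    discreteSpec q Φ Λ ω' = P.map (discretise q) := by
  refine Measure.ext fun B hB => ?_
  have hB' : Measurable (B.indicator 1 : (S → Fin q) → ℝ≥0∞) := measurable_one.indicator hB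
  have hm := measurable_restrict_discretise (q := q) Λ
  rw [discreteSpec_apply Λ ω' B hB, ← lintegral_indicator_one hB,
    lintegral_map hB' (measurable_discretise q)]
  -- Off `Λ` the arcs are almost surely those of `ω'`, so only those in `Λ` are random.
  have h1 : ∫⁻ ω, B.indicator 1 (discretise q ω) ∂P
      = ∫⁻ ω, B.indicator 1 (glue Λ (Λ.restrict (discretise q ω)) (outside Λ ω')) ∂P := by
    refine lintegral_congr_ae ?_
    filter_upwards [h.ae_mem hΦ] with ω hω
    rw [glue_restrict_discretise hω]
  rw [h1, ← lintegral_map (f := fun s => B.indicator 1 (glue Λ s (outside Λ ω')))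
    (measurable_of_finite _) hm, lintegral_fintype]
  refine Finset.sum_congr rfl fun s _ => ?_
  rw [Measure.map_apply hm (measurableSet_singleton s), mul_comm]
  congr 1
  exact (measure_arcEvent_eq_discreteProb hΦ hD h s).symm

end Discrete

/-! ### The discretised Gibbs measures -/

section Image

open Filter Topology

variable {S : Type*} [DecidableEq S] [Countable S] {q : ℕ} [NeZero q]
  {Φ : Finset S → (S → Spin) → ℝ}

/-- The tower property for conditioning on a finite-valued variable; null values contribute zero on
both sides. -/
lemma lintegral_mul_cond_preimage {Ω R : Type*} [MeasurableSpace Ω] [MeasurableSpace R]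
    [Fintype R] [MeasurableSingletonClass R] (P : Measure Ω) [IsFiniteMeasure P] {X : Ω → R}
    (hX : Measurable X) (g : R → ℝ≥0∞) (E : Set Ω) :
    ∫⁻ ω, g (X ω) * P[|X ⁻¹' {X ω}] E ∂P = ∫⁻ ω in E, g (X ω) ∂P := by
  rw [← lintegral_map (f := fun r => g r * P[|X ⁻¹' {r}] E) (measurable_of_finite _) hX,
    ← lintegral_map (measurable_of_finite g) hX, lintegral_fintype, lintegral_fintype]
  refine Finset.sum_congr rfl fun r _ => ?_
  have hr := hX (measurableSet_singleton r)
  rw [Measure.map_apply hX (measurableSet_singleton r),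
    Measure.map_apply hX (measurableSet_singleton r), mul_assoc, cond_mul_eq_inter hr,
    Measure.restrict_apply hr]

lemma cond_apply_le_one {Ω : Type*} [MeasurableSpace Ω] (P : Measure Ω) [IsFiniteMeasure P]
    (C E : Set Ω) : P[|C] E ≤ 1 := by
  by_cases h : P C = 0
  · rw [cond_eq_zero_of_meas_eq_zero h]
    exact zero_le_one
  · have := cond_isProbabilityMeasure h
    exact prob_le_one

lemma spinLaw_arcSet_self (k : Option (Fin q)) : spinLaw k (arcSet k) = 1 :=
  (mem_ae_iff_prob_eq_one (measurableSet_arcSet k)).1 (ae_mem_arcSet k)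

lemma spinLaw_cond_self (k : Option (Fin q)) : (spinLaw k)[|arcSet k] = spinLaw k := by
  rw [spinLaw, cond_cond_eq_cond_inter (measurableSet_arcSet k) (measurableSet_arcSet k),
    Set.inter_self]

/-- At a free site conditioning on the arc of `θ` yields the law of that arc; at a constrained site
`θ` already lies in the prescribed arc and nothing changes. Free and pinned sites can therefore be
treated together. -/
lemma spinLaw_cond_arc {k : Option (Fin q)} {θ : Spin} (h : θ ∈ arcSet k) :
    spinLaw k (arcSet (some (arc q θ))) ≠ 0 ∧
      (spinLaw k)[|arcSet (some (arc q θ))] = spinLaw (some (arc q θ)) := by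
  cases k with
  | none => exact ⟨spinLaw_none_apply_ne_zero _, spinLaw_none_cond _⟩
  | some l =>
    rw [mem_arcSet_some.1 h, spinLaw_arcSet_self, spinLaw_cond_self]
    exact ⟨one_ne_zero, rfl⟩

/-- The discretised spins in a finite set `F` of sites off `Λ`. -/
def outsideArcs (q : ℕ) [NeZero q] {Λ : Finset S} (F : Finset {x // x ∉ Λ}) (ω : S → Spin) :
    F → Fin q := F.restrict (outside Λ (discretise q ω))

lemma measurable_outside_discretise (Λ : Finset S) :
    Measurable fun ω : S → Spin => outside Λ (discretise q ω) :=
  (measurable_outside Λ).comp (measurable_discretise q)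

lemma measurable_outsideArcs {Λ : Finset S} (F : Finset {x // x ∉ Λ}) :
    Measurable (outsideArcs q F) :=
  (Finset.measurable_restrict F).comp (measurable_outside_discretise Λ)

lemma preimage_outsideArcs {Λ : Finset S} (F : Finset {x // x ∉ Λ}) (ω : S → Spin) :
    outsideArcs q F ⁻¹' {outsideArcs q F ω}
      = {ζ | ∀ x ∈ F.map (Function.Embedding.subtype _), ζ x ∈ arcSet (some (arc q (ω x)))} := by
  ext ζ
  simp only [Set.mem_preimage, Set.mem_singleton_iff, Set.mem_ofPred_eq, mem_arcSet_some]
  constructor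
  · intro h x hx
    obtain ⟨y, hy, rfl⟩ := Finset.mem_map.1 hx
    exact congrFun h ⟨y, hy⟩
  · intro h
    ext1 y
    exact h y.1.1 (Finset.mem_map.2 ⟨y.1, y.2, rfl⟩)

/-- Once `F` contains `Δ \ Λ`, conditioning on the arcs in `F` gives every site of `Δ` off `Λ` the
law of its arc, while the sites in `Λ` stay free. The conditioned measures thus satisfy more and
more of the equations for the arcs of `ω`. -/
lemma tendsto_cond_arcEvent (hΦ : IsRegular Φ) (hD : uniformDobrushinConst q Φ < 1)
    {Λ : Finset S} {κ : S → Option (Fin q)} (hκ : ∀ x ∈ Λ, κ x = none) {P : Measure (S → Spin)}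
    [IsProbabilityMeasure P] (h : IsConstrainedGibbs Φ κ P) (s : Λ → Fin q) {ω : S → Spin}
    (hω : ∀ x, ω x ∈ arcSet (κ x))
    (hP : ∀ F : Finset {x // x ∉ Λ}, P (outsideArcs q F ⁻¹' {outsideArcs q F ω}) ≠ 0) :
    Tendsto (fun F : Finset {x // x ∉ Λ} =>
      P[|outsideArcs q F ⁻¹' {outsideArcs q F ω}] (arcEvent Λ s)) atTop
      (𝓝 (discreteProb q Φ Λ s (outside Λ (discretise q ω)))) := by
  have hw := hΦ.isWeightFamily.isWeight
  have hprob : ∀ F : Finset {x // x ∉ Λ},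
      IsProbabilityMeasure P[|outsideArcs q F ⁻¹' {outsideArcs q F ω}] :=
    fun F => cond_isProbabilityMeasure (hP F)
  refine tendsto_measure_arcEvent hΦ hD (fun Δ => ?_) s
  filter_upwards [eventually_ge_atTop (Δ.subtype (· ∉ Λ))] with F hF
  have hA : ∀ x ∈ F.map (Function.Embedding.subtype (· ∉ Λ)),
      spinLaw (κ x) (arcSet (some (arc q (ω x)))) ≠ 0 := fun x _ => (spinLaw_cond_arc (hω x)).1
  have hpc := isProbabilityMeasure_condLaw (u := fun x => spinLaw (κ x))
    (A := fun x => arcSet (some (arc q (ω x)))) hA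
  have h1 := (((h Δ).isReversible (hw Δ).measurable).cond (hw Δ).measurable
    (fun x => measurableSet_arcSet _) hA).isInvariant (hw Δ)
  rw [preimage_outsideArcs]
  refine h1.congr (hw Δ).measurable fun x hx => ?_
  by_cases hxΛ : x ∈ Λ
  · have hxF : x ∉ F.map (Function.Embedding.subtype (· ∉ Λ)) := by
      intro hxF
      obtain ⟨y, -, rfl⟩ := Finset.mem_map.1 hxF
      exact y.2 hxΛ
    rw [condLaw, if_neg hxF, freeIn_of_mem _ hxΛ, hκ x hxΛ]
  · have hxF : x ∈ F.map (Function.Embedding.subtype (· ∉ Λ)) :=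
      Finset.mem_map.2 ⟨⟨x, hxΛ⟩, hF (Finset.mem_subtype.2 hx), rfl⟩
    rw [condLaw, if_pos hxF, (spinLaw_cond_arc (hω x)).2, freeIn_of_notMem _ hxΛ]
    rfl

lemma ae_measure_preimage_ne_zero {Ω R : Type*} [MeasurableSpace Ω] [Finite R] (P : Measure Ω)
    (X : Ω → R) : ∀ᵐ ω ∂P, P (X ⁻¹' {X ω}) ≠ 0 := by
  have h : {ω | ¬P (X ⁻¹' {X ω}) ≠ 0} ⊆ ⋃ r ∈ {r : R | P (X ⁻¹' {r}) = 0}, X ⁻¹' {r} := by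
    intro ω hω
    simp only [Set.mem_iUnion]
    exact ⟨X ω, not_not.1 hω, rfl⟩
  refine measure_mono_null h ((measure_biUnion_null_iff (Set.to_countable _)).2 fun r hr => hr)

/-- This says that `discreteProb` is a version of the conditional probability of the arcs `s` in `Λ`
given all arcs outside. The elementary conditional probabilities given finitely many arcs converge
to it almost everywhere, so the identity follows by dominated convergence on each finite-dimensional
event. -/
lemma withDensity_discreteProb (hΦ : IsRegular Φ) (hD : uniformDobrushinConst q Φ < 1)
    {Λ : Finset S} {κ : S → Option (Fin q)} (hκ : ∀ x ∈ Λ, κ x = none) {P : Measure (S → Spin)}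
    [IsProbabilityMeasure P] (h : IsConstrainedGibbs Φ κ P) (s : Λ → Fin q) :
    (P.map fun ω => outside Λ (discretise q ω)).withDensity (discreteProb q Φ Λ s)
      = (P.restrict (arcEvent Λ s)).map fun ω => outside Λ (discretise q ω) := by
  have hY := measurable_outside_discretise (q := q) Λ
  have hd : Measurable (discreteProb q Φ Λ s) := (continuous_discreteProb hΦ hD Λ s).measurable
  have hE := measurableSet_arcEvent Λ s
  have hlim : IsProjectiveLimit ((P.restrict (arcEvent Λ s)).map fun ω =>
      outside Λ (discretise q ω)) fun G : Finset {x // x ∉ Λ} =>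
      ((P.restrict (arcEvent Λ s)).map fun ω => outside Λ (discretise q ω)).map G.restrict :=
    fun _ => rfl
  refine IsProjectiveLimit.unique (fun G => Measure.ext_of_singleton fun t => ?_) hlim
  have hGm : MeasurableSet (G.restrict ⁻¹' {t} : Set ({x // x ∉ Λ} → Fin q)) :=
    (Finset.measurable_restrict G) (measurableSet_singleton t)
  have hGY : MeasurableSet (outsideArcs q G ⁻¹' {t}) :=
    measurable_outsideArcs G (measurableSet_singleton t)
  rw [Measure.map_apply (Finset.measurable_restrict G) (measurableSet_singleton t),
    Measure.map_apply (Finset.measurable_restrict G) (measurableSet_singleton t),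
    withDensity_apply _ hGm, Measure.restrict_map hY hGm, lintegral_map hd hY,
    Measure.map_apply hY hGm]
  change ∫⁻ ω in outsideArcs q G ⁻¹' {t}, _ ∂P = P.restrict _ (outsideArcs q G ⁻¹' {t})
  rw [← lintegral_indicator hGY, ← lintegral_indicator_one hGY]
  have h1 : ∀ ω : S → Spin, (outsideArcs q G ⁻¹' {t}).indicator
      (fun ω => discreteProb q Φ Λ s (outside Λ (discretise q ω))) ω
      = (outsideArcs q G ⁻¹' {t}).indicator 1 ω *
        discreteProb q Φ Λ s (outside Λ (discretise q ω)) := by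
    intro ω
    by_cases hω : ω ∈ outsideArcs q G ⁻¹' {t}
    · rw [Set.indicator_of_mem hω, Set.indicator_of_mem hω, Pi.one_apply, one_mul]
    · rw [Set.indicator_of_notMem hω, Set.indicator_of_notMem hω, zero_mul]
  simp only [h1]
  classical
  have h2 : Tendsto (fun F : Finset {x // x ∉ Λ} => ∫⁻ ω,
      (outsideArcs q G ⁻¹' {t}).indicator 1 ω *
        P[|outsideArcs q F ⁻¹' {outsideArcs q F ω}] (arcEvent Λ s) ∂P) atTop
      (𝓝 (∫⁻ ω, (outsideArcs q G ⁻¹' {t}).indicator 1 ω *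
        discreteProb q Φ Λ s (outside Λ (discretise q ω)) ∂P)) := by
    refine tendsto_lintegral_filter_of_dominated_convergence (fun _ => 1)
      (.of_forall fun F => ?_) (.of_forall fun F => .of_forall fun ω => ?_) (by simp) ?_
    · exact (measurable_one.indicator hGY).mul ((measurable_of_finite
        fun r => P[|outsideArcs q F ⁻¹' {r}] (arcEvent Λ s)).comp (measurable_outsideArcs F))
    · refine mul_le_one' (Set.indicator_le_self _ _ _) (cond_apply_le_one _ _ _)
    · filter_upwards [h.ae_mem hΦ, ae_all_iff.2 fun F : Finset {x // x ∉ Λ} =>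
        ae_measure_preimage_ne_zero P (outsideArcs q F)] with ω hω1 hω2
      refine ENNReal.Tendsto.const_mul (tendsto_cond_arcEvent hΦ hD hκ h s hω1 hω2) (.inr ?_)
      by_cases hω : ω ∈ outsideArcs q G ⁻¹' {t} <;> simp [hω]
  refine tendsto_nhds_unique h2 (tendsto_const_nhds.congr' ?_)
  filter_upwards [eventually_ge_atTop G] with F hGF
  -- As soon as `F` contains `G`, the event is a function of the arcs in `F`. The tower property
  -- then makes the integrals constant, equal to the desired mass.
  have h3 : ∀ ω : S → Spin, (outsideArcs q G ⁻¹' {t}).indicator (1 : (S → Spin) → ℝ≥0∞) ω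
      = if Finset.restrict₂ (π := fun _ => Fin q) hGF (outsideArcs q F ω) = t then 1 else 0 := by
    intro ω
    have : Finset.restrict₂ (π := fun _ => Fin q) hGF (outsideArcs q F ω) = outsideArcs q G ω := rfl
    rw [this, Set.indicator_apply]
    exact if_congr Iff.rfl rfl rfl
  simp only [h3]
  exact (lintegral_mul_cond_preimage P (measurable_outsideArcs F)
    (fun r => if Finset.restrict₂ (π := fun _ => Fin q) hGF r = t then 1 else 0) _).symm

/-- The image under discretisation of a Gibbs measure that is free in `Λ` satisfies the DLR
equation of the discrete kernel in `Λ`. -/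
theorem lintegral_discreteSpec (hΦ : IsRegular Φ) (hD : uniformDobrushinConst q Φ < 1)
    {Λ : Finset S} {κ : S → Option (Fin q)} (hκ : ∀ x ∈ Λ, κ x = none) {P : Measure (S → Spin)}
    [IsProbabilityMeasure P] (h : IsConstrainedGibbs Φ κ P) {B : Set (S → Fin q)}
    (hB : MeasurableSet B) :
    ∫⁻ ω', discreteSpec q Φ Λ ω' B ∂P.map (discretise q) = P.map (discretise q) B := by
  have hT : Measurable (discretise q : (S → Spin) → S → Fin q) := measurable_discretise q
  have hY := measurable_outside_discretise (q := q) Λ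
  have hd := fun s : Λ → Fin q => (continuous_discreteProb hΦ hD Λ s).measurable
  have hI : ∀ s : Λ → Fin q, Measurable fun τ : {x // x ∉ Λ} → Fin q =>
      (B.indicator 1 (glue Λ s τ) : ℝ≥0∞) := fun s =>
    (measurable_one.indicator hB).comp (measurable_glue_right Λ s)
  have hterm : ∀ s : Λ → Fin q, Measurable fun τ : {x // x ∉ Λ} → Fin q =>
      discreteProb q Φ Λ s τ * B.indicator 1 (glue Λ s τ) := fun s => (hd s).mul (hI s)
  simp only [discreteSpec_apply Λ _ B hB]
  rw [lintegral_finsetSum _ fun s _ => (hterm s).fun_comp (measurable_outside Λ)]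
  -- The term of `s` is the probability that the image lies in `B` and the arcs in `Λ` equal `s`;
  -- these events partition the preimage of `B`.
  have h1 : ∀ s : Λ → Fin q, ∫⁻ ω', discreteProb q Φ Λ s (outside Λ ω') *
      B.indicator 1 (glue Λ s (outside Λ ω')) ∂P.map (discretise q)
      = P.restrict (discretise q ⁻¹' B)
        ((fun ω => Λ.restrict (discretise q ω)) ⁻¹' {s}) := by
    intro s
    have hE := measurableSet_arcEvent Λ s
    rw [lintegral_map ((hterm s).fun_comp (measurable_outside Λ)) hT, ← lintegral_map (hterm s) hY]
    have h2 := lintegral_withDensity_eq_lintegral_mul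
      (P.map fun ω => outside Λ (discretise q ω)) (hd s) (hI s)
    simp only [Pi.mul_apply] at h2
    rw [← h2, withDensity_discreteProb hΦ hD hκ h s, lintegral_map (hI s) hY]
    have h3 : ∀ ω ∈ arcEvent Λ s, (B.indicator 1 (glue Λ s (outside Λ (discretise q ω))) : ℝ≥0∞)
        = (discretise q ⁻¹' B).indicator 1 ω := by
      intro ω hω
      have h4 : glue Λ s (outside Λ (discretise q ω)) = discretise q ω := by
        rw [← show Λ.restrict (discretise q ω) = s from hω, glue_outside_self]
      rw [h4]
      rfl
    rw [setLIntegral_congr_fun hE h3, lintegral_indicator_one (hT hB),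
      Measure.restrict_apply (hT hB), Set.inter_comm]
    exact (Measure.restrict_apply hE).symm
  simp only [h1]
  have h5 := sum_measure_preimage_singleton (μ := P.restrict (discretise q ⁻¹' B))
    (f := fun ω => Λ.restrict (discretise q ω)) Finset.univ
    fun s _ => measurableSet_arcEvent Λ s
  rw [h5, Finset.coe_univ, Set.preimage_univ, Measure.restrict_apply_univ,
    Measure.map_apply hT hB]

lemma measurable_outside_cylinderEvents {E : Type*} [MeasurableSpace E] (Λ : Finset S) :
    @Measurable _ _ (cylinderEvents ((Λ : Set S)ᶜ)) _ (outside Λ : (S → E) → _) := by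
  refine @measurable_pi_lambda _ _ _ (cylinderEvents ((Λ : Set S)ᶜ)) _ _ fun x => ?_
  exact measurable_cylinderEvent_apply (by simp)

lemma mem_iff_of_measurableSet_cylinderEvents {E : Type*} [MeasurableSpace E] {Λ : Finset S}
    {B : Set (S → E)} (hB : MeasurableSet[cylinderEvents ((Λ : Set S)ᶜ)] B) {ω ω' : S → E}
    (h : outside Λ ω = outside Λ ω') : ω ∈ B ↔ ω' ∈ B := by
  have hle : cylinderEvents (X := fun _ : S => E) ((Λ : Set S)ᶜ)
      ≤ MeasurableSpace.comap (outside Λ) MeasurableSpace.pi := by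
    refine iSup₂_le fun x hx => ?_
    rintro _ ⟨A, hA, rfl⟩
    exact ⟨(fun τ : {x // x ∉ Λ} → E => τ ⟨x, by simpa using hx⟩) ⁻¹' A,
      measurable_pi_apply _ hA, rfl⟩
  obtain ⟨B', -, rfl⟩ := hle B hB
  simp only [Set.mem_preimage, h]

theorem isSpecification_discreteSpec (hΦ : IsRegular Φ) (hD : uniformDobrushinConst q Φ < 1) :
    IsSpecification (discreteSpec q Φ) := by
  have hmap : ∀ (Λ : Finset S) (η : S → Fin q), ∃ P : ProbabilityMeasure (S → Spin),
      IsConstrainedGibbs Φ (freeIn Λ (outside Λ η)) (P : Measure (S → Spin)) ∧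
      discreteSpec q Φ Λ η = (P : Measure (S → Spin)).map (discretise q) := fun Λ η => by
    obtain ⟨P, hP⟩ := exists_isConstrainedGibbs hΦ (freeIn Λ (outside Λ η))
    exact ⟨P, hP, discreteSpec_eq_map hΦ hD hP⟩
  have hprob : ∀ (Λ : Finset S) (η : S → Fin q), IsProbabilityMeasure (discreteSpec q Φ Λ η) := by
    intro Λ η
    obtain ⟨P, -, h⟩ := hmap Λ η
    rw [h]
    exact Measure.isProbabilityMeasure_map (measurable_discretise q).aemeasurable
  refine ⟨hprob, fun Λ B hB => ?_, fun Λ B hB η => ?_, fun Δ Λ hΔ B hB η => ?_⟩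
  · simp only [discreteSpec_apply Λ _ B hB]
    have h1 : Measurable fun τ : {x // x ∉ Λ} → Fin q => ∑ s : Λ → Fin q,
        discreteProb q Φ Λ s τ * B.indicator 1 (glue Λ s τ) :=
      Finset.measurable_sum _ fun s _ => (continuous_discreteProb hΦ hD Λ s).measurable.mul
        ((measurable_one.indicator hB).comp (measurable_glue_right Λ s))
    exact h1.comp (measurable_outside_cylinderEvents Λ)
  · have hB' : MeasurableSet B := cylinderEvents_le_pi B hB
    have h1 : ∀ s : Λ → Fin q, (B.indicator 1 (glue Λ s (outside Λ η)) : ℝ≥0∞)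
        = B.indicator 1 η := by
      intro s
      have := mem_iff_of_measurableSet_cylinderEvents hB
        (ω := glue Λ s (outside Λ η)) (ω' := η) (outside_glue _ _ _)
      by_cases hη : η ∈ B
      · rw [Set.indicator_of_mem hη, Set.indicator_of_mem (this.2 hη)]
        rfl
      · rw [Set.indicator_of_notMem hη, Set.indicator_of_notMem (mt this.1 hη)]
    have h2 := (hprob Λ η).measure_univ
    rw [discreteSpec_apply Λ η _ .univ] at h2
    simp only [Set.indicator_univ, Pi.one_apply, mul_one] at h2
    rw [discreteSpec_apply Λ η B hB']
    simp only [h1]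
    rw [← Finset.sum_mul, h2, one_mul]
  -- Consistency: the kernel in `Λ` is the image of a Gibbs measure free in `Λ`, hence free in `Δ`,
  -- so the DLR equation in `Δ` holds for it.
  · obtain ⟨P, hP, h⟩ := hmap Λ η
    rw [h]
    exact lintegral_discreteSpec hΦ hD (fun x hx => freeIn_of_mem _ (hΔ hx)) hP hB

theorem isGibbs_map_discretise (hΦ : IsRegular Φ) (hD : uniformDobrushinConst q Φ < 1)
    {μ : Measure (S → Spin)} (hμ : IsGibbs (gibbsSpec Φ) μ) :
    IsGibbs (discreteSpec q Φ) (μ.map (discretise q)) := by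
  have := hμ.prob
  exact ⟨Measure.isProbabilityMeasure_map (measurable_discretise q).aemeasurable,
    fun Λ B hB => lintegral_discreteSpec hΦ hD (fun _ _ => rfl) (hμ.isConstrainedGibbs hΦ) hB⟩

end Image

/-! ### Regularity of the long-range rotator potential -/

section LongRange

lemma continuous_spinCos : Continuous spinCos :=
  Real.continuous_cos.quotient_liftOn' _

lemma abs_spinCos_le_one (θ : Spin) : |spinCos θ| ≤ 1 := by
  induction θ using QuotientAddGroup.induction_on with
  | H t => exact Real.abs_cos_le_one t

lemma latticeDist_nonneg {d : ℕ} (x y : Fin d → ℤ) : 0 ≤ latticeDist x y := Real.sqrt_nonneg _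

/-- The differences `x - y` run injectively through a lattice of rank `d`, over which `‖v‖ ^ (-α)`
is summable for `α > d`. The single term `y = x` is harmless. -/
lemma summable_latticeDist_rpow {d : ℕ} {α : ℝ} (hα : (d : ℝ) < α) (x : Fin d → ℤ) :
    Summable fun y => latticeDist x y ^ (-α) := by
  let b : Module.Basis (Fin d) ℝ (EuclideanSpace ℝ (Fin d)) :=
    (EuclideanSpace.basisFun (Fin d) ℝ).toBasis
  let L : Submodule ℤ (EuclideanSpace ℝ (Fin d)) := Submodule.span ℤ (Set.range b)
  have hL : Module.finrank ℤ L = d := by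
    rw [ZLattice.rank ℝ L, finrank_euclideanSpace, Fintype.card_fin]
  have hs := ZLattice.summable_norm_rpow L (-α) (by rw [hL]; linarith)
  have hmem : ∀ y : Fin d → ℤ,
      WithLp.toLp 2 (fun i => (x i : ℝ) - (y i : ℝ)) ∈ L := by
    intro y
    have h : WithLp.toLp 2 (fun i => (x i : ℝ) - (y i : ℝ)) = ∑ i, (x i - y i) • b i := by
      ext j
      simp [b, Finset.sum_apply, Pi.single_apply]
    rw [h]
    exact Submodule.sum_mem _ fun i _ =>
      Submodule.smul_mem _ _ (Submodule.subset_span (Set.mem_range_self i))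
  have hinj : Function.Injective fun y : Fin d → ℤ => (⟨_, hmem y⟩ : L) := by
    intro y z h
    ext i
    have h1 := congrFun (congrArg WithLp.ofLp (Subtype.ext_iff.1 h)) i
    simpa using h1
  refine (hs.comp_injective hinj).congr fun y => ?_
  simp [latticeDist, EuclideanSpace.norm_eq]

/-- A bound for the long-range potential on `A`. -/
def longRangeBound (d : ℕ) (α β : ℝ) (A : Finset (Fin d → ℤ)) : ℝ :=
  if A.card = 2 then |β| * ((1 / 2) * ∑ p ∈ A.offDiag, latticeDist p.1 p.2 ^ (-α)) else 0

lemma abs_longRange_le (d : ℕ) (α β : ℝ) (A : Finset (Fin d → ℤ)) (ω : (Fin d → ℤ) → Spin) :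
    |longRange d α β A ω| ≤ longRangeBound d α β A := by
  unfold longRange longRangeBound
  split_ifs
  · rw [abs_mul, abs_mul, abs_of_pos (one_half_pos (α := ℝ))]
    gcongr
    refine (Finset.abs_sum_le_sum_abs _ _).trans (Finset.sum_le_sum fun p _ => ?_)
    have h := Real.rpow_nonneg (latticeDist_nonneg p.1 p.2) (-α)
    rw [abs_mul, abs_of_nonneg h]
    exact mul_le_of_le_one_right h (abs_spinCos_le_one _)
  · rw [abs_zero]

lemma longRangeBound_pair (d : ℕ) (α β : ℝ) {x y : Fin d → ℤ} (h : x ≠ y) :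
    longRangeBound d α β {x, y} = |β| * latticeDist x y ^ (-α) := by
  -- For coupling `|β|` and the constant configuration all cosines equal `1`, and the potential
  -- coincides with its bound.
  have h1 := longRange_pair d α |β| h 0
  have h2 : spinCos 0 = 1 := Real.cos_zero
  simp only [longRange, Pi.zero_apply, sub_self, h2, mul_one] at h1
  exact h1

theorem isRegular_longRange {d : ℕ} {α : ℝ} (hα : (d : ℝ) < α) (β : ℝ) :
    IsRegular (longRange d α β) where
  continuous A := by
    unfold longRange
    split_ifs
    · refine continuous_const.mul (continuous_const.mul (continuous_finsetSum _ fun p _ => ?_))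
      exact continuous_const.mul (continuous_spinCos.comp
        ((continuous_apply p.1).sub (continuous_apply p.2)))
    · exact continuous_const
  congr A ω ω' h := by
    unfold longRange
    rw [Finset.sum_congr rfl fun p hp => ?_]
    rw [Finset.mem_offDiag] at hp
    rw [h _ hp.1, h _ hp.2.1]
  summable := by
    refine ⟨longRangeBound d α β, abs_longRange_le d α β, fun x => ?_⟩
    -- The sets containing `x` with nonzero bound are among the pairs `{x, y}`, indexed by their
    -- other point; this reduces the sum over sets to one over sites.
    let i : {y : Fin d → ℤ // y ≠ x} → Finset (Fin d → ℤ) := fun y => {x, y.1}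
    have hi : Function.Injective i := by
      intro y z h
      have h1 : y.1 ∈ i z := by
        rw [← h]
        simp [i]
      rcases Finset.mem_insert.1 h1 with h2 | h2
      · exact absurd h2 y.2
      · exact Subtype.ext (Finset.mem_singleton.1 h2)
    refine (hi.summable_iff fun A hA => ?_).1 ?_
    · by_contra h
      have hx : x ∈ A := by
        by_contra hx
        exact h (if_neg hx)
      rw [if_pos hx] at h
      have hc : A.card = 2 := by
        by_contra hc
        exact h (if_neg hc)
      obtain ⟨u, v, huv, rfl⟩ := Finset.card_eq_two.1 hc
      rcases Finset.mem_insert.1 hx with rfl | hv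
      · exact hA ⟨⟨v, huv.symm⟩, rfl⟩
      · obtain rfl := Finset.mem_singleton.1 hv
        exact hA ⟨⟨u, huv⟩, Finset.pair_comm _ _⟩
    · refine (((summable_latticeDist_rpow hα x).mul_left |β|).comp_injective
        Subtype.val_injective).congr fun y => ?_
      have hx : x ∈ i y := Finset.mem_insert_self _ _
      simp only [Function.comp_apply]
      rw [if_pos hx, longRangeBound_pair d α β y.2.symm]

end LongRange

end DiscretisedGibbs

end

theorem mainTheorem9 (d : ℕ) (hd : d = 1 ∨ d = 2) (α β : ℝ)
    (hα : α ∈ Set.Ioo (d : ℝ) (2 * (d : ℝ))) (q : ℕ) [NeZero q]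
    (hc : DiscretisedGibbs.uniformDobrushinConst q (DiscretisedGibbs.longRange d α β) < 1) :
    -- the constrained Gibbs measures that enter the definition of `γ'` exist and are unique
    (∀ (Λ : Finset (Fin d → ℤ)) (ω' : {x // x ∉ Λ} → Fin q),
      ∃! ν : MeasureTheory.Measure ({x // x ∉ Λ} → DiscretisedGibbs.Spin),
        DiscretisedGibbs.IsGibbs
          (DiscretisedGibbs.constrainedSpec q
            (DiscretisedGibbs.restrictPotential (DiscretisedGibbs.longRange d α β) Λ) ω') ν) ∧
    DiscretisedGibbs.IsSpecification
      (DiscretisedGibbs.discreteSpec q (DiscretisedGibbs.longRange d α β)) ∧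
    ∀ μ : MeasureTheory.Measure ((Fin d → ℤ) → DiscretisedGibbs.Spin),
      DiscretisedGibbs.IsGibbs
        (DiscretisedGibbs.gibbsSpec (DiscretisedGibbs.longRange d α β)) μ →
      DiscretisedGibbs.IsGibbs
        (DiscretisedGibbs.discreteSpec q (DiscretisedGibbs.longRange d α β))
        (μ.map (DiscretisedGibbs.discretise q)) := by
  have hΦ := DiscretisedGibbs.isRegular_longRange hα.1 β
  exact ⟨fun Λ ω' => DiscretisedGibbs.existsUnique_isGibbs_restrictPotential hΦ hc Λ ω',
    DiscretisedGibbs.isSpecification_discreteSpec hΦ hc,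
    fun μ hμ => DiscretisedGibbs.isGibbs_map_discretise hΦ hc hμ⟩
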